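/- Setting. Let $s\in\mathbb N$, $s\ge 1$, be the number of spin states and $k_F\ge 1$. Put $B_F=\{p\in\mathbb Z^3:|p|\le k_F\}$, $B_F^c=\mathbb Z^3\setminus B_F$, $\mathbb Z^3_*=\mathbb Z^3\setminus\{0\}$ and $N=s|B_F|$. Let $\mathcal H_N=\bigwedge^N L^2(\mathbb T^3;\mathbb C^s)$, let $c_{p,\sigma},c_{p,\sigma}^*$ be the fermionic annihilation and creation operators of the plane waves $u_{p,\sigma}(x)=(2\pi)^{-3/2}e^{ip\cdot x}v_\sigma$ ($p\in\mathbb Z^3$, $1\le\sigma\le s$), let $\tilde c_{p,\sigma}=c_{p,\sigma}$ for $p\in B_F^c$ and $\tilde c_{p,\sigma}=c_{p,\sigma}^*$ for $p\in B_F$, and let $\mathcal N_E=\sum_{p\in B_F^c,\sigma}c_{p,\sigma}^*c_{p,\sigma}$. Let $\hat V_k\in\mathbb R$ satisfy $\hat V_k=\hat V_{-k}\ge 0$ for $k\in\mathbb Z^3_*$ and $\sum_{k\in\mathbb Z^3_*}\hat V_k^2<\infty$. For $k\in\mathbb Z^3_*$ let $L_k=(B_F+k)\setminus B_F$ and $D_k=D_{1,k}+D_{2,k}$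 with $$D_{1,k}=\sum_{q\in B_F\cap(B_F+k),\,\sigma}c_{q-k,\sigma}^*c_{q,\sigma},\qquad D_{2,k}=\sum_{q\in B_F^c\cap(B_F^c+k),\,\sigma}c_{q-k,\sigma}^*c_{q,\sigma},$$ and define $$\mathcal Q=\frac{k_F^{-1}}{2(2\pi)^3}\sum_{k\in\mathbb Z^3_*}\hat V_k\Big(D_k^*D_k-\sum_{p\in L_k,\,\sigma}\big(c_{p,\sigma}^*c_{p,\sigma}+c_{p-k,\sigma}c_{p-k,\sigma}^*\big)\Big),$$ $$G=\frac{k_F^{-1}}{(2\pi)^3}\sum_{k\in\mathbb Z^3_*}\hat V_k\Big(\sum_{q\in B_F,\,\sigma}1_{B_F}(q+k)\,\tilde c_{q,\sigma}^*\tilde c_{q,\sigma}-\sum_{p\in B_F^c,\,\sigma}1_{B_F}(p-k)\,\tilde c_{p,\sigma}^*\tilde c_{p,\sigma}\Big),$$ $$\mathcal Q_{LR}=\frac{k_F^{-1}}{2(2\pi)^3}\sum_{0<|k|\le 2k_F}\hat V_k\Big(\sum_{p,q\in B_F\cap(B_F+k),\,\sigma,\tau}\tilde c_{p-k,\sigma}^*\tilde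 c_{q,\tau}^*\tilde c_{q-k,\tau}\tilde c_{p,\sigma}+D_{1,k}^*D_{2,k}+D_{2,k}^*D_{1,k}\Big),$$ $$\mathcal Q_{SR}=\frac{k_F^{-1}}{2(2\pi)^3}\sum_{k\in\mathbb Z^3_*}\hat V_k\sum_{p,q\in B_F^c\cap(B_F^c-k),\,\sigma,\tau}\tilde c_{p+k,\sigma}^*\tilde c_{q,\tau}^*\tilde c_{q+k,\tau}\tilde c_{p,\sigma}.$$ On the real space $\ell^2(L_k)$ with standard basis $(e_p)$ let $h_ke_p=\lambda_{k,p}e_p$ with $\lambda_{k,p}=\frac12(|p|^2-|p-k|^2)$, $P_k=\langle v_k,\cdot\rangle v_k$ with $v_k=\big(\frac{s\hat V_kk_F^{-1}}{2(2\pi)^3}\big)^{1/2}\sum_{p\in L_k}e_p$, and $$K_k=-\tfrac12\log\Big(h_k^{-1/2}\big(h_k^{1/2}(h_k+2P_k)h_k^{1/2}\big)^{1/2}h_k^{-1/2}\Big).$$ With $b_{k,p}=s^{-1/2}\sum_{\sigma}c_{p-k,\sigma}^*c_{p,\sigma}$ let $$\mathcal K=\tfrac12\sum_{l\in\mathbb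 Z^3_*}\sum_{p,q\in L_l}\langle e_p,K_le_q\rangle\big(b_{l,p}b_{-l,-q}-b_{-l,-q}^*b_{l,p}^*\big)$$ on $\mathcal H_N$, and let $D(H_{\mathrm{kin}})\subset\mathcal H_N$ be the domain of $H_{\mathrm{kin}}=\sum_{p,\sigma}|p|^2c_{p,\sigma}^*c_{p,\sigma}$. Theorem. There are a constant $C>0$ depending only on $\sum_{k\in\mathbb Z^3_*}\hat V_k^2$ and a constant $C'>0$ depending only on $\sum_{k\in\mathbb Z^3_*}\hat V_k^2$ and $s$ such that the following holds for all $k_F\ge1$. The sum defining $\mathcal K$ converges unconditionally in operator norm on $\mathcal H_N$; the quadratic forms of $G$ and $\mathcal Q_{LR}$ are defined by convergent sums on $\mathcal H_N$, those of $\mathcal Q$ and $\mathcal Q_{SR}$ on $D(H_{\mathrm{kin}})$, and in the sense of quadratic forms on $D(H_{\mathrm{kin}})$ $$\mathcal Q=G+\mathcal Q_{LR}+\mathcal Q_{SR}.$$ For every $\Psi\in\mathcal H_N$ $$|\langle\Psi,G\Psi\rangle|\le C\sqrt{\sum_{k\in\mathbb Z^3_*}\hat V_k^2\min\{|k|,k_F\}}\;\langle\Psi,\mathcal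 N_E\Psi\rangle,\qquad |\langle\Psi,\mathcal Q_{LR}\Psi\rangle|\le C\sqrt{\sum_{k\in\mathbb Z^3_*}\hat V_k^2\min\{|k|,k_F\}}\;\langle\Psi,\mathcal N_E^2\Psi\rangle .$$ Moreover there is a bounded operator $\mathcal G$ on $\mathcal H_N$ such that, in the sense of quadratic forms on $D(H_{\mathrm{kin}})$ (in particular the sum defining $\mathcal Q_{SR}$ also converges on $e^{-\mathcal K}D(H_{\mathrm{kin}})$), $$e^{\mathcal K}\mathcal Q_{SR}e^{-\mathcal K}=\mathcal Q_{SR}+\int_0^1e^{t\mathcal K}\big(2\,\mathrm{Re}\,\mathcal G\big)e^{-t\mathcal K}\,dt,\qquad 2\,\mathrm{Re}\,\mathcal G=\mathcal G+\mathcal G^*,$$ and for every $\Psi\in\mathcal H_N$ $$|\langle\Psi,\mathcal G\Psi\rangle|\le C'\sqrt{\sum_{k\in\mathbb Z^3_*}\hat V_k^2\min\{|k|,k_F\}}\;\langle\Psi,(\mathcal N_E^3+1)\Psi\rangle .$$ -/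

import Mathlib

open scoped InnerProductSpace

noncomputable section

namespace FermiGas

/-! ### Momenta, the Fermi ball and the lunes -/

/-- Momenta: the lattice `ℤ³`. -/
abbrev Mom : Type := Fin 3 → ℤ

/-- Non-zero momenta `ℤ³ \ {0}`. -/
abbrev MomStar : Type := {k : Mom // k ≠ 0}

/-- The Euclidean length `|p|` of a momentum. -/
def len (p : Mom) : ℝ := Real.sqrt (∑ i, (p i : ℝ) ^ 2)

/-- The closed Fermi ball `B_F = {p ∈ ℤ³ : |p| ≤ k_F}` (as a finite set, see `mem_fermiBall`). -/
def fermiBall (kF : ℝ) : Finset Mom :=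
  (Fintype.piFinset fun _ : Fin 3 => Finset.Icc (-⌊kF⌋) ⌊kF⌋).filter fun p => len p ≤ kF

theorem mem_fermiBall {kF : ℝ} {p : Mom} : p ∈ fermiBall kF ↔ len p ≤ kF := by
  simp only [fermiBall, Finset.mem_filter, Fintype.mem_piFinset, Finset.mem_Icc,
    and_iff_right_iff_imp]
  intro h i
  have h1 : |(p i : ℝ)| ≤ kF := by
    refine le_trans ?_ h
    refine Real.abs_le_sqrt ?_
    exact Finset.single_le_sum (f := fun i => (p i : ℝ) ^ 2) (fun j _ => sq_nonneg _)
      (Finset.mem_univ i)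
  obtain ⟨h2, h3⟩ := abs_le.1 h1
  constructor
  · have : -(p i) ≤ ⌊kF⌋ := Int.le_floor.2 (by push_cast; linarith)
    linarith
  · exact Int.le_floor.2 h3

/-- The lune `L_k = (B_F + k) \ B_F`. -/
def lune (kF : ℝ) (k : Mom) : Finset Mom :=
  (fermiBall kF).image (fun q => q + k) \ fermiBall kF

theorem mem_lune {kF : ℝ} {k p : Mom} : p ∈ lune kF k ↔ len (p - k) ≤ kF ∧ kF < len p := by
  simp only [lune, Finset.mem_sdiff, Finset.mem_image, mem_fermiBall, not_le]
  refine and_congr_left fun _ => ⟨?_, fun h => ⟨p - k, h, by simp⟩⟩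
  rintro ⟨q, hq, rfl⟩
  simpa using hq

/-! ### The fermionic Fock space over the plane-wave modes -/

/-- One-particle modes `(p, σ)`: momentum `p ∈ ℤ³` and spin `σ ∈ {1, …, s}`; the mode `(p, σ)`
stands for the plane wave `u_{p,σ}(x) = (2π)^{-3/2} e^{i p·x} v_σ` of `L²(𝕋³; ℂˢ)`. -/
abbrev Mode (s : ℕ) : Type := Mom × Fin s

/-- The fermionic Fock space over `L²(𝕋³; ℂˢ)` in occupation number representation: the
coefficient `Ψ S` of `Ψ` belongs to the Slater determinant `⋀_{i ∈ S} u_i` of the plane waves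
with modes in the finite set `S` (factors in increasing order of a fixed enumeration of the
modes). These Slater determinants form an orthonormal basis of the Fock space. -/
abbrev Fock (s : ℕ) : Type := lp (fun _ : Finset (Mode s) => ℂ) 2

/-- The sign `(-1)^{#{j ∈ S : j < i}}` produced by moving `u_i` to the front of
`⋀_{j ∈ S} u_j`. -/
def modeSign {s : ℕ} (i : Mode s) (S : Finset (Mode s)) : ℂ :=
  (-1) ^ (S.filter fun j => Encodable.encode j < Encodable.encode i).card

theorem norm_modeSign {s : ℕ} (i : Mode s) (S : Finset (Mode s)) : ‖modeSign i S‖ = 1 := by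
  simp [modeSign]

/-- Coefficients of `c_i Ψ`: the operator `c_i` sends `⋀_{j ∈ insert i S} u_j` to
`modeSign i S • ⋀_{j ∈ S} u_j` for `i ∉ S`, and kills the determinants without `u_i`. -/
def annFun {s : ℕ} (i : Mode s) (f : Finset (Mode s) → ℂ) (S : Finset (Mode s)) : ℂ :=
  if i ∈ S then 0 else modeSign i S * f (insert i S)

theorem annFun_sum_le {s : ℕ} (i : Mode s) (f : Fock s) (T : Finset (Finset (Mode s))) :
    ∑ S ∈ T, ‖annFun i f S‖ ^ (2 : ENNReal).toReal ≤ ‖f‖ ^ (2 : ENNReal).toReal := by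
  classical
  have h1 : ∑ S ∈ T, ‖annFun i f S‖ ^ (2 : ENNReal).toReal
      = ∑ S ∈ T.filter (fun S => i ∉ S), ‖f (insert i S)‖ ^ (2 : ENNReal).toReal := by
    rw [Finset.sum_filter]
    refine Finset.sum_congr rfl fun S _ => ?_
    by_cases h : i ∈ S
    · simp [annFun, h]
    · simp [annFun, h, norm_modeSign]
  have h2 : ∑ S ∈ T.filter (fun S => i ∉ S), ‖f (insert i S)‖ ^ (2 : ENNReal).toReal
      = ∑ S ∈ (T.filter (fun S => i ∉ S)).image (insert i), ‖f S‖ ^ (2 : ENNReal).toReal := by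
    rw [Finset.sum_image]
    intro S hS S' hS' h
    have hS1 : i ∉ S := (Finset.mem_filter.1 hS).2
    have hS2 : i ∉ S' := (Finset.mem_filter.1 hS').2
    rw [← Finset.erase_insert hS1, ← Finset.erase_insert hS2, h]
  rw [h1, h2]
  exact lp.sum_rpow_le_norm_rpow (by simp) f _

theorem annFun_memℓp {s : ℕ} (i : Mode s) (f : Fock s) :
    Memℓp (E := fun _ : Finset (Mode s) => ℂ) (annFun i f) 2 :=
  memℓp_gen' (annFun_sum_le i f)

/-- The annihilation operator `c_i = c_{p,σ}` of the mode `i = (p, σ)`. -/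
def ann {s : ℕ} (i : Mode s) : Fock s →L[ℂ] Fock s :=
  LinearMap.mkContinuous
    { toFun := fun f => ⟨annFun i f, annFun_memℓp i f⟩
      map_add' := fun f g => by
        ext S
        simp only [annFun, lp.coeFn_add, Pi.add_apply]
        split_ifs <;> ring
      map_smul' := fun a f => by
        ext S
        simp only [annFun, lp.coeFn_smul, Pi.smul_apply, smul_eq_mul, RingHom.id_apply]
        split_ifs <;> ring }
    1 (fun f => by
      rw [one_mul]
      exact lp.norm_le_of_forall_sum_le (by simp) (norm_nonneg _) (annFun_sum_le i f))

/-- The creation operator `c_i^*`, the adjoint of `c_i`. -/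
def cre {s : ℕ} (i : Mode s) : Fock s →L[ℂ] Fock s := ContinuousLinearMap.adjoint (ann i)

/-- The `n`-particle sector of the Fock space. -/
def sector (s n : ℕ) : Submodule ℂ (Fock s) where
  carrier := {Ψ | ∀ S : Finset (Mode s), S.card ≠ n → Ψ S = 0}
  add_mem' := fun {Ψ Φ} h h' S hS => by
    rw [lp.coeFn_add, Pi.add_apply, h S hS, h' S hS, add_zero]
  zero_mem' := fun S _ => by rw [lp.coeFn_zero, Pi.zero_apply]
  smul_mem' := fun a Ψ h S hS => by
    rw [lp.coeFn_smul, Pi.smul_apply, h S hS, smul_zero]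

theorem isClosed_sector (s n : ℕ) : IsClosed (sector s n : Set (Fock s)) := by
  have h : (sector s n : Set (Fock s))
      = ⋂ (S : Finset (Mode s)) (_ : S.card ≠ n), {Ψ : Fock s | Ψ S = 0} := by
    ext Ψ
    simp only [Set.mem_iInter]
    rfl
  rw [h]
  refine isClosed_iInter fun S => isClosed_iInter fun _ => isClosed_eq ?_ continuous_const
  exact (continuous_apply S).comp
    (lp.uniformContinuous_coe (E := fun _ : Finset (Mode s) => ℂ) (p := 2)).continuous

instance (s n : ℕ) : CompleteSpace (sector s n) :=
  (isClosed_sector s n).completeSpace_coe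

/-- The `N`-particle sector of the Fock space for `N = s |B_F|`. -/
abbrev HN (s : ℕ) (kF : ℝ) : Submodule ℂ (Fock s) := sector s (s * (fermiBall kF).card)

/-- The `N`-particle space `H_N = ⋀^N L²(𝕋³; ℂˢ)`, `N = s |B_F|`, as a Hilbert space of its own. -/
def HSpace (s : ℕ) (kF : ℝ) : Type := ↥(HN s kF)

instance (s : ℕ) (kF : ℝ) : NormedAddCommGroup (HSpace s kF) :=
  inferInstanceAs (NormedAddCommGroup ↥(HN s kF))

instance (s : ℕ) (kF : ℝ) : InnerProductSpace ℂ (HSpace s kF) :=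
  inferInstanceAs (InnerProductSpace ℂ ↥(HN s kF))

instance (s : ℕ) (kF : ℝ) : CompleteSpace (HSpace s kF) :=
  inferInstanceAs (CompleteSpace ↥(HN s kF))

/-- The inclusion of `H_N` into the Fock space; its adjoint is the orthogonal projection. -/
def incl (s : ℕ) (kF : ℝ) : HSpace s kF →L[ℂ] Fock s := (HN s kF).subtypeL

/-- The domain of the kinetic operator `H_kin = ∑_{p,σ} |p|² c_{p,σ}^* c_{p,σ}` on `H_N`:
`H_kin` multiplies the Slater determinant of `S` by `∑_{(p,σ) ∈ S} |p|²`. -/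
def kinDomain (s : ℕ) (kF : ℝ) : Set (Fock s) :=
  {Ψ | Ψ ∈ HN s kF ∧ Summable fun S : Finset (Mode s) => ‖(∑ i ∈ S, len i.1 ^ 2) * ‖Ψ S‖‖ ^ 2}

/-! ### The excitation number operator and the operators `c̃` and `D_k` -/

/-- The excitation number operator `N_E = ∑_{p ∉ B_F, σ} c_{p,σ}^* c_{p,σ}`, applied to a
vector (the series converges in norm on `H_N`). -/
def excNum {s : ℕ} (kF : ℝ) (Ψ : Fock s) : Fock s :=
  ∑' i : {i : Mode s // i.1 ∉ fermiBall kF}, cre i.1 (ann i.1 Ψ)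

/-- `c̃_{p,σ} = c_{p,σ}` for `p ∉ B_F` and `c̃_{p,σ} = c_{p,σ}^*` for `p ∈ B_F`. -/
def annT {s : ℕ} (kF : ℝ) (p : Mom) (σ : Fin s) : Fock s →L[ℂ] Fock s :=
  if p ∈ fermiBall kF then cre (p, σ) else ann (p, σ)

/-- `c̃_{p,σ}^*`. -/
def creT {s : ℕ} (kF : ℝ) (p : Mom) (σ : Fin s) : Fock s →L[ℂ] Fock s :=
  ContinuousLinearMap.adjoint (annT kF p σ)

/-- `D_{1,k} = dΓ(P_{B_F} e^{-ik·x} P_{B_F}) = ∑_{q ∈ B_F, q - k ∈ B_F, σ} c_{q-k,σ}^* c_{q,σ}`,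
applied to a vector. -/
def D1 {s : ℕ} (kF : ℝ) (k : Mom) (Ψ : Fock s) : Fock s :=
  ∑ q ∈ (fermiBall kF).filter (fun q => q - k ∈ fermiBall kF), ∑ σ : Fin s,
    cre (q - k, σ) (ann (q, σ) Ψ)

/-- The momenta `q` with `q ∉ B_F` and `q - k ∉ B_F`, that is `B_F^c ∩ (B_F^c + k)`. -/
abbrev OutOut (kF : ℝ) (k : Mom) : Type :=
  {q : Mom // q ∉ fermiBall kF ∧ q - k ∉ fermiBall kF}

/-- The terms of `D_{2,k} Ψ`. -/
def D2Term {s : ℕ} (kF : ℝ) (k : Mom) (Ψ : Fock s) (q : OutOut kF k) : Fock s :=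
  ∑ σ : Fin s, cre (q.1 - k, σ) (ann (q.1, σ) Ψ)

/-- `D_{2,k} = dΓ(P_{B_F^c} e^{-ik·x} P_{B_F^c}) = ∑_{q ∉ B_F, q - k ∉ B_F, σ} c_{q-k,σ}^* c_{q,σ}`,
applied to a vector. -/
def D2 {s : ℕ} (kF : ℝ) (k : Mom) (Ψ : Fock s) : Fock s := ∑' q : OutOut kF k, D2Term kF k Ψ q

/-- `D_k = D_{1,k} + D_{2,k}`. -/
def Dk {s : ℕ} (kF : ℝ) (k : Mom) (Ψ : Fock s) : Fock s := D1 kF k Ψ + D2 kF k Ψ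

/-! ### The quartic term and its parts, as quadratic forms `Ψ ↦ ⟨Ψ, · Ψ⟩` -/

/-- `V_k ⟨Ψ, (D_k^* D_k - ∑_{p ∈ L_k, σ} (c_{p,σ}^* c_{p,σ} + c_{p-k,σ} c_{p-k,σ}^*)) Ψ⟩`. -/
def QTerm {s : ℕ} (kF : ℝ) (V : Mom → ℝ) (Ψ : Fock s) (k : MomStar) : ℂ :=
  (V k : ℂ) * (⟪Dk kF k.1 Ψ, Dk kF k.1 Ψ⟫_ℂ
    - ∑ p ∈ lune kF k.1, ∑ σ : Fin s,
        (⟪Ψ, cre (p, σ) (ann (p, σ) Ψ)⟫_ℂ + ⟪Ψ, ann (p - k.1, σ) (cre (p - k.1, σ) Ψ)⟫_ℂ))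

/-- The quadratic form of the quartic non-bosonizable term `Q`. -/
def QForm {s : ℕ} (kF : ℝ) (V : Mom → ℝ) (Ψ : Fock s) : ℂ :=
  ((kF⁻¹ / (2 * (2 * Real.pi) ^ 3) : ℝ) : ℂ) * ∑' k : MomStar, QTerm kF V Ψ k

/-- `V_k ⟨Ψ, (∑_{q ∈ B_F, σ} 1_{B_F}(q + k) c̃_{q,σ}^* c̃_{q,σ}
- ∑_{p ∉ B_F, σ} 1_{B_F}(p - k) c̃_{p,σ}^* c̃_{p,σ}) Ψ⟩`; the `p ∉ B_F` with `p - k ∈ B_F` are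
exactly those of `L_k`. -/
def GTerm {s : ℕ} (kF : ℝ) (V : Mom → ℝ) (Ψ : Fock s) (k : MomStar) : ℂ :=
  (V k : ℂ) *
    (∑ q ∈ (fermiBall kF).filter (fun q => q + k.1 ∈ fermiBall kF), ∑ σ : Fin s,
        ⟪Ψ, creT kF q σ (annT kF q σ Ψ)⟫_ℂ
      - ∑ p ∈ lune kF k.1, ∑ σ : Fin s, ⟪Ψ, creT kF p σ (annT kF p σ Ψ)⟫_ℂ)

/-- The quadratic form of `G`. -/
def GForm {s : ℕ} (kF : ℝ) (V : Mom → ℝ) (Ψ : Fock s) : ℂ :=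
  ((kF⁻¹ / (2 * Real.pi) ^ 3 : ℝ) : ℂ) * ∑' k : MomStar, GTerm kF V Ψ k

/-- `⟨Ψ, (∑_{p,q ∈ B_F ∩ (B_F + k), σ, τ} c̃_{p-k,σ}^* c̃_{q,τ}^* c̃_{q-k,τ} c̃_{p,σ}
+ D_{1,k}^* D_{2,k} + D_{2,k}^* D_{1,k}) Ψ⟩`. -/
def LRTerm {s : ℕ} (kF : ℝ) (Ψ : Fock s) (k : Mom) : ℂ :=
  ∑ p ∈ (fermiBall kF).filter (fun p => p - k ∈ fermiBall kF),
      ∑ q ∈ (fermiBall kF).filter (fun q => q - k ∈ fermiBall kF),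
        ∑ σ : Fin s, ∑ τ : Fin s,
          ⟪Ψ, creT kF (p - k) σ (creT kF q τ (annT kF (q - k) τ (annT kF p σ Ψ)))⟫_ℂ
    + ⟪D1 kF k Ψ, D2 kF k Ψ⟫_ℂ + ⟪D2 kF k Ψ, D1 kF k Ψ⟫_ℂ

/-- The quadratic form of the long-range part `Q_LR`; the sum runs over `0 < |k| ≤ 2 k_F`. -/
def LRForm {s : ℕ} (kF : ℝ) (V : Mom → ℝ) (Ψ : Fock s) : ℂ :=
  ((kF⁻¹ / (2 * (2 * Real.pi) ^ 3) : ℝ) : ℂ) *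
    ∑ k ∈ (fermiBall (2 * kF)).erase 0, (V k : ℂ) * LRTerm kF Ψ k

/-- `⟨Ψ, ∑_{σ,τ} c̃_{p+k,σ}^* c̃_{q,τ}^* c̃_{q+k,τ} c̃_{p,σ} Ψ⟩` for
`p, q ∈ B_F^c ∩ (B_F^c - k)`. -/
def SRInner {s : ℕ} (kF : ℝ) (Ψ : Fock s) (k : Mom) (x : OutOut kF (-k) × OutOut kF (-k)) : ℂ :=
  ∑ σ : Fin s, ∑ τ : Fin s,
    ⟪Ψ, creT kF (x.1.1 + k) σ (creT kF x.2.1 τ (annT kF (x.2.1 + k) τ (annT kF x.1.1 σ Ψ)))⟫_ℂ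

/-- `V_k ∑_{p,q ∈ B_F^c ∩ (B_F^c - k), σ, τ} ⟨Ψ, c̃_{p+k,σ}^* c̃_{q,τ}^* c̃_{q+k,τ} c̃_{p,σ} Ψ⟩`. -/
def SRTerm {s : ℕ} (kF : ℝ) (V : Mom → ℝ) (Ψ : Fock s) (k : MomStar) : ℂ :=
  (V k : ℂ) * ∑' x : OutOut kF (-k.1) × OutOut kF (-k.1), SRInner kF Ψ k.1 x

/-- The quadratic form of the short-range part `Q_SR`. -/
def SRForm {s : ℕ} (kF : ℝ) (V : Mom → ℝ) (Ψ : Fock s) : ℂ :=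
  ((kF⁻¹ / (2 * (2 * Real.pi) ^ 3) : ℝ) : ℂ) * ∑' k : MomStar, SRTerm kF V Ψ k

/-! ### The transformation kernel -/

/-- `λ_{k,p} = (|p|² - |p - k|²) / 2`. -/
def lam (k p : Mom) : ℝ := (len p ^ 2 - len (p - k) ^ 2) / 2

/-- The power `h_k^a` of the operator `h_k e_p = λ_{k,p} e_p` on `ℓ²(L_k)` (`λ_{k,p} > 0`). -/
def hPow (kF : ℝ) (k : Mom) (a : ℝ) : Matrix (lune kF k) (lune kF k) ℝ :=
  Matrix.diagonal fun p => lam k p ^ a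

/-- The vector `v_k = √(s V_k k_F⁻¹ / (2 (2π)³)) ∑_{p ∈ L_k} e_p`. -/
def vVec (s : ℕ) (kF : ℝ) (V : Mom → ℝ) (k : Mom) : lune kF k → ℝ :=
  fun _ => Real.sqrt (s * V k * kF⁻¹ / (2 * (2 * Real.pi) ^ 3))

/-- The operator `P_k = ⟨v_k, ·⟩ v_k` on `ℓ²(L_k)`. -/
def PMat (s : ℕ) (kF : ℝ) (V : Mom → ℝ) (k : Mom) : Matrix (lune kF k) (lune kF k) ℝ :=
  Matrix.vecMulVec (vVec s kF V k) (vVec s kF V k)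

/-- `K_k = -½ log(h_k^{-1/2} (h_k^{1/2} (h_k + 2 P_k) h_k^{1/2})^{1/2} h_k^{-1/2})`, with square
root and logarithm taken in the functional calculus of real symmetric matrices. -/
def KMat (s : ℕ) (kF : ℝ) (V : Mom → ℝ) (k : Mom) : Matrix (lune kF k) (lune kF k) ℝ :=
  (-(1 / 2) : ℝ) • cfc Real.log
    (hPow kF k (-(1 / 2)) *
      cfc Real.sqrt
        (hPow kF k (1 / 2) * (hPow kF k 1 + (2 : ℝ) • PMat s kF V k) * hPow kF k (1 / 2)) *
      hPow kF k (-(1 / 2)))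

/-- The excitation operator `b_{k,p} = s^{-1/2} ∑_σ c_{p-k,σ}^* c_{p,σ}`. -/
def bOp (s : ℕ) (k p : Mom) : Fock s →L[ℂ] Fock s :=
  (((Real.sqrt s)⁻¹ : ℝ) : ℂ) • ∑ σ : Fin s, cre (p - k, σ) ∘L ann (p, σ)

/-- `½ ∑_{p,q ∈ L_l} ⟨e_p, K_l e_q⟩ (b_{l,p} b_{-l,-q} - b_{-l,-q}^* b_{l,p}^*)` on Fock space. -/
def calKTermFock (s : ℕ) (kF : ℝ) (V : Mom → ℝ) (l : Mom) : Fock s →L[ℂ] Fock s :=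
  (1 / 2 : ℂ) • ∑ p : lune kF l, ∑ q : lune kF l, (KMat s kF V l p q : ℂ) •
    (bOp s l p ∘L bOp s (-l) (-q.1)
      - ContinuousLinearMap.adjoint (bOp s (-l) (-q.1)) ∘L
          ContinuousLinearMap.adjoint (bOp s l p))

/-- The summand of the kernel `𝒦` as an operator on `H_N`. The operators `b_{k,p}` preserve the
particle number, so the compression to `H_N` is the restriction to `H_N`. -/
def calKTerm (s : ℕ) (kF : ℝ) (V : Mom → ℝ) (l : MomStar) :
    HSpace s kF →L[ℂ] HSpace s kF :=
  ContinuousLinearMap.adjoint (incl s kF) ∘L calKTermFock s kF V l.1 ∘L incl s kF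

/-- The kernel
`𝒦 = ½ ∑_{l ≠ 0} ∑_{p,q ∈ L_l} ⟨e_p, K_l e_q⟩ (b_{l,p} b_{-l,-q} - b_{-l,-q}^* b_{l,p}^*)`
on `H_N`, the sum over `l` converging in operator norm. -/
def calK (s : ℕ) (kF : ℝ) (V : Mom → ℝ) : HSpace s kF →L[ℂ] HSpace s kF :=
  ∑' l : MomStar, calKTerm s kF V l

/-- `√(∑_{k ≠ 0} V_k² min{|k|, k_F})`. -/
def errScale (kF : ℝ) (V : Mom → ℝ) : ℝ :=
  Real.sqrt (∑' k : MomStar, V k ^ 2 * min (len k.1) kF)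

end FermiGas

end

open FermiGas

namespace FermiGas

/-! ### Canonical anticommutation relations -/

section CAR

variable {s : ℕ}

/-! Everything is written in the excitation operators c̃, which again satisfy the canonical
anticommutation relations. Normal ordering D_{j,k}^* D_{j,k} in them (`inner_sum_tcre_tann`)
produces a quartic part and a number operator. For D_{2,k} these are the summand of Q_SR and N_E
minus the density of the lune; for D_{1,k} they are the quartic part of Q_LR and the density of the
q ∈ B_F with q + k ∈ B_F. In the N-particle sector with N = s|B_F| there are as many holes as
particles, so the hole density on L_k - k is N_E minus that same ball density. The two copies of N_E
cancel and twice the summand of G is left (`QTerm_eq`).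

The bounds on G and Q_LR use that Σ c̃_{f i}^* c̃_{g i} with injective f and g is dominated by N_E
(`norm_sum_tcre_tann_le`), and that a sum of V_k over O(k_F³) momenta is O(k_F) times the error
scale, by Cauchy–Schwarz against the weight min{|k|, k_F} (`sum_V_le`). The form of Q_SR converges
on the kinetic domain because V is square summable and Σ_p (1 + |p|²)^{-2} is finite on ℤ³: the
weight 1 + |p|² is put on one factor of each matrix element and its inverse on the other
(`summable_SRTerm`).

For the transformation, 𝒦 = A - A^*, where A destroys two particles and two holes. Each two-body
operator T_k in Q_SR = const Σ V_k T_k is bounded and self-adjoint on H_N, so Duhamel's formula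
gives e^𝒦 T_k e^{-𝒦} = T_k + ∫ e^{t𝒦} ([A, T_k] + [A, T_k]^*) e^{-t𝒦} dt. The commutator series Σ
V_k [A, T_k] converges in operator norm, and 𝒢 is its multiple by the prefactor; summing over k
gives the identity, and also the convergence of Q_SR on the transformed vector.

To bound the commutator, commute c̃_x c̃_y c̃_i c̃_j (holes x, y; particles i, j) through T_k. The
holes commute with T_k; the particles have their momenta shifted by ±k, and at most one factor
D_{2,±k} remains, which is moved to the left vector. Since k can be recovered from the shifted pair,
Cauchy–Schwarz in k costs only the ℓ² norm of V; Cauchy–Schwarz in the lune indices then costs the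
Hilbert–Schmidt norm of K_l (`sum_norm_inner_lowOp_commutator_le`). Weights (N_E + 3)^{1/2} and (N_E
+ 1)^{-1/2} on the two sides balance the powers of N_E and yield N_E³ + 1.

It remains to sum the Hilbert–Schmidt norms. The matrix inside the logarithm in K_l is at least 1
and its trace excess is at most Σ v_p²/λ_p, so ‖K_l‖ is at most a constant times s V_l k_F^{-1} Σ_{p
∈ L_l} 1/λ_{l,p} (`sum_sq_log_kernel_le`). Counting lattice points in thin slices of the lune
(`card_lune_filter_le`) bounds these lune sums well enough that their squares, weighted by
1/min{|l|, k_F}, add up to O(k_F⁴) (`sum_luneSum_sq_le`). Hence Σ_l ‖K_l‖ is O(k_F) times the error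
scale, and the prefactor k_F^{-1} of Q_SR absorbs the k_F. -/

theorem ann_apply (i : Mode s) (Ψ : Fock s) (S : Finset (Mode s)) :
    ann i Ψ S = if i ∈ S then 0 else modeSign i S * Ψ (insert i S) := rfl

theorem star_modeSign (i : Mode s) (S : Finset (Mode s)) :
    (starRingEnd ℂ) (modeSign i S) = modeSign i S := by simp [modeSign]

theorem modeSign_mul_self (i : Mode s) (S : Finset (Mode s)) :
    modeSign i S * modeSign i S = 1 := by
  simp [modeSign, ← mul_pow]

theorem modeSign_insert {i : Mode s} {S : Finset (Mode s)} (j : Mode s) (h : i ∉ S) :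
    modeSign j (insert i S) =
      (if Encodable.encode i < Encodable.encode j then -1 else 1) * modeSign j S := by
  unfold modeSign
  rw [Finset.filter_insert]
  split_ifs with h1
  · rw [Finset.card_insert_of_notMem (by simp [h]), pow_succ]; ring
  · simp

/-- Exactly one of two distinct modes precedes the other, so exactly one of the two insertions flips
a sign. All anticommutation relations rest on this. -/
theorem modeSign_swap {i j : Mode s} {S : Finset (Mode s)} (hij : i ≠ j) (hi : i ∉ S)
    (hj : j ∉ S) :
    modeSign i S * modeSign j (insert i S) = -(modeSign j S * modeSign i (insert j S)) := by
  rw [modeSign_insert _ hi, modeSign_insert _ hj]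
  have : Encodable.encode i ≠ Encodable.encode j := fun h => hij (Encodable.encode_injective h)
  rcases lt_or_gt_of_ne this with h | h
  · rw [if_pos h, if_neg h.le.not_gt]; ring
  · rw [if_pos h, if_neg h.le.not_gt]; ring

theorem ann_single (i : Mode s) (S : Finset (Mode s)) (a : ℂ) :
    ann i (lp.single 2 S a : Fock s) =
      if i ∈ S then (lp.single 2 (S.erase i) (modeSign i (S.erase i) * a) : Fock s) else 0 := by
  ext T
  rw [ann_apply]
  by_cases hT : i ∈ T
  · rw [if_pos hT]
    split_ifs with hS
    · rw [lp.coeFn_single, Pi.single_apply, if_neg]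
      rintro rfl; simp at hT
    · rfl
  · rw [if_neg hT, lp.coeFn_single, Pi.single_apply]
    split_ifs with h1 h2 h2
    · subst h1; simp [hT]
    · subst h1; simp at h2
    · rw [lp.coeFn_single, Pi.single_apply, if_neg]
      · simp
      · rintro rfl; exact h1 (Finset.insert_erase h2)
    · simp

theorem apply_eq_inner (Ψ : Fock s) (S : Finset (Mode s)) :
    Ψ S = ⟪(lp.single 2 S (1 : ℂ) : Fock s), Ψ⟫_ℂ := by
  rw [lp.inner_single_left]; simp

theorem cre_apply (i : Mode s) (Ψ : Fock s) (S : Finset (Mode s)) :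
    cre i Ψ S = if i ∈ S then modeSign i (S.erase i) * Ψ (S.erase i) else 0 := by
  rw [apply_eq_inner, cre, ContinuousLinearMap.adjoint_inner_right, ann_single]
  split_ifs with h
  · rw [lp.inner_single_left]; simp [star_modeSign, mul_comm]
  · simp

theorem ann_ann (i j : Mode s) (Ψ : Fock s) : ann i (ann j Ψ) = -ann j (ann i Ψ) := by
  ext S
  rw [lp.coeFn_neg, Pi.neg_apply]
  simp only [ann_apply, Finset.mem_insert]
  by_cases hij : i = j
  · subst hij; simp
  by_cases hi : i ∈ S
  · simp [hi]
  by_cases hj : j ∈ S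
  · simp [hj]
  rw [if_neg hi, if_neg hj, if_neg (by tauto), if_neg (by tauto), ← mul_assoc, ← mul_assoc,
    modeSign_swap hij hi hj, Finset.insert_comm]
  ring

theorem ann_cre (i j : Mode s) (Ψ : Fock s) :
    ann i (cre j Ψ) = (if i = j then Ψ else 0) - cre j (ann i Ψ) := by
  ext S
  rw [lp.coeFn_sub, Pi.sub_apply, ann_apply, cre_apply, cre_apply, ann_apply]
  by_cases hij : i = j
  · subst hij
    by_cases hi : i ∈ S
    · simp only [hi, if_true, Finset.mem_erase, not_true_eq_false, ne_eq, false_and, if_false,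
        Finset.insert_erase hi]
      rw [← mul_assoc, modeSign_mul_self]; simp
    · simp only [hi, if_false, Finset.mem_insert_self, if_true, Finset.erase_insert hi]
      rw [← mul_assoc, modeSign_mul_self]; simp
  · simp only [hij, if_false, Finset.mem_insert, Finset.mem_erase]
    by_cases hi : i ∈ S
    · simp [hi, hij]
    by_cases hj : j ∈ S
    · have hi' : i ∉ S.erase j := fun h => hi (Finset.mem_of_mem_erase h)
      rw [if_neg hi, if_pos (Or.inr hj), if_pos hj, if_neg (by tauto)]
      have e : (insert i S).erase j = insert i (S.erase j) := by
        rw [Finset.erase_insert_of_ne hij]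
      rw [e]
      have hj' : j ∉ S.erase j := by simp
      have h1 := modeSign_swap hij hi' hj'
      rw [Finset.insert_erase hj] at h1
      have h2 := modeSign_mul_self j (S.erase j)
      have h3 := modeSign_mul_self j (insert i (S.erase j))
      -- All signs square to one, so multiplying by suitable squares reduces this to the swap rule
      -- on `S.erase j`.
      have h4 : modeSign i S * modeSign j (insert i (S.erase j)) =
          - (modeSign j (S.erase j) * modeSign i (S.erase j)) := by
        calc _ = (modeSign j (S.erase j) * modeSign j (S.erase j)) *
              (modeSign i S * modeSign j (insert i (S.erase j))) := by rw [h2, one_mul]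
          _ = modeSign j (S.erase j) * (modeSign j (S.erase j) * modeSign i S) *
                modeSign j (insert i (S.erase j)) := by ring
          _ = -(modeSign j (S.erase j) * modeSign i (S.erase j) *
              (modeSign j (insert i (S.erase j)) * modeSign j (insert i (S.erase j)))) := by
            rw [← neg_eq_iff_eq_neg.2 h1]; ring
          _ = _ := by rw [h3, mul_one]
      rw [← mul_assoc, ← mul_assoc, h4]; simp
    · simp [hi, hj, Ne.symm hij]

theorem inner_cre_right (i : Mode s) (Φ Ψ : Fock s) : ⟪Φ, cre i Ψ⟫_ℂ = ⟪ann i Φ, Ψ⟫_ℂ :=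
  ContinuousLinearMap.adjoint_inner_right _ _ _

theorem adjoint_cre (i : Mode s) : ContinuousLinearMap.adjoint (cre i) = ann i :=
  ContinuousLinearMap.adjoint_adjoint _

theorem cre_cre (i j : Mode s) (Ψ : Fock s) : cre i (cre j Ψ) = -cre j (cre i Ψ) := by
  refine ext_inner_left ℂ fun Φ => ?_
  rw [inner_neg_right, inner_cre_right, inner_cre_right, inner_cre_right, inner_cre_right,
    ann_ann, inner_neg_left]

/-- `c̃_i` as a function of the mode. -/
noncomputable def tann (kF : ℝ) (i : Mode s) : Fock s →L[ℂ] Fock s := annT kF i.1 i.2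

/-- `c̃_i^*` as a function of the mode. -/
noncomputable def tcre (kF : ℝ) (i : Mode s) : Fock s →L[ℂ] Fock s := creT kF i.1 i.2

variable {kF : ℝ}

theorem tann_of_mem {i : Mode s} (h : i.1 ∈ fermiBall kF) : tann kF i = cre i := by
  rw [tann, annT, if_pos h]

theorem tann_of_notMem {i : Mode s} (h : i.1 ∉ fermiBall kF) : tann kF i = ann i := by
  rw [tann, annT, if_neg h]

theorem tcre_of_mem {i : Mode s} (h : i.1 ∈ fermiBall kF) : tcre kF i = ann i := by
  rw [tcre, creT, annT, if_pos h, adjoint_cre]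

theorem tcre_of_notMem {i : Mode s} (h : i.1 ∉ fermiBall kF) : tcre kF i = cre i := by
  rw [tcre, creT, annT, if_neg h]; rfl

theorem inner_tcre_left (i : Mode s) (Φ Ψ : Fock s) :
    ⟪tcre kF i Φ, Ψ⟫_ℂ = ⟪Φ, tann kF i Ψ⟫_ℂ :=
  ContinuousLinearMap.adjoint_inner_left _ _ _

theorem inner_tcre_right (i : Mode s) (Φ Ψ : Fock s) :
    ⟪Φ, tcre kF i Ψ⟫_ℂ = ⟪tann kF i Φ, Ψ⟫_ℂ :=
  ContinuousLinearMap.adjoint_inner_right _ _ _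

/-- The relations are symmetric under exchanging c and c^*. A mode in the ball and a mode outside it
are distinct, so in the mixed cases the delta term is absent. -/
theorem tann_tann (i j : Mode s) (Ψ : Fock s) :
    tann kF i (tann kF j Ψ) = -tann kF j (tann kF i Ψ) := by
  by_cases hi : i.1 ∈ fermiBall kF <;> by_cases hj : j.1 ∈ fermiBall kF
  · rw [tann_of_mem hi, tann_of_mem hj, cre_cre]
  · have hij : j ≠ i := by rintro rfl; exact hj hi
    rw [tann_of_mem hi, tann_of_notMem hj, ann_cre, if_neg hij]; simp
  · have hij : i ≠ j := by rintro rfl; exact hi hj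
    rw [tann_of_notMem hi, tann_of_mem hj, ann_cre, if_neg hij]; simp
  · rw [tann_of_notMem hi, tann_of_notMem hj, ann_ann]

theorem tann_tcre (i j : Mode s) (Ψ : Fock s) :
    tann kF i (tcre kF j Ψ) = (if i = j then Ψ else 0) - tcre kF j (tann kF i Ψ) := by
  by_cases hi : i.1 ∈ fermiBall kF <;> by_cases hj : j.1 ∈ fermiBall kF
  · rw [tann_of_mem hi, tcre_of_mem hj, ann_cre]
    by_cases h : i = j
    · subst h; simp
    · rw [if_neg h, if_neg (Ne.symm h)]; simp
  · have hij : i ≠ j := by rintro rfl; exact hj hi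
    rw [tann_of_mem hi, tcre_of_notMem hj, cre_cre, if_neg hij]; simp
  · have hij : i ≠ j := by rintro rfl; exact hi hj
    rw [tann_of_notMem hi, tcre_of_mem hj, ann_ann, if_neg hij]; simp
  · rw [tann_of_notMem hi, tcre_of_notMem hj, ann_cre]

end CAR

end FermiGas

namespace FermiGas

/-! ### Number operators and quadratic expressions in the `c̃` -/

section Number

variable {s : ℕ} {kF : ℝ}

/-- Cauchy criterion for almost orthogonal families, where the norms themselves need not be
summable. It serves both the series D_{2,k} Ψ and the operator series of commutators. -/
theorem summable_of_sq_norm_sum_le {ι E : Type*} [NormedAddCommGroup E] [CompleteSpace E]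
    {v : ι → E} {r : ι → ℝ} (hr : Summable r)
    (h : ∀ Y : Finset ι, ‖∑ i ∈ Y, v i‖ ^ 2 ≤ ∑ i ∈ Y, r i) : Summable v := by
  rw [summable_iff_vanishing_norm] at hr ⊢
  intro ε hε
  obtain ⟨Y, hY⟩ := hr (ε ^ 2) (by positivity)
  refine ⟨Y, fun Z hZ => ?_⟩
  have h1 := (h Z).trans_lt ((le_abs_self _).trans_lt (hY Z hZ))
  exact lt_of_pow_lt_pow_left₀ 2 hε.le h1

theorem norm_le_of_apply_le {Φ Ψ : Fock s} (h : ∀ S, ‖Φ S‖ ≤ ‖Ψ S‖) : ‖Φ‖ ≤ ‖Ψ‖ := by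
  refine lp.norm_le_of_forall_sum_le (by simp) (norm_nonneg _) fun T => ?_
  refine le_trans (Finset.sum_le_sum fun S _ => ?_) (lp.sum_rpow_le_norm_rpow (by simp) Ψ T)
  exact Real.rpow_le_rpow (norm_nonneg _) (h S) (by simp)

/-- `∑_{i ∈ Y} c̃_i^* c̃_i`. -/
noncomputable def num (kF : ℝ) (Y : Finset (Mode s)) : Fock s →L[ℂ] Fock s :=
  ∑ i ∈ Y, tcre kF i ∘L tann kF i

theorem num_def (Y : Finset (Mode s)) (Ψ : Fock s) :
    num kF Y Ψ = ∑ i ∈ Y, tcre kF i (tann kF i Ψ) := by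
  simp [num]

/-- c̃_i^* c̃_i is the projection onto determinants in which i is excited: occupied if outside the
ball, empty if inside. -/
theorem tcre_tann_apply (i : Mode s) (Ψ : Fock s) (S : Finset (Mode s)) :
    tcre kF i (tann kF i Ψ) S = if (i ∈ S ↔ i.1 ∉ fermiBall kF) then Ψ S else 0 := by
  by_cases hi : i.1 ∈ fermiBall kF
  · rw [tcre_of_mem hi, tann_of_mem hi, ann_apply]
    by_cases h : i ∈ S
    · simp [h, hi]
    · simp only [h, hi, if_false, cre_apply, Finset.mem_insert_self, if_true,
        Finset.erase_insert h, not_true_eq_false]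
      rw [← mul_assoc, modeSign_mul_self, one_mul]
  · rw [tcre_of_notMem hi, tann_of_notMem hi, cre_apply]
    by_cases h : i ∈ S
    · simp only [h, hi, if_true, ann_apply, Finset.mem_erase, ne_eq, not_true_eq_false, false_and,
        if_false, Finset.insert_erase h, not_false_eq_true]
      rw [← mul_assoc, modeSign_mul_self, one_mul]
    · simp [h, hi]

open Classical in
theorem num_apply (Y : Finset (Mode s)) (Ψ : Fock s) (S : Finset (Mode s)) :
    num kF Y Ψ S = ((Y.filter fun i => (i ∈ S ↔ i.1 ∉ fermiBall kF)).card : ℂ) * Ψ S := by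
  rw [num_def, lp.coeFn_sum, Finset.sum_apply]
  simp only [tcre_tann_apply]
  rw [← Finset.sum_filter, Finset.sum_const, nsmul_eq_mul]

theorem num_tann (Y : Finset (Mode s)) (j : Mode s) (Ψ : Fock s) :
    num kF Y (tann kF j Ψ) = tann kF j (num kF Y Ψ) - if j ∈ Y then tann kF j Ψ else 0 := by
  rw [num_def, num_def, map_sum]
  have h : ∀ i, tcre kF i (tann kF i (tann kF j Ψ)) =
      tann kF j (tcre kF i (tann kF i Ψ)) - if j = i then tann kF j Ψ else 0 := by
    intro i
    rw [tann_tcre, tann_tann i j]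
    by_cases h : j = i
    · subst h; simp
    · simp [h]
  simp only [h, Finset.sum_sub_distrib, Finset.sum_ite_eq]

theorem sum_inner_tann (Y : Finset (Mode s)) (Φ Ψ : Fock s) :
    ∑ i ∈ Y, ⟪tann kF i Φ, tann kF i Ψ⟫_ℂ = ⟪Φ, num kF Y Ψ⟫_ℂ := by
  rw [num_def, inner_sum]
  simp only [inner_tcre_right]

theorem sum_inner_tann' (Y : Finset (Mode s)) (Φ Ψ : Fock s) :
    ∑ i ∈ Y, ⟪tann kF i Φ, tann kF i Ψ⟫_ℂ = ⟪num kF Y Φ, Ψ⟫_ℂ := by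
  rw [num_def, sum_inner]
  simp only [inner_tcre_left]

theorem sum_norm_tann (Y : Finset (Mode s)) (Ψ : Fock s) :
    ∑ i ∈ Y, ‖tann kF i Ψ‖ ^ 2 = (⟪Ψ, num kF Y Ψ⟫_ℂ).re := by
  rw [← sum_inner_tann, Complex.re_sum]
  exact Finset.sum_congr rfl fun i _ => norm_sq_eq_re_inner (𝕜 := ℂ) _

theorem sum_norm_tann_le (Y : Finset (Mode s)) (Ψ : Fock s) :
    ∑ i ∈ Y, ‖tann kF i Ψ‖ ^ 2 ≤ ‖Ψ‖ * ‖num kF Y Ψ‖ := by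
  rw [sum_norm_tann]
  exact (Complex.re_le_norm _).trans (norm_inner_le_norm _ _)

/-- The first double sum is the expectation of n(n - 1), where n is the number operator of Y,
because c̃_i lowers n by one. The identity being exact, the one-body and two-body parts of a normal
ordering can later be absorbed together. -/
theorem sum_norm_tann_tann (Y : Finset (Mode s)) (Ψ : Fock s) :
    ∑ i ∈ Y, ∑ j ∈ Y, ‖tann kF j (tann kF i Ψ)‖ ^ 2 + ∑ i ∈ Y, ‖tann kF i Ψ‖ ^ 2
      = ‖num kF Y Ψ‖ ^ 2 := by
  have h1 : ∀ i ∈ Y, ∑ j ∈ Y, ‖tann kF j (tann kF i Ψ)‖ ^ 2 =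
      (⟪tann kF i Ψ, tann kF i (num kF Y Ψ)⟫_ℂ - ⟪tann kF i Ψ, tann kF i Ψ⟫_ℂ).re := by
    intro i hi
    rw [sum_norm_tann, num_tann, if_pos hi, inner_sub_right]
  rw [Finset.sum_congr rfl h1, ← Complex.re_sum, Finset.sum_sub_distrib, sum_inner_tann',
    sum_inner_tann, sum_norm_tann, Complex.sub_re, sub_add_cancel]
  exact (norm_sq_eq_re_inner (𝕜 := ℂ) _).symm

theorem sum_norm_tann_tann_le (Y : Finset (Mode s)) (Ψ : Fock s) :
    ∑ i ∈ Y, ∑ j ∈ Y, ‖tann kF j (tann kF i Ψ)‖ ^ 2 ≤ ‖num kF Y Ψ‖ ^ 2 := by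
  rw [← sum_norm_tann_tann]
  exact le_add_of_nonneg_right (Finset.sum_nonneg fun _ _ => by positivity)

/-- Annihilators of modes in Z commute with the number operator of the disjoint set Y, so the
two-operator bound applies first on Y and then on Z. -/
theorem sum_norm_four_le {Y Z : Finset (Mode s)} (h : Disjoint Y Z) (Ψ : Fock s) :
    ∑ u ∈ Z, ∑ w ∈ Z, ∑ x ∈ Y, ∑ y ∈ Y,
      ‖tann kF y (tann kF x (tann kF w (tann kF u Ψ)))‖ ^ 2 ≤ ‖num kF Z (num kF Y Ψ)‖ ^ 2 := by
  refine le_trans (Finset.sum_le_sum fun u hu => Finset.sum_le_sum fun w hw =>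
    sum_norm_tann_tann_le Y _) (le_trans (le_of_eq ?_) (sum_norm_tann_tann_le Z _))
  refine Finset.sum_congr rfl fun u hu => Finset.sum_congr rfl fun w hw => ?_
  have hu' : u ∉ Y := fun h' => Finset.disjoint_left.1 h h' hu
  have hw' : w ∉ Y := fun h' => Finset.disjoint_left.1 h h' hw
  rw [num_tann, num_tann, if_neg hu', if_neg hw', sub_zero, sub_zero]

/-- Expansion of `‖∑_i c̃_{f i}^* c̃_{g i} Ψ‖²` into its one- and two-body parts. -/
theorem inner_sum_tcre_tann {ι : Type*} (I : Finset ι) {f : ι → Mode s} (g : ι → Mode s)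
    (hf : Set.InjOn f I) (Ψ : Fock s) :
    ⟪∑ i ∈ I, tcre kF (f i) (tann kF (g i) Ψ), ∑ i ∈ I, tcre kF (f i) (tann kF (g i) Ψ)⟫_ℂ =
      ∑ i ∈ I, ⟪tann kF (g i) Ψ, tann kF (g i) Ψ⟫_ℂ -
        ∑ i ∈ I, ∑ j ∈ I, ⟪tann kF (f j) (tann kF (g i) Ψ),
          tann kF (f i) (tann kF (g j) Ψ)⟫_ℂ := by
  classical
  rw [sum_inner, ← Finset.sum_sub_distrib]
  refine Finset.sum_congr rfl fun i hi => ?_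
  rw [inner_sum]
  have h : ∀ j ∈ I, ⟪tcre kF (f i) (tann kF (g i) Ψ), tcre kF (f j) (tann kF (g j) Ψ)⟫_ℂ =
      (if i = j then ⟪tann kF (g i) Ψ, tann kF (g j) Ψ⟫_ℂ else 0) -
        ⟪tann kF (f j) (tann kF (g i) Ψ), tann kF (f i) (tann kF (g j) Ψ)⟫_ℂ := by
    intro j hj
    rw [inner_tcre_left, tann_tcre, inner_sub_right, inner_tcre_right]
    congr 1
    by_cases hij : i = j
    · simp [hij]
    · rw [if_neg hij, if_neg (fun h => hij (hf hi hj h)), inner_zero_right]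
  rw [Finset.sum_congr rfl h, Finset.sum_sub_distrib, Finset.sum_ite_eq, if_pos hi]

/-- The summand pairs the (i, j) vector with the (j, i) vector, so 2ab ≤ a² + b² and the symmetry of
the double sum return the sum of squares without loss. -/
theorem norm_sum_sum_inner_le {ι : Type*} (I : Finset ι) (f g : ι → Mode s) (Ψ : Fock s) :
    ‖∑ i ∈ I, ∑ j ∈ I, ⟪tann kF (f j) (tann kF (g i) Ψ), tann kF (f i) (tann kF (g j) Ψ)⟫_ℂ‖ ≤
      ∑ i ∈ I, ∑ j ∈ I, ‖tann kF (f j) (tann kF (g i) Ψ)‖ ^ 2 := by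
  set r : ι → ι → ℝ := fun i j => ‖tann kF (f j) (tann kF (g i) Ψ)‖ with hr
  have h1 : ‖∑ i ∈ I, ∑ j ∈ I, ⟪tann kF (f j) (tann kF (g i) Ψ),
      tann kF (f i) (tann kF (g j) Ψ)⟫_ℂ‖ ≤ ∑ i ∈ I, ∑ j ∈ I, (r i j ^ 2 + r j i ^ 2) / 2 := by
    refine norm_sum_le_of_le _ fun i _ => norm_sum_le_of_le _ fun j _ => ?_
    refine (norm_inner_le_norm _ _).trans ?_
    nlinarith [sq_nonneg (r i j - r j i)]
  refine h1.trans (le_of_eq ?_)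
  simp only [add_div, Finset.sum_add_distrib]
  rw [Finset.sum_comm (f := fun i j => r j i ^ 2 / 2)]
  rw [← Finset.sum_add_distrib]
  refine Finset.sum_congr rfl fun i _ => ?_
  rw [← Finset.sum_add_distrib]
  exact Finset.sum_congr rfl fun j _ => by ring

theorem norm_sq_sum_tcre_tann_le {ι : Type*} (I : Finset ι) {f : ι → Mode s} (g : ι → Mode s)
    (hf : Set.InjOn f I) (Ψ : Fock s) :
    ‖∑ i ∈ I, tcre kF (f i) (tann kF (g i) Ψ)‖ ^ 2 ≤
      ∑ i ∈ I, ‖tann kF (g i) Ψ‖ ^ 2 +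
        ∑ i ∈ I, ∑ j ∈ I, ‖tann kF (f j) (tann kF (g i) Ψ)‖ ^ 2 := by
  have h := congrArg Complex.re (inner_sum_tcre_tann (kF := kF) I g hf Ψ)
  have e : ∀ Φ : Fock s, (⟪Φ, Φ⟫_ℂ).re = ‖Φ‖ ^ 2 := fun Φ =>
    (norm_sq_eq_re_inner (𝕜 := ℂ) Φ).symm
  rw [e, Complex.sub_re, Complex.re_sum] at h
  simp only [e] at h
  rw [h, sub_eq_add_neg]
  gcongr
  refine le_trans ?_ (norm_sum_sum_inner_le I f g Ψ)
  rw [← Complex.neg_re]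
  exact (Complex.re_le_norm _).trans (norm_neg _).le

/-- Second quantization of a partial shift is dominated by the number operator: injectivity of f and
g makes the one-body and two-body parts subsums of those in `sum_norm_tann_tann`. -/
theorem norm_sum_tcre_tann_le {ι : Type*} (I : Finset ι) {f g : ι → Mode s}
    (hf : Set.InjOn f I) (hg : Set.InjOn g I) {Y : Finset (Mode s)} (hfY : ∀ i ∈ I, f i ∈ Y)
    (hgY : ∀ i ∈ I, g i ∈ Y) (Ψ : Fock s) :
    ‖∑ i ∈ I, tcre kF (f i) (tann kF (g i) Ψ)‖ ≤ ‖num kF Y Ψ‖ := by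
  classical
  refine le_of_sq_le_sq ?_ (norm_nonneg _)
  refine (norm_sq_sum_tcre_tann_le I g hf Ψ).trans ?_
  rw [← sum_norm_tann_tann, add_comm]
  have key : ∀ (q : ι → Mode s), Set.InjOn q I → (∀ i ∈ I, q i ∈ Y) → ∀ F : Mode s → ℝ,
      (∀ m, 0 ≤ F m) → ∑ i ∈ I, F (q i) ≤ ∑ m ∈ Y, F m := by
    intro q hq hqY F hF
    rw [← Finset.sum_image hq]
    exact Finset.sum_le_sum_of_subset_of_nonneg (Finset.image_subset_iff.2 hqY)
      fun m _ _ => hF m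
  refine add_le_add ?_ (key g hg hgY (fun m => ‖tann kF m Ψ‖ ^ 2) fun m => by positivity)
  refine le_trans (Finset.sum_le_sum fun i _ =>
    key f hf hfY (fun m => ‖tann kF m (tann kF (g i) Ψ)‖ ^ 2) fun m => by positivity) ?_
  exact key g hg hgY (fun m => ∑ j ∈ Y, ‖tann kF j (tann kF m Ψ)‖ ^ 2)
    fun m => Finset.sum_nonneg fun _ _ => by positivity

/-! ### Particle-number bounds on `H_N` -/

/-- The vanishing of the components with more than `m` particles. -/
def CardLE (m : ℕ) (Ψ : Fock s) : Prop := ∀ S : Finset (Mode s), m < S.card → Ψ S = 0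

theorem CardLE.ann {m : ℕ} {Ψ : Fock s} (h : CardLE m Ψ) (i : Mode s) : CardLE m (ann i Ψ) := by
  intro S hS
  rw [ann_apply]
  split_ifs with hi
  · rfl
  · rw [h _ (by rw [Finset.card_insert_of_notMem hi]; omega), mul_zero]

theorem cardLE_of_mem {Ψ : Fock s} (h : Ψ ∈ HN s kF) : CardLE (s * (fermiBall kF).card) Ψ :=
  fun S hS => h S hS.ne'

theorem norm_num_le {m : ℕ} {Ψ : Fock s} (h : CardLE m Ψ) {Y : Finset (Mode s)}
    (hY : ∀ i ∈ Y, i.1 ∉ fermiBall kF) : ‖num kF Y Ψ‖ ≤ m * ‖Ψ‖ := by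
  classical
  have e : (m : ℝ) * ‖Ψ‖ = ‖(m : ℂ) • Ψ‖ := by rw [norm_smul]; simp
  rw [e]
  refine norm_le_of_apply_le fun S => ?_
  rw [num_apply, lp.coeFn_smul, Pi.smul_apply, smul_eq_mul, norm_mul, norm_mul]
  by_cases hS : m < S.card
  · rw [h S hS]; simp
  · gcongr
    rw [Complex.norm_natCast, Complex.norm_natCast]
    norm_cast
    refine le_trans (Finset.card_le_card (t := S) fun i hi => ?_) (not_lt.1 hS)
    rw [Finset.mem_filter] at hi
    exact hi.2.2 (hY i hi.1)

theorem sum_norm_sq_tann_le {ι : Type*} {m : ℕ} {Ψ : Fock s} (h : CardLE m Ψ) (I : Finset ι)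
    {g : ι → Mode s} (hg : Set.InjOn g I) (hgY : ∀ i ∈ I, (g i).1 ∉ fermiBall kF) :
    ∑ i ∈ I, ‖tann kF (g i) Ψ‖ ^ 2 ≤ m * ‖Ψ‖ ^ 2 := by
  classical
  have e : ∑ i ∈ I, ‖tann kF (g i) Ψ‖ ^ 2 = ∑ i ∈ I.image g, ‖tann kF i Ψ‖ ^ 2 := by
    rw [Finset.sum_image hg]
  rw [e]
  refine (sum_norm_tann_le _ Ψ).trans ?_
  have := norm_num_le (kF := kF) h (Y := I.image g) (by
    intro i hi
    obtain ⟨j, hj, rfl⟩ := Finset.mem_image.1 hi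
    exact hgY j hj)
  nlinarith [norm_nonneg Ψ]

theorem summable_norm_sq_tann {ι : Type*} {m : ℕ} {Ψ : Fock s} (h : CardLE m Ψ)
    {g : ι → Mode s} (hg : Function.Injective g) (hgY : ∀ i, (g i).1 ∉ fermiBall kF) :
    Summable fun i => ‖tann kF (g i) Ψ‖ ^ 2 :=
  summable_of_sum_le (fun _ => by positivity)
    fun I => sum_norm_sq_tann_le h I hg.injOn fun i _ => hgY i

/-- The one-body part of the norm squared is summable since at most m particles lie outside the
ball, and the two-body part is at most m times it. -/
theorem summable_tcre_tann {ι : Type*} {m : ℕ} {Ψ : Fock s} (h : CardLE m Ψ)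
    {f g : ι → Mode s} (hf : Function.Injective f) (hg : Function.Injective g)
    (hfY : ∀ i, (f i).1 ∉ fermiBall kF) (hgY : ∀ i, (g i).1 ∉ fermiBall kF) :
    Summable fun i => tcre kF (f i) (tann kF (g i) Ψ) := by
  refine summable_of_sq_norm_sum_le
    ((summable_norm_sq_tann (kF := kF) h hg hgY).mul_left (1 + (m : ℝ))) fun Y => ?_
  refine (norm_sq_sum_tcre_tann_le Y g hf.injOn Ψ).trans ?_
  rw [← Finset.sum_add_distrib]
  refine Finset.sum_le_sum fun i _ => ?_
  rw [add_mul, one_mul]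
  gcongr
  refine sum_norm_sq_tann_le ?_ Y hf.injOn fun j _ => hfY j
  rw [tann_of_notMem (hgY i)]
  exact h.ann _

/-! ### The excitation number operator -/

/-- The number of modes of `S` outside the Fermi ball. -/
noncomputable def outCard (kF : ℝ) (S : Finset (Mode s)) : ℕ := (S.filter fun i => i.1 ∉ fermiBall kF).card

/-- The modes inside the Fermi ball. -/
noncomputable def ballModes (s : ℕ) (kF : ℝ) : Finset (Mode s) := fermiBall kF ×ˢ Finset.univ

theorem mem_ballModes {i : Mode s} : i ∈ ballModes s kF ↔ i.1 ∈ fermiBall kF := by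
  simp [ballModes]

theorem card_ballModes : (ballModes s kF).card = s * (fermiBall kF).card := by
  simp [ballModes, mul_comm]

theorem summable_excNum {Ψ : Fock s} (h : Ψ ∈ HN s kF) :
    Summable fun i : {i : Mode s // i.1 ∉ fermiBall kF} => cre i.1 (ann i.1 Ψ) := by
  have := summable_tcre_tann (kF := kF) (cardLE_of_mem h)
    (f := fun i : {i : Mode s // i.1 ∉ fermiBall kF} => i.1) Subtype.val_injective
    Subtype.val_injective (fun i => i.2) fun i => i.2
  refine this.congr fun i => ?_
  rw [tcre_of_notMem i.2, tann_of_notMem i.2]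

theorem hasSum_apply {ι : Type*} {v : ι → Fock s} {Ψ : Fock s} (h : HasSum v Ψ)
    (S : Finset (Mode s)) : HasSum (fun i => v i S) (Ψ S) := by
  have := h.mapL (innerSL ℂ (lp.single 2 S (1 : ℂ) : Fock s))
  simpa only [innerSL_apply_apply, ← apply_eq_inner] using this

theorem excNum_apply {Ψ : Fock s} (h : Ψ ∈ HN s kF) (S : Finset (Mode s)) :
    excNum kF Ψ S = (outCard kF S : ℂ) * Ψ S := by
  classical
  have h1 := hasSum_apply (summable_excNum h).hasSum S
  refine h1.unique ?_
  have h2 : ∀ i : {i : Mode s // i.1 ∉ fermiBall kF}, cre i.1 (ann i.1 Ψ) S =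
      if i.1 ∈ S then Ψ S else 0 := by
    intro i
    have := tcre_tann_apply (kF := kF) i.1 Ψ S
    rw [tcre_of_notMem i.2, tann_of_notMem i.2] at this
    rw [this]
    simp [i.2]
  simp only [h2]
  have h3 := hasSum_sum_of_ne_finset_zero (L := SummationFilter.unconditional _)
    (f := fun i : {i : Mode s // i.1 ∉ fermiBall kF} => if i.1 ∈ S then Ψ S else 0)
    (s := S.subtype fun i => i.1 ∉ fermiBall kF)
    (fun i hi => by rw [if_neg]; simpa using hi)
  convert h3 using 1
  rw [Finset.sum_congr rfl (g := fun _ => Ψ S) (fun i hi => by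
    rw [if_pos]; simpa using hi), Finset.sum_const, Finset.card_subtype, nsmul_eq_mul]
  rfl

theorem excNum_mem {Ψ : Fock s} (h : Ψ ∈ HN s kF) : excNum kF Ψ ∈ HN s kF := by
  intro S hS
  rw [excNum_apply h, h S hS, mul_zero]

/-- S and the ball modes have equal cardinality, hence S \ ball and ball \ S do too. This is the
only place where the choice N = s|B_F| is decisive. -/
theorem holeCard_eq {S : Finset (Mode s)} (h : S.card = s * (fermiBall kF).card) :
    ((ballModes s kF).filter fun i => (i ∈ S ↔ i.1 ∉ fermiBall kF)).card = outCard kF S := by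
  have e1 : ((ballModes s kF).filter fun i => (i ∈ S ↔ i.1 ∉ fermiBall kF)) =
      ballModes s kF \ S := by
    ext i
    simp only [Finset.mem_filter, Finset.mem_sdiff, mem_ballModes]
    tauto
  have e2 : S.filter (fun i => i.1 ∉ fermiBall kF) = S \ ballModes s kF := by
    ext i
    simp [mem_ballModes]
  rw [e1, outCard, e2]
  have h1 := Finset.card_sdiff_add_card_inter (ballModes s kF) S
  have h2 := Finset.card_sdiff_add_card_inter S (ballModes s kF)
  rw [Finset.inter_comm] at h2
  rw [card_ballModes] at h1
  omega

/-- Counting holes instead of particles turns N_E into a finite sum of bounded operators on the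
sector, so the finite-sum identities apply to it without a limit. -/
theorem num_ballModes {Ψ : Fock s} (h : Ψ ∈ HN s kF) :
    num kF (ballModes s kF) Ψ = excNum kF Ψ := by
  classical
  ext S
  rw [excNum_apply h]
  have := num_apply (kF := kF) (ballModes s kF) Ψ S
  by_cases hS : S.card = s * (fermiBall kF).card
  · rw [this, ← holeCard_eq hS]
  · rw [this, h S hS]; simp

theorem norm_num_le_excNum {Ψ : Fock s} (h : Ψ ∈ HN s kF) {Y : Finset (Mode s)}
    (hY : ∀ i ∈ Y, i.1 ∉ fermiBall kF) : ‖num kF Y Ψ‖ ≤ ‖excNum kF Ψ‖ := by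
  classical
  refine norm_le_of_apply_le fun S => ?_
  rw [num_apply, excNum_apply h, norm_mul, norm_mul]
  gcongr
  rw [Complex.norm_natCast, Complex.norm_natCast]
  norm_cast
  refine Finset.card_le_card fun i hi => ?_
  rw [Finset.mem_filter] at hi ⊢
  exact ⟨hi.2.2 (hY i hi.1), hY i hi.1⟩

theorem hasSum_excNum {Ψ : Fock s} (h : Ψ ∈ HN s kF) :
    HasSum (fun i : {i : Mode s // i.1 ∉ fermiBall kF} => ‖tann kF i.1 Ψ‖ ^ 2)
      (⟪Ψ, excNum kF Ψ⟫_ℂ).re := by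
  have h1 := ((summable_excNum h).hasSum.mapL (innerSL ℂ Ψ)).mapL Complex.reCLM
  refine h1.congr_fun fun i => ?_
  simp only [innerSL_apply_apply, inner_cre_right, Complex.reCLM_apply, tann_of_notMem i.2]
  exact norm_sq_eq_re_inner (𝕜 := ℂ) _

theorem sum_norm_tann_le_excNum {ι : Type*} {Ψ : Fock s} (h : Ψ ∈ HN s kF) (I : Finset ι)
    {g : ι → Mode s} (hg : Set.InjOn g I) (hgY : ∀ i ∈ I, (g i).1 ∉ fermiBall kF) :
    ∑ i ∈ I, ‖tann kF (g i) Ψ‖ ^ 2 ≤ (⟪Ψ, excNum kF Ψ⟫_ℂ).re := by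
  classical
  have e : ∑ i ∈ I, ‖tann kF (g i) Ψ‖ ^ 2 = ∑ i ∈ (I.image g).subtype
      (fun i => i.1 ∉ fermiBall kF), ‖tann kF i.1 Ψ‖ ^ 2 := by
    rw [Finset.sum_subtype_of_mem (f := fun i => ‖tann kF i Ψ‖ ^ 2), Finset.sum_image hg]
    intro i hi
    obtain ⟨j, hj, rfl⟩ := Finset.mem_image.1 hi
    exact hgY j hj
  rw [e]
  exact sum_le_hasSum _ (fun _ _ => by positivity) (hasSum_excNum h)

theorem sum_norm_tann_ball {Ψ : Fock s} (h : Ψ ∈ HN s kF) :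
    ∑ i ∈ ballModes s kF, ‖tann kF i Ψ‖ ^ 2 = (⟪Ψ, excNum kF Ψ⟫_ℂ).re := by
  rw [sum_norm_tann, num_ballModes h]

theorem inner_excNum_left {Φ Ψ : Fock s} (hΦ : Φ ∈ HN s kF) (hΨ : Ψ ∈ HN s kF) :
    ⟪excNum kF Φ, Ψ⟫_ℂ = ⟪Φ, excNum kF Ψ⟫_ℂ := by
  rw [← num_ballModes hΦ, ← num_ballModes hΨ, ← sum_inner_tann', ← sum_inner_tann]

theorem inner_excNum_excNum {Ψ : Fock s} (h : Ψ ∈ HN s kF) :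
    (⟪Ψ, excNum kF (excNum kF Ψ)⟫_ℂ).re = ‖excNum kF Ψ‖ ^ 2 := by
  rw [← inner_excNum_left h (excNum_mem h)]
  exact (norm_sq_eq_re_inner (𝕜 := ℂ) _).symm

theorem inner_excNum_le {Ψ : Fock s} (h : Ψ ∈ HN s kF) :
    (⟪Ψ, excNum kF Ψ⟫_ℂ).re ≤ ‖excNum kF Ψ‖ ^ 2 := by
  rw [← num_ballModes h, ← sum_norm_tann_tann, ← sum_norm_tann]
  exact le_add_of_nonneg_left (Finset.sum_nonneg fun _ _ => Finset.sum_nonneg fun _ _ => by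
    positivity)

theorem norm_tsum_tcre_tann_le {ι : Type*} {f g : ι → Mode s} (hf : Function.Injective f)
    (hg : Function.Injective g)
    (hfo : ∀ i, (f i).1 ∉ fermiBall kF) (hgo : ∀ i, (g i).1 ∉ fermiBall kF)
    {Ψ : Fock s} (h : Ψ ∈ HN s kF) :
    ‖∑' i, tcre kF (f i) (tann kF (g i) Ψ)‖ ≤ ‖excNum kF Ψ‖ := by
  classical
  refine le_of_tendsto (summable_tcre_tann (cardLE_of_mem h) hf hg hfo hgo).hasSum.norm
    (Filter.Eventually.of_forall fun Y => ?_)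
  refine (norm_sum_tcre_tann_le (kF := kF) Y hf.injOn hg.injOn (Y := Y.image f ∪ Y.image g)
    (fun i hi => Finset.mem_union_left _ (Finset.mem_image_of_mem _ hi))
    (fun i hi => Finset.mem_union_right _ (Finset.mem_image_of_mem _ hi)) Ψ).trans
    (norm_num_le_excNum h ?_)
  intro i hi
  rcases Finset.mem_union.1 hi with hi | hi <;> obtain ⟨j, -, rfl⟩ := Finset.mem_image.1 hi
  · exact hfo j
  · exact hgo j

end Number

end FermiGas

namespace FermiGas

/-! ### Lattice sums over momenta -/

section Lattice

theorem len_sq (p : Mom) : len p ^ 2 = ∑ i, (p i : ℝ) ^ 2 :=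
  Real.sq_sqrt (Finset.sum_nonneg fun _ _ => sq_nonneg _)

theorem len_nonneg (p : Mom) : 0 ≤ len p := Real.sqrt_nonneg _

theorem len_eq_norm (p : Mom) : len p = ‖WithLp.toLp 2 fun i => (p i : ℝ)‖ := by
  rw [EuclideanSpace.norm_eq]; simp [len]

theorem len_add_le (p q : Mom) : len (p + q) ≤ len p + len q := by
  rw [len_eq_norm, len_eq_norm, len_eq_norm]
  refine le_trans (le_of_eq ?_) (norm_add_le _ _)
  congr 1
  ext i
  simp

theorem len_neg (p : Mom) : len (-p) = len p := by simp [len]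

theorem abs_le_len (p : Mom) (i : Fin 3) : |(p i : ℝ)| ≤ len p :=
  Real.abs_le_sqrt (Finset.single_le_sum (f := fun i => (p i : ℝ) ^ 2)
    (fun _ _ => sq_nonneg _) (Finset.mem_univ i))

/-- The largest absolute value of the coordinates of a momentum. -/
def supLen (p : Mom) : ℕ := Finset.univ.sup fun i => (p i).natAbs

theorem abs_le_supLen (p : Mom) (i : Fin 3) : |(p i : ℝ)| ≤ supLen p := by
  have h : (p i).natAbs ≤ supLen p :=
    Finset.le_sup (f := fun i => (p i).natAbs) (Finset.mem_univ i)
  rw [← Int.cast_abs, Int.abs_eq_natAbs]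
  exact_mod_cast h

theorem exists_abs_eq_supLen (p : Mom) : ∃ i, |(p i : ℝ)| = supLen p := by
  obtain ⟨i, -, hi⟩ := Finset.exists_mem_eq_sup Finset.univ ⟨0, Finset.mem_univ _⟩
    (fun i : Fin 3 => (p i).natAbs)
  refine ⟨i, ?_⟩
  rw [← Int.cast_abs, Int.abs_eq_natAbs, supLen, hi]
  simp

theorem supLen_le_len (p : Mom) : (supLen p : ℝ) ≤ len p := by
  obtain ⟨i, hi⟩ := exists_abs_eq_supLen p
  rw [← hi]; exact abs_le_len p i

theorem len_le_supLen (p : Mom) : len p ≤ 2 * supLen p := by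
  refine Real.sqrt_le_iff.2 ⟨by positivity, ?_⟩
  have h : ∀ i, (p i : ℝ) ^ 2 ≤ (supLen p : ℝ) ^ 2 := fun i =>
    sq_le_sq.2 ((abs_le_supLen p i).trans (le_abs_self _))
  rw [Fin.sum_univ_three]
  nlinarith [h 0, h 1, h 2, sq_nonneg (supLen p : ℝ)]

theorem supLen_pos {p : Mom} (h : p ≠ 0) : 1 ≤ supLen p := by
  by_contra h'
  apply h
  funext i
  have := abs_le_supLen p i
  rw [show supLen p = 0 by omega] at this
  simpa using this

theorem one_le_len {p : Mom} (h : p ≠ 0) : 1 ≤ len p :=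
  le_trans (by exact_mod_cast supLen_pos h) (supLen_le_len p)

theorem mem_box_of_supLen_le {p : Mom} {m : ℕ} (h : supLen p ≤ m) :
    p ∈ Fintype.piFinset fun _ : Fin 3 => Finset.Icc (-(m : ℤ)) m := by
  rw [Fintype.mem_piFinset]
  intro i
  have h1 := abs_le_supLen p i
  have h2 : |p i| ≤ (m : ℤ) := by
    have : |(p i : ℝ)| ≤ (m : ℝ) := h1.trans (by exact_mod_cast h)
    exact_mod_cast this
  rw [Finset.mem_Icc]
  exact abs_le.1 h2

/-- The shell is the difference of two cubes, with (2m + 1)³ - (2m - 1)³ = 24m² + 2 ≤ 26m² points.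
-/
theorem card_shell_le (F : Finset Mom) {m : ℕ} (hm : 1 ≤ m) :
    (F.filter fun p => supLen p = m).card ≤ 26 * m ^ 2 := by
  obtain ⟨n, rfl⟩ : ∃ n, m = n + 1 := ⟨m - 1, by omega⟩
  set A := Fintype.piFinset fun _ : Fin 3 => Finset.Icc (-((n + 1 : ℕ) : ℤ)) (n + 1 : ℕ) with hA
  set B := Fintype.piFinset fun _ : Fin 3 => Finset.Icc (-(n : ℤ)) n with hB
  have hBA : B ⊆ A := by
    refine Fintype.piFinset_subset _ _ fun _ => Finset.Icc_subset_Icc ?_ ?_ <;> push_cast <;> linarith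
  have h1 : (F.filter fun p => supLen p = n + 1) ⊆ A \ B := by
    intro p hp
    rw [Finset.mem_filter] at hp
    rw [Finset.mem_sdiff]
    refine ⟨mem_box_of_supLen_le hp.2.le, fun hpB => ?_⟩
    obtain ⟨i, hi⟩ := exists_abs_eq_supLen p
    rw [hB, Fintype.mem_piFinset] at hpB
    have := abs_le.2 (Finset.mem_Icc.1 (hpB i))
    rw [hp.2] at hi
    have h3 : |(p i : ℝ)| ≤ n := by exact_mod_cast this
    rw [hi] at h3
    push_cast at h3
    linarith
  refine (Finset.card_le_card h1).trans ?_
  rw [Finset.card_sdiff_of_subset hBA, hA, hB, Fintype.card_piFinset_const,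
    Fintype.card_piFinset_const, Int.card_Icc, Int.card_Icc]
  have e1 : (((n + 1 : ℕ) : ℤ) + 1 - -((n + 1 : ℕ) : ℤ)).toNat = 2 * n + 3 := by omega
  have e2 : ((n : ℤ) + 1 - -(n : ℤ)).toNat = 2 * n + 1 := by omega
  rw [e1, e2, Nat.sub_le_iff_le_add]
  nlinarith

theorem sum_supLen_le {F : Finset Mom} (h0 : (0 : Mom) ∉ F) {R : ℕ}
    (hR : ∀ p ∈ F, supLen p ≤ R) {f : ℕ → ℝ} (hf : ∀ m, 0 ≤ f m) :
    ∑ p ∈ F, f (supLen p) ≤ ∑ m ∈ Finset.Icc 1 R, 26 * (m : ℝ) ^ 2 * f m := by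
  have hmaps : ∀ p ∈ F, supLen p ∈ Finset.Icc 1 R := fun p hp =>
    Finset.mem_Icc.2 ⟨supLen_pos (fun h => h0 (h ▸ hp)), hR p hp⟩
  rw [← Finset.sum_fiberwise_of_maps_to hmaps]
  refine Finset.sum_le_sum fun m hm => ?_
  rw [Finset.sum_congr rfl (g := fun _ => f m) (fun p hp => by rw [(Finset.mem_filter.1 hp).2]),
    Finset.sum_const, nsmul_eq_mul]
  refine mul_le_mul_of_nonneg_right ?_ (hf m)
  exact_mod_cast card_shell_le F (Finset.mem_Icc.1 hm).1

theorem card_fermiBall_le {R : ℝ} (hR : 0 ≤ R) :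
    ((fermiBall R).card : ℝ) ≤ (2 * R + 1) ^ 3 := by
  have h1 : (fermiBall R).card ≤ (2 * ⌊R⌋₊ + 1) ^ 3 := by
    refine (Finset.card_filter_le _ _).trans (le_of_eq ?_)
    rw [Fintype.card_piFinset_const, Int.card_Icc]
    congr 1
    rw [← Int.natCast_floor_eq_floor hR]
    omega
  refine (Nat.cast_le.2 h1).trans ?_
  push_cast
  have := Nat.floor_le hR
  gcongr

theorem card_lune_le {kF : ℝ} (hk : 1 ≤ kF) (l : Mom) :
    ((lune kF l).card : ℝ) ≤ 27 * kF ^ 3 := by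
  have h1 : (lune kF l).card ≤ (fermiBall kF).card :=
    (Finset.card_le_card Finset.sdiff_subset).trans Finset.card_image_le
  refine (Nat.cast_le.2 h1).trans ((card_fermiBall_le (by linarith)).trans ?_)
  calc (2 * kF + 1) ^ 3 ≤ (3 * kF) ^ 3 := by gcongr; linarith
    _ = _ := by ring

/-- Points with |k| ≥ k_F cost 1/k_F each, at most 125 k_F² together. A shell of radius m ≤ k_F
costs at most 26m²/m ≤ 26 k_F, and there are at most k_F such shells; 151 = 125 + 26. -/
theorem sum_inv_min_le {kF : ℝ} (hk : 1 ≤ kF) {Y : Finset Mom} (h0 : (0 : Mom) ∉ Y)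
    (hY : (Y.card : ℝ) ≤ 125 * kF ^ 3) : ∑ k ∈ Y, (min (len k) kF)⁻¹ ≤ 151 * kF ^ 2 := by
  set f : ℕ → ℝ := fun m => if m ≤ ⌊kF⌋₊ then (m : ℝ)⁻¹ else 0 with hf
  have hf0 : ∀ m, 0 ≤ f m := fun m => by simp only [hf]; split_ifs <;> positivity
  have h1 : ∀ k ∈ Y, (min (len k) kF)⁻¹ ≤ kF⁻¹ + f (supLen k) := by
    intro k hk'
    have hne : k ≠ 0 := fun h => h0 (h ▸ hk')
    rcases le_total (len k) kF with h | h
    · rw [min_eq_left h]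
      have h2 : supLen k ≤ ⌊kF⌋₊ := Nat.le_floor ((supLen_le_len k).trans h)
      have h3 : (len k)⁻¹ ≤ (supLen k : ℝ)⁻¹ :=
        inv_anti₀ (by exact_mod_cast supLen_pos hne) (supLen_le_len k)
      simp only [hf, if_pos h2]
      have : 0 ≤ kF⁻¹ := by positivity
      linarith
    · rw [min_eq_right h]
      linarith [hf0 (supLen k)]
  refine (Finset.sum_le_sum h1).trans ?_
  rw [Finset.sum_add_distrib, Finset.sum_const, nsmul_eq_mul]
  obtain ⟨R, hR⟩ : ∃ R, ∀ p ∈ Y, supLen p ≤ R := ⟨Y.sup supLen, fun p hp => Finset.le_sup hp⟩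
  have h2 := sum_supLen_le h0 hR hf0
  have h3 : ∑ m ∈ Finset.Icc 1 R, 26 * (m : ℝ) ^ 2 * f m ≤
      ∑ m ∈ Finset.Icc 1 ⌊kF⌋₊, 26 * kF := by
    have : ∀ m ∈ Finset.Icc 1 R, 26 * (m : ℝ) ^ 2 * f m ≤
        if m ∈ Finset.Icc 1 ⌊kF⌋₊ then 26 * kF else 0 := by
      intro m hm
      have hm1 := (Finset.mem_Icc.1 hm).1
      by_cases hmk : m ≤ ⌊kF⌋₊
      · rw [if_pos (Finset.mem_Icc.2 ⟨hm1, hmk⟩)]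
        simp only [hf, if_pos hmk]
        have hm0 : (m : ℝ) ≠ 0 := by positivity
        have : (m : ℝ) ≤ kF := (Nat.le_floor_iff (by linarith)).1 hmk
        field_simp
        linarith
      · rw [if_neg (fun h => hmk (Finset.mem_Icc.1 h).2)]
        simp [hf, hmk]
    refine (Finset.sum_le_sum this).trans ?_
    rw [← Finset.sum_filter]
    refine Finset.sum_le_sum_of_subset_of_nonneg (fun m hm => (Finset.mem_filter.1 hm).2) ?_
    intros; linarith
  rw [Finset.sum_const, Nat.card_Icc, nsmul_eq_mul, Nat.add_sub_cancel] at h3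
  have h4 : (⌊kF⌋₊ : ℝ) ≤ kF := Nat.floor_le (by linarith)
  have h5 : (Y.card : ℝ) * kF⁻¹ ≤ 125 * kF ^ 2 := by
    rw [← div_eq_mul_inv, div_le_iff₀ (by linarith)]
    linarith [show 125 * kF ^ 2 * kF = 125 * kF ^ 3 by ring]
  nlinarith

/-- Shells of O(m²) points with values at most m^{-4} leave Σ m^{-2}. This is where the dimension
three enters the convergence of Q_SR. -/
theorem summable_inv_one_add_len_sq :
    Summable fun p : Mom => ((1 + len p ^ 2) ^ 2)⁻¹ := by
  refine summable_of_sum_le (c := 1 + 26 * 2) (fun _ => by positivity) fun F => ?_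
  have h1 : ∑ p ∈ F, ((1 + len p ^ 2) ^ 2)⁻¹ ≤
      ∑ p ∈ insert 0 F, ((1 + len p ^ 2) ^ 2)⁻¹ :=
    Finset.sum_le_sum_of_subset_of_nonneg (Finset.subset_insert _ _) fun _ _ _ => by positivity
  refine h1.trans ?_
  rw [← Finset.insert_erase (Finset.mem_insert_self (0 : Mom) F), Finset.sum_insert (by simp)]
  set G := (insert 0 F).erase (0 : Mom)
  have hG : (0 : Mom) ∉ G := by simp [G]
  refine add_le_add (by simp [len]) ?_
  obtain ⟨R, hR⟩ : ∃ R, ∀ p ∈ G, supLen p ≤ R := ⟨G.sup supLen, fun p hp => Finset.le_sup hp⟩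
  have h2 : ∑ p ∈ G, ((1 + len p ^ 2) ^ 2)⁻¹ ≤ ∑ p ∈ G, ((supLen p : ℝ) ^ 4)⁻¹ := by
    refine Finset.sum_le_sum fun p hp => ?_
    have hp0 : 1 ≤ supLen p := supLen_pos fun h => hG (h ▸ hp)
    have h3 := supLen_le_len p
    refine inv_anti₀ (by positivity) ?_
    have h4 : (supLen p : ℝ) ^ 2 ≤ 1 + len p ^ 2 := by
      have : (supLen p : ℝ) ^ 2 ≤ len p ^ 2 := by gcongr
      linarith
    calc (supLen p : ℝ) ^ 4 = ((supLen p : ℝ) ^ 2) ^ 2 := by ring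
      _ ≤ _ := by gcongr
  refine h2.trans ((sum_supLen_le hG hR (f := fun m => ((m : ℝ) ^ 4)⁻¹)
    (fun _ => by positivity)).trans ?_)
  have h5 : ∀ m ∈ Finset.Icc 1 R, 26 * (m : ℝ) ^ 2 * ((m : ℝ) ^ 4)⁻¹ = 26 * ((m : ℝ) ^ 2)⁻¹ := by
    intro m hm
    have : (m : ℝ) ≠ 0 := by have := (Finset.mem_Icc.1 hm).1; positivity
    field_simp
  rw [Finset.sum_congr rfl h5, ← Finset.mul_sum]
  gcongr
  have h6 := sum_Ioo_inv_sq_le (α := ℝ) 0 (R + 1)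
  refine le_trans (le_of_eq ?_) (h6.trans (by norm_num))
  exact Finset.sum_congr (by ext; simp; omega) fun _ _ => rfl

/-! ### Weighted sums of the potential -/

variable {kF : ℝ} {V : Mom → ℝ}

theorem min_len_pos (hk : 1 ≤ kF) (k : MomStar) : 0 < min (len k.1) kF :=
  lt_min (by linarith [one_le_len k.2]) (by linarith)

theorem summable_errScale (hk : 1 ≤ kF) (hV : Summable fun k : MomStar => V k ^ 2) :
    Summable fun k : MomStar => V k ^ 2 * min (len k.1) kF :=
  Summable.of_nonneg_of_le
    (fun k => mul_nonneg (sq_nonneg _) (min_len_pos hk k).le)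
    (fun _ => mul_le_mul_of_nonneg_left (min_le_right _ _) (sq_nonneg _)) (hV.mul_right kF)

theorem errScale_nonneg : 0 ≤ errScale kF V := Real.sqrt_nonneg _

/-- Cauchy–Schwarz against the weight `min {|k|, k_F}`. -/
theorem sum_mul_le_errScale (hk : 1 ≤ kF) (hV : Summable fun k : MomStar => V k ^ 2)
    (F : Finset MomStar) {g : MomStar → ℝ} {A : ℝ} (hA : 0 ≤ A)
    (hg : ∑ k ∈ F, g k ^ 2 * (min (len k.1) kF)⁻¹ ≤ A ^ 2) :
    ∑ k ∈ F, V k * g k ≤ errScale kF V * A := by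
  have h1 := Real.sum_mul_le_sqrt_mul_sqrt F
    (fun k : MomStar => V k * √(min (len k.1) kF)) (fun k => g k * (√(min (len k.1) kF))⁻¹)
  have e1 : ∑ k ∈ F, V k * g k = ∑ k ∈ F, V k * √(min (len k.1) kF) *
      (g k * (√(min (len k.1) kF))⁻¹) := by
    refine Finset.sum_congr rfl fun k _ => ?_
    have := Real.sqrt_pos.2 (min_len_pos hk k)
    field_simp
  rw [e1]
  refine h1.trans ?_
  refine mul_le_mul ?_ ?_ (Real.sqrt_nonneg _) errScale_nonneg
  · refine Real.sqrt_le_sqrt ?_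
    refine le_trans (le_of_eq ?_) ((summable_errScale hk hV).sum_le_tsum F
      fun k _ => mul_nonneg (sq_nonneg _) (min_len_pos hk k).le)
    refine Finset.sum_congr rfl fun k _ => ?_
    rw [mul_pow, Real.sq_sqrt (min_len_pos hk k).le]
  · refine Real.sqrt_le_iff.2 ⟨hA, le_trans (le_of_eq ?_) hg⟩
    refine Finset.sum_congr rfl fun k _ => ?_
    rw [mul_pow, inv_pow, Real.sq_sqrt (min_len_pos hk k).le]

/-- Only the number of momenta matters, not their position; 13 is chosen so that 13² ≥ 151. -/
theorem sum_V_le (hk : 1 ≤ kF) (hV : Summable fun k : MomStar => V k ^ 2)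
    (F : Finset MomStar) (hF : (F.card : ℝ) ≤ 125 * kF ^ 3) :
    ∑ k ∈ F, V k ≤ errScale kF V * (13 * kF) := by
  have h1 := sum_mul_le_errScale hk hV F (g := fun _ => 1) (A := 13 * kF) (by linarith) (by
    have h2 := sum_inv_min_le hk (Y := F.map (Function.Embedding.subtype _))
      (by simp) (by rwa [Finset.card_map])
    rw [Finset.sum_map] at h2
    simp only [one_pow, one_mul]
    refine h2.trans ?_
    nlinarith)
  simpa using h1

end Lattice

end FermiGas

namespace FermiGas

/-! ### The sum of `1 / λ_{k,p}` over a lune -/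

section Lune

variable {kF : ℝ}

/-- `∑_{p ∈ L_l} 1 / λ_{l,p}`. -/
noncomputable def luneSum (kF : ℝ) (l : Mom) : ℝ := ∑ p ∈ lune kF l, (lam l p)⁻¹

theorem lam_eq (l p : Mom) :
    lam l p = ∑ i, (l i : ℝ) * p i - (∑ i, (l i : ℝ) ^ 2) / 2 := by
  rw [lam, len_sq, len_sq, Fin.sum_univ_three, Fin.sum_univ_three, Fin.sum_univ_three,
    Fin.sum_univ_three]
  simp only [Pi.sub_apply, Int.cast_sub]
  ring

/-- |p|² and |p - l|² are integers, so strict inequality means a gap of at least 1. -/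
theorem half_le_lam {l p : Mom} (h : p ∈ lune kF l) : 1 / 2 ≤ lam l p := by
  obtain ⟨h1, h2⟩ := mem_lune.1 h
  have h3 : len (p - l) < len p := h1.trans_lt h2
  have h4 : len (p - l) ^ 2 < len p ^ 2 := by
    have := len_nonneg (p - l); gcongr
  rw [len_sq, len_sq] at h4
  have h5 : ∑ i, ((p - l) i) ^ 2 + 1 ≤ ∑ i, (p i) ^ 2 := by
    have : ∑ i, ((p - l) i) ^ 2 < ∑ i, (p i) ^ 2 := by exact_mod_cast h4
    omega
  have h6 : ∑ i, (((p - l) i : ℤ) : ℝ) ^ 2 + 1 ≤ ∑ i, (p i : ℝ) ^ 2 := by exact_mod_cast h5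
  rw [lam, len_sq, len_sq]
  linarith

theorem lam_pos {l p : Mom} (h : p ∈ lune kF l) : 0 < lam l p := by
  linarith [half_le_lam h]

theorem luneSum_nonneg (l : Mom) : 0 ≤ luneSum kF l :=
  Finset.sum_nonneg fun _ hp => (inv_pos.2 (lam_pos hp)).le

theorem luneSum_far (hk : 1 ≤ kF) {l : Mom} (hl : 6 * kF < supLen l) :
    luneSum kF l ≤ 81 * kF ^ 3 / (supLen l : ℝ) ^ 2 := by
  have hL : (0 : ℝ) < supLen l := by linarith
  have h1 : ∀ p ∈ lune kF l, (lam l p)⁻¹ ≤ 3 / (supLen l : ℝ) ^ 2 := by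
    intro p hp
    have h2 := (mem_lune.1 hp).1
    have h3 : len l ≤ len p + len (p - l) := by
      have := len_add_le p (-(p - l))
      rwa [len_neg, show p + -(p - l) = l by abel] at this
    have h4 := supLen_le_len l
    have h5 := len_nonneg (p - l)
    -- Half the difference (5/6)² - (1/6)² is 1/3.
    have h6 : (supLen l : ℝ) ^ 2 / 3 ≤ lam l p := by
      rw [lam]
      have h7 : 5 / 6 * (supLen l : ℝ) ≤ len p := by linarith
      have h8 : len (p - l) ≤ supLen l / 6 := by linarith
      nlinarith
    rw [show 3 / (supLen l : ℝ) ^ 2 = ((supLen l : ℝ) ^ 2 / 3)⁻¹ by field_simp]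
    exact inv_anti₀ (by positivity) h6
  refine (Finset.sum_le_sum h1).trans ?_
  rw [Finset.sum_const, nsmul_eq_mul]
  have := card_lune_le hk l
  calc ((lune kF l).card : ℝ) * (3 / (supLen l : ℝ) ^ 2)
      ≤ 27 * kF ^ 3 * (3 / (supLen l : ℝ) ^ 2) := by gcongr
    _ = _ := by ring

theorem card_le_of_sub_le {T : Finset ℤ} {D : ℝ} (hD : 0 ≤ D)
    (h : ∀ a ∈ T, ∀ b ∈ T, (b : ℝ) - a ≤ D) : (T.card : ℝ) ≤ D + 1 := by
  rcases T.eq_empty_or_nonempty with rfl | hT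
  · simp; linarith
  have h1 : T ⊆ Finset.Icc (T.min' hT) (T.min' hT + ⌊D⌋) := by
    intro b hb
    rw [Finset.mem_Icc]
    refine ⟨Finset.min'_le _ _ hb, ?_⟩
    have := Int.le_floor.2 (show ((b - T.min' hT : ℤ) : ℝ) ≤ D by
      push_cast; exact h _ (Finset.min'_mem _ _) _ hb)
    linarith
  have h2 := Finset.card_le_card h1
  rw [Int.card_Icc] at h2
  have h3 : ((T.min' hT + ⌊D⌋ + 1 - T.min' hT).toNat : ℤ) = ⌊D⌋ + 1 := by
    have := Int.floor_nonneg.2 hD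
    omega
  have h4 : (T.card : ℤ) ≤ ⌊D⌋ + 1 := by omega
  have h5 : (T.card : ℝ) ≤ ⌊D⌋ + 1 := by exact_mod_cast h4
  linarith [Int.floor_le D]

/-- A quadratic polynomial with leading coefficient at least `1` takes values in an interval of
length `H` at no more than `2 (√H + 1)` integers. -/
theorem card_quadratic_le {T : Finset ℤ} {c β γ u H : ℝ} (hc : 1 ≤ c)
    (h : ∀ b ∈ T, u ≤ c * (b : ℝ) ^ 2 + β * b + γ ∧ c * (b : ℝ) ^ 2 + β * b + γ ≤ u + H) :
    (T.card : ℝ) ≤ 2 * (√H + 1) := by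
  -- Split at the vertex of the parabola. On either side the values at a ≤ b differ by at least (b -
  -- a)², so the diameter of T' is at most √H.
  have key : ∀ T' ⊆ T, ((∀ b ∈ T', (0 : ℝ) ≤ 2 * c * b + β) ∨ ∀ b ∈ T', 2 * c * (b : ℝ) + β ≤ 0) →
      (T'.card : ℝ) ≤ √H + 1 := by
    intro T' hT' hs
    refine card_le_of_sub_le (Real.sqrt_nonneg _) fun a ha b hb => ?_
    rcases le_total (b : ℝ) a with hab | hab
    · linarith [Real.sqrt_nonneg H]
    refine Real.le_sqrt_of_sq_le ?_
    have h1 := h a (hT' ha)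
    have h2 := h b (hT' hb)
    rcases hs with hs | hs
    · nlinarith [hs a ha, mul_nonneg (sub_nonneg.2 hab) (hs a ha), mul_nonneg (sub_nonneg.2 hc) (sq_nonneg ((b : ℝ) - a))]
    · nlinarith [mul_nonneg (sub_nonneg.2 hab) (neg_nonneg.2 (hs b hb)), mul_nonneg (sub_nonneg.2 hc) (sq_nonneg ((b : ℝ) - a))]
  have h1 := key (T.filter fun b => (0 : ℝ) ≤ 2 * c * b + β) (Finset.filter_subset _ _)
    (Or.inl fun b hb => (Finset.mem_filter.1 hb).2)
  have h2 := key (T.filter fun b => ¬ (0 : ℝ) ≤ 2 * c * b + β) (Finset.filter_subset _ _)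
    (Or.inr fun b hb => (not_le.1 (Finset.mem_filter.1 hb).2).le)
  have h3 := Finset.card_filter_add_card_filter_not (s := T) (fun b => (0 : ℝ) ≤ 2 * c * (b : ℝ) + β)
  have h4 : (T.card : ℝ) = ((T.filter fun b : ℤ => (0 : ℝ) ≤ 2 * c * (b : ℝ) + β).card : ℝ) +
    ((T.filter fun b : ℤ => ¬ (0 : ℝ) ≤ 2 * c * (b : ℝ) + β).card : ℝ) := by exact_mod_cast h3.symm
  linarith

theorem exists_complementary_axes (i : Fin 3) : ∃ a b : Fin 3,
    (∀ f : Fin 3 → ℝ, ∑ x, f x = f i + f a + f b) ∧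
      ∀ p q : Mom, p i = q i → p a = q a → p b = q b → p = q := by
  fin_cases i
  · refine ⟨1, 2, fun f => Fin.sum_univ_three f, fun p q h1 h2 h3 => ?_⟩
    funext x; fin_cases x <;> assumption
  · refine ⟨0, 2, fun f => by rw [Fin.sum_univ_three]; simp; ring, fun p q h1 h2 h3 => ?_⟩
    funext x; fin_cases x <;> assumption
  · refine ⟨0, 1, fun f => by rw [Fin.sum_univ_three]; simp; ring, fun p q h1 h2 h3 => ?_⟩
    funext x; fin_cases x <;> assumption

theorem len_le_of_mem_lune {l p : Mom} (hL : (supLen l : ℝ) ≤ 6 * kF)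
    (hp : p ∈ lune kF l) : len p ≤ 13 * kF := by
  have h1 := (mem_lune.1 hp).1
  have h2 := len_add_le (p - l) l
  rw [sub_add_cancel] at h2
  linarith [len_le_supLen l]

set_option maxHeartbeats 600000 in
-- Let i be an axis with |l_i| = L, the sup norm of l. Slice by p_a, which takes at most 3 k_F
-- values, and by ⌊λ/L⌋, which takes at most Λ/L + 1 values. In a slice λ varies by less than L
-- while a unit step of p_i changes it by L, so p_b determines p. There p_i is within δ/L, δ =
-- min{L, Λ}, of an affine function of p_b, and |p|² lies between k_F² and k_F² + 2Λ; hence a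
-- quadratic polynomial in p_b is confined to a short interval and `card_quadratic_le` counts its
-- integer arguments.
theorem card_lune_filter_le (hk : 1 ≤ kF) {l : Mom} (hl : l ≠ 0)
    (hL : (supLen l : ℝ) ≤ 6 * kF) {Λ : ℝ} (hΛ : 0 < Λ) :
    (((lune kF l).filter fun p => lam l p ≤ Λ).card : ℝ) ≤
      2 * (√(2 * Λ + 53 * kF * (min (supLen l : ℝ) Λ / supLen l)) + 1) *
        ((3 * kF) * (Λ / supLen l + 1)) := by
  obtain ⟨i, hi⟩ := exists_abs_eq_supLen l
  obtain ⟨a, b, hsum, hext⟩ := exists_complementary_axes i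
  set L : ℝ := (supLen l : ℝ) with hLdef
  have hL1 : (1 : ℝ) ≤ L := by rw [hLdef]; exact_mod_cast supLen_pos hl
  have hL0 : 0 < L := by linarith
  have hli : (l i : ℝ) ≠ 0 := fun h => by rw [h, abs_zero] at hi; linarith
  set δ : ℝ := min L Λ with hδ
  have hδ0 : 0 < δ := lt_min hL0 hΛ
  have hδL : δ / L ≤ 1 := (div_le_one hL0).2 (min_le_left _ _)
  have hδL0 : 0 < δ / L := div_pos hδ0 hL0
  set H : ℝ := 2 * Λ + 53 * kF * (δ / L) with hH
  have hH0 : 0 ≤ H := by positivity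
  set Q : ℝ := (∑ x, (l x : ℝ) ^ 2) / 2 with hQ
  have hlam : ∀ p, lam l p = l i * p i + l a * p a + l b * p b - Q := fun p => by
    rw [lam_eq, hsum]
  set T := (lune kF l).filter fun p => lam l p ≤ Λ with hT
  set A : Finset ℤ := Finset.Icc (l a - ⌊kF⌋) (l a + ⌊kF⌋) with hA
  set J := Finset.range (⌊Λ / L⌋₊ + 1) with hJ
  have hfl : ∀ p ∈ T, (⌊lam l p / L⌋₊ : ℝ) * L ≤ lam l p ∧
      lam l p - ⌊lam l p / L⌋₊ * L ≤ δ := by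
    intro p hp
    obtain ⟨hp1, hp2⟩ := Finset.mem_filter.1 hp
    have h0 := lam_pos hp1
    have h1 := Nat.floor_le (div_nonneg h0.le hL0.le)
    have h2 := Nat.lt_floor_add_one (lam l p / L)
    rw [le_div_iff₀ hL0] at h1
    rw [div_lt_iff₀ hL0] at h2
    refine ⟨h1, le_min (by linarith) ?_⟩
    have : 0 ≤ (⌊lam l p / L⌋₊ : ℝ) * L := by positivity
    linarith
  have hmaps : ∀ p ∈ T, (p a, ⌊lam l p / L⌋₊) ∈ A ×ˢ J := by
    intro p hp
    obtain ⟨hp1, hp2⟩ := Finset.mem_filter.1 hp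
    rw [Finset.mem_product]
    constructor
    · have h1 := (abs_le_len (p - l) a).trans (mem_lune.1 hp1).1
      rw [Pi.sub_apply, ← Int.cast_abs] at h1
      have h2 := abs_le.1 (Int.le_floor.2 h1)
      simp only [hA, Finset.mem_Icc]
      constructor <;> linarith [h2.1, h2.2]
    · simp only [hJ, Finset.mem_range, Nat.lt_succ_iff]
      exact Nat.floor_le_floor (by gcongr)
  have hfib : ∀ y ∈ A ×ˢ J, (T.filter fun p => (p a, ⌊lam l p / L⌋₊) = y).card ≤
      ⌊2 * (√H + 1)⌋₊ := by
    rintro ⟨A0, j⟩ -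
    refine Nat.le_floor ?_
    set W := T.filter fun p => (p a, ⌊lam l p / L⌋₊) = (A0, j) with hW
    have hW1 : ∀ p ∈ W, p ∈ T ∧ p a = A0 ∧ ⌊lam l p / L⌋₊ = j := by
      intro p hp
      obtain ⟨h1, h2⟩ := Finset.mem_filter.1 hp
      exact ⟨h1, by simpa using h2⟩
    have hinj : Set.InjOn (fun p : Mom => p b) W := by
      intro p hp q hq hpq
      obtain ⟨hp1, hp2, hp3⟩ := hW1 p hp
      obtain ⟨hq1, hq2, hq3⟩ := hW1 q hq
      have hpq' : p b = q b := hpq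
      refine hext p q ?_ (hp2.trans hq2.symm) hpq'
      have e1 : lam l p - lam l q = l i * ((p i - q i : ℤ) : ℝ) := by
        rw [hlam, hlam, hp2, hq2, hpq']; push_cast; ring
      have h1 := Nat.floor_le (div_nonneg (lam_pos (Finset.mem_filter.1 hp1).1).le hL0.le)
      have h2 := Nat.lt_floor_add_one (lam l p / L)
      have h3 := Nat.floor_le (div_nonneg (lam_pos (Finset.mem_filter.1 hq1).1).le hL0.le)
      have h4 := Nat.lt_floor_add_one (lam l q / L)
      rw [hp3] at h1 h2
      rw [hq3] at h3 h4
      have h5 : |lam l p - lam l q| < L := by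
        have : |lam l p / L - lam l q / L| < 1 := abs_lt.2 ⟨by linarith, by linarith⟩
        rwa [← sub_div, abs_div, abs_of_pos hL0, div_lt_one hL0] at this
      rw [e1, abs_mul, hi] at h5
      have h6 : |((p i - q i : ℤ) : ℝ)| < 1 := by
        by_contra hcon
        nlinarith [not_lt.1 hcon]
      have h7 : |p i - q i| < 1 := by exact_mod_cast h6
      have h8 := Int.abs_lt_one_iff.1 h7
      linarith
    rw [← Finset.card_image_of_injOn hinj]
    set r : ℝ := l b / l i with hr
    set τ0 : ℝ := (j * L - l a * A0 + Q) / l i with hτ0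
    -- The polynomial is p_a² + p_b² + (τ0 - r p_b)² = |p|² - 2 p_i e + e². With |p_i| ≤ 13 k_F and
    -- |e| ≤ δ/L, the cross term costs 26 k_F δ/L on each side and e² costs one more, giving the 53
    -- in H.
    refine card_quadratic_le (c := 1 + r ^ 2) (β := -2 * τ0 * r) (γ := (A0 : ℝ) ^ 2 + τ0 ^ 2)
      (u := kF ^ 2 - 26 * kF * (δ / L)) (by nlinarith [sq_nonneg r]) fun n hn => ?_
    obtain ⟨p, hp, rfl⟩ := Finset.mem_image.1 hn
    obtain ⟨hp1, hp2, hp3⟩ := hW1 p hp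
    obtain ⟨hp4, hp5⟩ := Finset.mem_filter.1 hp1
    have hf := hfl p hp1
    rw [hp3] at hf
    set e : ℝ := (lam l p - j * L) / l i with he
    have hτ : τ0 - r * p b = p i - e := by
      rw [hτ0, hr, he, hlam, hp2]
      field_simp
      ring
    have hsq : (p i : ℝ) ^ 2 + A0 ^ 2 + (p b : ℝ) ^ 2 = len p ^ 2 := by
      rw [len_sq, hsum, hp2]
    have e1 : (1 + r ^ 2) * (p b : ℝ) ^ 2 + -2 * τ0 * r * p b + ((A0 : ℝ) ^ 2 + τ0 ^ 2) =
        len p ^ 2 - 2 * p i * e + e ^ 2 := by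
      rw [← hsq]
      have : (1 + r ^ 2) * (p b : ℝ) ^ 2 + -2 * τ0 * r * p b + ((A0 : ℝ) ^ 2 + τ0 ^ 2) =
        (A0 : ℝ) ^ 2 + (p b : ℝ) ^ 2 + (τ0 - r * p b) ^ 2 := by ring
      rw [this, hτ]
      ring
    have he1 : |e| ≤ δ / L := by
      rw [he, abs_div, hi, abs_of_nonneg (by linarith [hf.1])]
      exact div_le_div_of_nonneg_right hf.2 hL0.le
    have hpi : |(p i : ℝ)| ≤ 13 * kF := (abs_le_len p i).trans (len_le_of_mem_lune hL hp4)
    have h1 : |(p i : ℝ) * e| ≤ 13 * kF * (δ / L) := by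
      rw [abs_mul]; gcongr
    have h2 := abs_le.1 h1
    have h3 : e ^ 2 ≤ kF * (δ / L) := by
      rw [← sq_abs]
      nlinarith [abs_nonneg e]
    obtain ⟨h4, h5⟩ := mem_lune.1 hp4
    have h6 : len p ^ 2 = len (p - l) ^ 2 + 2 * lam l p := by rw [lam]; ring
    have h7 : len (p - l) ^ 2 ≤ kF ^ 2 := by
      have := len_nonneg (p - l); gcongr
    have h8 : kF ^ 2 ≤ len p ^ 2 := by gcongr
    simp only [e1]
    constructor
    · linarith [sq_nonneg e, h2.2]
    · linarith [h2.1]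
  have h1 := Finset.card_le_mul_card_image_of_maps_to hmaps _ hfib
  have h2 : (T.card : ℝ) ≤ (⌊2 * (√H + 1)⌋₊ : ℝ) * ((A.card : ℝ) * J.card) := by
    rw [Finset.card_product] at h1
    exact_mod_cast h1
  have h3 : (A.card : ℝ) ≤ 3 * kF := by
    have e : A.card = 2 * ⌊kF⌋₊ + 1 := by
      rw [hA, Int.card_Icc, ← Int.natCast_floor_eq_floor (by linarith : 0 ≤ kF)]
      omega
    rw [e]
    push_cast
    linarith [Nat.floor_le (show 0 ≤ kF by linarith)]
  have h4 : (J.card : ℝ) ≤ Λ / L + 1 := by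
    rw [hJ, Finset.card_range]
    push_cast
    linarith [Nat.floor_le (show 0 ≤ Λ / L by positivity)]
  have h5 := Nat.floor_le (show 0 ≤ 2 * (√H + 1) by positivity)
  refine h2.trans ?_
  gcongr

end Lune

end FermiGas

namespace FermiGas

/-! ### Dyadic summation of the lune counts and the sum over all lunes -/

section LuneSum

variable {kF : ℝ}

/-- The least i with x ≤ 2^i satisfies 2^i ≤ 2x; for i = 0 this is x ≥ 1/2, exactly what
`half_le_lam` supplies. -/
theorem inv_le_dyadic_sum {x : ℝ} (hx : 1 / 2 ≤ x) {J : ℕ} (hJ : x ≤ 2 ^ J) :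
    x⁻¹ ≤ 2 * ∑ i ∈ Finset.range (J + 1), if x ≤ 2 ^ i then ((2 : ℝ) ^ i)⁻¹ else 0 := by
  classical
  have hex : ∃ i : ℕ, x ≤ 2 ^ i := ⟨J, hJ⟩
  set i := Nat.find hex with hi
  have h1 : x ≤ 2 ^ i := Nat.find_spec hex
  have h2 : i ≤ J := Nat.find_min' hex hJ
  have h3 : (2 : ℝ) ^ i ≤ 2 * x := by
    rcases Nat.eq_zero_or_pos i with h0 | h0
    · rw [h0]; linarith
    · have h4 := Nat.find_min hex (m := i - 1) (by omega)
      have h5 : (2 : ℝ) ^ i = 2 * 2 ^ (i - 1) := by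
        rw [← pow_succ', Nat.sub_add_cancel h0]
      rw [h5]
      linarith [not_le.1 h4]
  have h6 : ((2 : ℝ) ^ i)⁻¹ ≤
      ∑ i ∈ Finset.range (J + 1), if x ≤ 2 ^ i then ((2 : ℝ) ^ i)⁻¹ else 0 := by
    have := Finset.single_le_sum (f := fun i : ℕ => if x ≤ 2 ^ i then ((2 : ℝ) ^ i)⁻¹ else 0)
      (fun i _ => by split_ifs <;> positivity) (Finset.mem_range.2 (Nat.lt_succ_of_le h2))
    simpa [h1] using this
  have h7 : x⁻¹ ≤ 2 * ((2 : ℝ) ^ i)⁻¹ := by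
    rw [← div_eq_mul_inv, le_div_iff₀ (by positivity), inv_mul_le_iff₀ (by linarith)]
    linarith
  linarith

/-- The first term covers Λ ≤ L, where there are at most two layers of ⌊λ/L⌋; the second covers Λ ≥
L, where the layers number about Λ/L. -/
theorem card_lune_filter_le' (hk : 1 ≤ kF) {l : Mom} (hl : l ≠ 0)
    (hL : (supLen l : ℝ) ≤ 6 * kF) {Λ : ℝ} (hΛ : 1 ≤ Λ) :
    (((lune kF l).filter fun p => lam l p ≤ Λ).card : ℝ) ≤
      144 * kF * √(kF / supLen l) * √Λ + 108 * kF * (Λ / supLen l) * (√Λ + √kF) := by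
  refine (card_lune_filter_le hk hl hL (by linarith)).trans ?_
  set L : ℝ := (supLen l : ℝ) with hLdef
  have hL1 : (1 : ℝ) ≤ L := by rw [hLdef]; exact_mod_cast supLen_pos hl
  have hkL : 1 / 6 ≤ kF / L := by rw [le_div_iff₀ (by linarith)]; linarith
  have hkL0 : 0 < kF / L := by linarith
  rcases le_total Λ L with h | h
  · rw [min_eq_right h]
    have h1 : 2 * Λ + 53 * kF * (Λ / L) ≤ 81 * (kF / L * Λ) := by
      have : 53 * kF * (Λ / L) = 53 * (kF / L * Λ) := by ring
      nlinarith
    have h2 : √(2 * Λ + 53 * kF * (Λ / L)) ≤ 9 * (√(kF / L) * √Λ) := by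
      rw [← Real.sqrt_mul hkL0.le]
      refine (Real.sqrt_le_sqrt h1).trans (le_of_eq ?_)
      rw [Real.sqrt_mul (by norm_num), show (81 : ℝ) = 9 ^ 2 by norm_num,
        Real.sqrt_sq (by norm_num)]
    have h3 : 1 ≤ 3 * (√(kF / L) * √Λ) := by
      rw [← Real.sqrt_mul hkL0.le]
      have : 1 / 3 ≤ √(kF / L * Λ) := Real.le_sqrt_of_sq_le (by nlinarith)
      linarith
    have h4 : Λ / L + 1 ≤ 2 := by
      have := (div_le_one (by linarith : 0 < L)).2 h
      linarith
    have h5 : 0 ≤ 108 * kF * (Λ / L) * (√Λ + √kF) := by positivity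
    calc 2 * (√(2 * Λ + 53 * kF * (Λ / L)) + 1) * (3 * kF * (Λ / L + 1))
        ≤ 2 * (9 * (√(kF / L) * √Λ) + 3 * (√(kF / L) * √Λ)) * (3 * kF * 2) := by gcongr
      _ = 144 * kF * √(kF / L) * √Λ := by ring
      _ ≤ _ := by linarith
  · rw [min_eq_left h, div_self (by linarith), mul_one]
    have h2 : √(2 * Λ + 53 * kF) ≤ 8 * (√Λ + √kF) := by
      refine Real.sqrt_le_iff.2 ⟨by positivity, ?_⟩
      have := Real.sq_sqrt (show 0 ≤ Λ by linarith)
      have := Real.sq_sqrt (show 0 ≤ kF by linarith)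
      have : 0 ≤ √Λ * √kF := by positivity
      nlinarith
    have h3 : 1 ≤ √Λ + √kF := by
      have : 1 ≤ √Λ := Real.one_le_sqrt.2 hΛ
      linarith [Real.sqrt_nonneg kF]
    have h4 : Λ / L + 1 ≤ 2 * (Λ / L) := by
      have := (one_le_div (by linarith : 0 < L)).2 h
      linarith
    have h5 : 0 ≤ 144 * kF * √(kF / L) * √Λ := by positivity
    calc 2 * (√(2 * Λ + 53 * kF) + 1) * (3 * kF * (Λ / L + 1))
        ≤ 2 * (8 * (√Λ + √kF) + (√Λ + √kF)) * (3 * kF * (2 * (Λ / L))) := by gcongr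
      _ = 108 * kF * (Λ / L) * (√Λ + √kF) := by ring
      _ ≤ _ := by linarith

theorem lam_le {l p : Mom} (hL : (supLen l : ℝ) ≤ 6 * kF)
    (hp : p ∈ lune kF l) : lam l p ≤ 14 * kF * supLen l := by
  have h1 := (mem_lune.1 hp).1
  have h2 := len_le_of_mem_lune hL hp
  have h3 := len_add_le (p - l) l
  rw [sub_add_cancel] at h3
  have h4 := len_le_supLen l
  have h5 := len_nonneg (p - l)
  have h6 := len_nonneg p
  have h7 : lam l p = (len p - len (p - l)) * (len p + len (p - l)) / 2 := by rw [lam]; ring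
  rw [h7]
  have h8 : (len p - len (p - l)) * (len p + len (p - l)) ≤
      (2 * supLen l) * (14 * kF) :=
    mul_le_mul (by linarith) (by linarith) (by positivity) (by positivity)
  linarith

/-- Weighting the counts at Λ = 2^i by 2^{-i} leaves a decaying geometric series, a growing one
controlled by the top scale 2^J ≲ k_F L, and J + 1 equal terms. The two geometric parts have the
same size, k_F √(k_F/L); the equal terms give the second summand of the bound. -/
theorem luneSum_sq_le (hk : 1 ≤ kF) {l : Mom} (hl : l ≠ 0) (hL : (supLen l : ℝ) ≤ 6 * kF) :
    luneSum kF l ^ 2 ≤ 10 ^ 8 *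
      (kF ^ 3 / supLen l + kF ^ 3 * √(kF * supLen l) / (supLen l : ℝ) ^ 2) := by
  have hlam := fun p (hp : p ∈ lune kF l) => lam_le hL hp
  have hcard := fun {Λ : ℝ} (hΛ : 1 ≤ Λ) => card_lune_filter_le' hk hl hL hΛ
  set L : ℝ := (supLen l : ℝ) with hLdef
  have hL1 : (1 : ℝ) ≤ L := by rw [hLdef]; exact_mod_cast supLen_pos hl
  have hkL1 : 1 ≤ kF * L := by nlinarith
  obtain ⟨n, hn1, hn2⟩ := exists_nat_pow_near (show 1 ≤ 14 * kF * L by nlinarith)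
    (show (1 : ℝ) < 2 by norm_num)
  set J := n + 1 with hJ
  have hJ1 : (2 : ℝ) ^ J ≤ 28 * (kF * L) := by rw [hJ, pow_succ]; linarith
  set r : ℝ := √2 with hr
  have hr2 : r ^ 2 = 2 := Real.sq_sqrt (by norm_num)
  have hr0 : 0 < r := Real.sqrt_pos.2 (by norm_num)
  have hr1 : 1.4 ≤ r := Real.le_sqrt_of_sq_le (by norm_num)
  have hrpow : ∀ i : ℕ, √((2 : ℝ) ^ i) = r ^ i := fun i => by
    rw [← hr2, ← pow_mul, mul_comm, pow_mul, Real.sqrt_sq (by positivity)]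
  have hrJ : r ^ J ≤ 6 * √(kF * L) := by
    rw [← hrpow]
    refine Real.sqrt_le_iff.2 ⟨by positivity, ?_⟩
    rw [mul_pow, Real.sq_sqrt (by linarith)]
    linarith
  -- Bernoulli's inequality for 2^{J/4}: the logarithmic number of scales is traded for a small
  -- power of k_F L, which the sum over l can afford.
  have hJsq : ((J : ℝ) + 1) ^ 2 ≤ 384 * √(kF * L) := by
    have h1 : (1.18 : ℝ) ≤ √r := Real.le_sqrt_of_sq_le (by linarith)
    have h2 := one_add_mul_le_pow (show (-2 : ℝ) ≤ √r - 1 by linarith) J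
    rw [add_sub_cancel] at h2
    have h3 : (J : ℝ) + 1 ≤ 8 * √r ^ J := by
      have : (0 : ℝ) ≤ J := by positivity
      nlinarith
    calc ((J : ℝ) + 1) ^ 2 ≤ (8 * √r ^ J) ^ 2 := by gcongr
      _ = 64 * r ^ J := by rw [mul_pow, ← pow_mul, mul_comm J 2, pow_mul, Real.sq_sqrt hr0.le]; norm_num
      _ ≤ 384 * √(kF * L) := by linarith
  have hs1 : ∀ m : ℕ, ∑ i ∈ Finset.range (m + 1), r ^ i ≤ 4 * r ^ m := by
    intro m
    induction m with
    | zero => simp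
    | succ m ih =>
      rw [Finset.sum_range_succ]
      have : r ^ (m + 1) = r * r ^ m := pow_succ' r m
      have : 0 < r ^ m := by positivity
      nlinarith
  have hs2 : ∀ m : ℕ, ∑ i ∈ Finset.range m, (r ^ i)⁻¹ ≤ 4 - 4 * (r ^ m)⁻¹ := by
    intro m
    induction m with
    | zero => simp
    | succ m ih =>
      rw [Finset.sum_range_succ, pow_succ, mul_inv]
      have h1 : 0 < (r ^ m)⁻¹ := by positivity
      have h2 : r⁻¹ ≤ 3 / 4 := by
        rw [inv_le_comm₀ hr0 (by norm_num)]; linarith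
      nlinarith
  have hdy : luneSum kF l ≤ 2 * ∑ i ∈ Finset.range (J + 1),
      ((2 : ℝ) ^ i)⁻¹ * ((lune kF l).filter fun p => lam l p ≤ 2 ^ i).card := by
    have h1 : luneSum kF l ≤ ∑ p ∈ lune kF l, 2 * ∑ i ∈ Finset.range (J + 1),
        if lam l p ≤ 2 ^ i then ((2 : ℝ) ^ i)⁻¹ else 0 :=
      Finset.sum_le_sum fun p hp => inv_le_dyadic_sum (half_le_lam hp)
        ((hlam p hp).trans hn2.le)
    refine h1.trans (le_of_eq ?_)
    rw [← Finset.mul_sum, Finset.sum_comm]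
    congr 1
    refine Finset.sum_congr rfl fun i _ => ?_
    rw [← Finset.sum_filter, Finset.sum_const, nsmul_eq_mul, mul_comm]
  have hterm : ∀ i : ℕ, ((2 : ℝ) ^ i)⁻¹ * ((lune kF l).filter fun p => lam l p ≤ 2 ^ i).card ≤
      144 * kF * √(kF / L) * (r ^ i)⁻¹ + 108 * (kF / L) * (r ^ i + √kF) := by
    intro i
    have h1 := hcard (Λ := 2 ^ i) (one_le_pow₀ (by norm_num))
    rw [hrpow] at h1
    refine (mul_le_mul_of_nonneg_left h1 (by positivity)).trans (le_of_eq ?_)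
    have h2 : (2 : ℝ) ^ i = r ^ i * r ^ i := by rw [← hr2, ← pow_mul, ← pow_add]; ring_nf
    have h3 : r ^ i ≠ 0 := by positivity
    have h4 : L ≠ 0 := by linarith
    rw [h2]
    field_simp
  have hsum : luneSum kF l ≤ 6336 * (kF * √(kF / L)) + 216 * (kF / L * √kF * (J + 1)) := by
    refine hdy.trans ?_
    have h1 := Finset.sum_le_sum fun i (_ : i ∈ Finset.range (J + 1)) => hterm i
    rw [Finset.sum_add_distrib, ← Finset.mul_sum, ← Finset.mul_sum, Finset.sum_add_distrib,
      Finset.sum_const, Finset.card_range, nsmul_eq_mul] at h1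
    have h2 : ∑ i ∈ Finset.range (J + 1), (r ^ i)⁻¹ ≤ 4 := (hs2 (J + 1)).trans (by
      have : 0 < (r ^ (J + 1))⁻¹ := by positivity
      linarith)
    have h3 : ∑ i ∈ Finset.range (J + 1), r ^ i ≤ 24 * √(kF * L) := (hs1 J).trans (by linarith)
    -- The growing series at its top scale matches the decaying series at its bottom scale.
    have h4 : kF / L * √(kF * L) = kF * √(kF / L) := by
      rw [Real.sqrt_div (by linarith), Real.sqrt_mul (by linarith)]
      have := Real.mul_self_sqrt (show 0 ≤ L by linarith)
      have : √L ≠ 0 := (Real.sqrt_pos.2 (by linarith)).ne'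
      have : L ≠ 0 := by linarith
      field_simp
      linarith
    have h5 : 144 * kF * √(kF / L) * ∑ i ∈ Finset.range (J + 1), (r ^ i)⁻¹ ≤
        144 * kF * √(kF / L) * 4 := by gcongr
    have h6 : 108 * (kF / L) * (∑ i ∈ Finset.range (J + 1), r ^ i + ((J + 1 : ℕ) : ℝ) * √kF) ≤
        108 * (kF / L) * (24 * √(kF * L) + ((J + 1 : ℕ) : ℝ) * √kF) := by
      gcongr
    have h7 : 108 * (kF / L) * (24 * √(kF * L) + ((J + 1 : ℕ) : ℝ) * √kF) =
        2592 * (kF * √(kF / L)) + 108 * (kF / L * √kF * (J + 1)) := by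
      rw [← h4]; push_cast; ring
    linarith
  have hsq := pow_le_pow_left₀ (luneSum_nonneg l) hsum 2
  have e1 : (kF * √(kF / L)) ^ 2 = kF ^ 3 / L := by
    rw [mul_pow, Real.sq_sqrt (by positivity)]; ring
  have e2 : (kF / L * √kF * (J + 1)) ^ 2 ≤ 384 * (kF ^ 3 * √(kF * L) / L ^ 2) := by
    calc (kF / L * √kF * (J + 1)) ^ 2 = kF ^ 3 / L ^ 2 * ((J : ℝ) + 1) ^ 2 := by
          rw [mul_pow, mul_pow, Real.sq_sqrt (by linarith)]; ring
      _ ≤ kF ^ 3 / L ^ 2 * (384 * √(kF * L)) := by gcongr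
      _ = _ := by ring
  have e3 : 0 ≤ kF ^ 3 / L := by positivity
  have e4 : 0 ≤ kF ^ 3 * √(kF * L) / L ^ 2 := by positivity
  nlinarith [sq_nonneg (6336 * (kF * √(kF / L)) - 216 * (kF / L * √kF * (J + 1)))]

theorem sum_inv_sqrt_le (n : ℕ) : ∑ m ∈ Finset.Icc 1 n, (√(m : ℝ))⁻¹ ≤ 2 * √(n : ℝ) := by
  induction n with
  | zero => simp
  | succ n ih =>
    rw [← Finset.insert_Icc_right_eq_Icc_add_one (by omega), Finset.sum_insert (by simp)]
    have h1 : (√((n + 1 : ℕ) : ℝ))⁻¹ ≤ 2 * (√((n + 1 : ℕ) : ℝ) - √(n : ℝ)) := by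
      have ha := Real.sq_sqrt (show (0 : ℝ) ≤ ((n + 1 : ℕ) : ℝ) by positivity)
      have hb := Real.sq_sqrt (show (0 : ℝ) ≤ (n : ℝ) by positivity)
      have hc : 0 < √((n + 1 : ℕ) : ℝ) := Real.sqrt_pos.2 (by positivity)
      rw [inv_le_iff_one_le_mul₀ hc]
      push_cast at *
      nlinarith [sq_nonneg (√((n : ℝ) + 1) - √(n : ℝ))]
    linarith

/-- `∑_{l ≠ 0} (∑_{p ∈ L_l} 1/λ_{l,p})² / min {|l|, k_F} ≤ C k_F⁴`. -/
theorem sum_luneSum_sq_le (hk : 1 ≤ kF) {Y : Finset Mom} (h0 : (0 : Mom) ∉ Y) :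
    ∑ l ∈ Y, luneSum kF l ^ 2 * (min (len l) kF)⁻¹ ≤ 10 ^ 12 * kF ^ 4 := by
  -- Majorants by shells: for sup norm m ≤ 6 k_F use min{|l|, k_F} ≥ m/6 and the counting bound;
  -- beyond that the weight is 1/k_F and λ is of order m².
  set f1 : ℕ → ℝ := fun m => if m ≤ ⌊6 * kF⌋₊ then
    6 / m * (10 ^ 8 * (kF ^ 3 / m + kF ^ 3 * √(kF * m) / (m : ℝ) ^ 2)) else 0 with hf1
  set f2 : ℕ → ℝ := fun m => if m ≤ ⌊6 * kF⌋₊ then 0 else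
    (81 * kF ^ 3 / (m : ℝ) ^ 2) ^ 2 * kF⁻¹ with hf2
  have hf10 : ∀ m, 0 ≤ f1 m := fun m => by simp only [hf1]; split_ifs <;> positivity
  have hf20 : ∀ m, 0 ≤ f2 m := fun m => by simp only [hf2]; split_ifs <;> positivity
  have hbound : ∀ l ∈ Y, luneSum kF l ^ 2 * (min (len l) kF)⁻¹ ≤
      f1 (supLen l) + f2 (supLen l) := by
    intro l hl
    have hne : l ≠ 0 := fun h => h0 (h ▸ hl)
    have hL1 : (1 : ℝ) ≤ supLen l := by exact_mod_cast supLen_pos hne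
    have hlen := supLen_le_len l
    have hlen1 := one_le_len hne
    by_cases hL : supLen l ≤ ⌊6 * kF⌋₊
    · have hL' : (supLen l : ℝ) ≤ 6 * kF := (Nat.le_floor_iff (by linarith)).1 hL
      have h1 := luneSum_sq_le hk hne hL'
      have h2 : (min (len l) kF)⁻¹ ≤ 6 / supLen l := by
        rw [show (6 : ℝ) / supLen l = ((supLen l : ℝ) / 6)⁻¹ by field_simp]
        refine inv_anti₀ (by positivity) (le_min ?_ ?_) <;> linarith
      simp only [hf1, hf2, if_pos hL, add_zero]
      rw [mul_comm (6 / (supLen l : ℝ))]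
      exact mul_le_mul h1 h2 (inv_nonneg.2 (le_min (by linarith) (by linarith))) (by positivity)
    · have hL' : 6 * kF < supLen l := (Nat.floor_lt (by linarith)).1 (not_le.1 hL)
      have h1 := luneSum_far hk hL'
      simp only [hf1, hf2, if_neg hL, zero_add]
      rw [min_eq_right (by linarith)]
      have := luneSum_nonneg (kF := kF) l
      gcongr
  refine (Finset.sum_le_sum hbound).trans ?_
  rw [Finset.sum_add_distrib]
  obtain ⟨R, hR⟩ : ∃ R, ∀ p ∈ Y, supLen p ≤ R := ⟨Y.sup supLen, fun p hp => Finset.le_sup hp⟩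
  set n := ⌊6 * kF⌋₊ with hn
  have hn1 : (n : ℝ) ≤ 6 * kF := Nat.floor_le (by linarith)
  have hn2 : 5 * kF ≤ n := by have := Nat.lt_floor_add_one (6 * kF); linarith
  -- After multiplication by the shell size 26 m² the summand is a constant plus a multiple of
  -- m^{-1/2}. Over m ≤ 6 k_F these give 6 k_F⁴ and 5 k_F⁴, hence the 11.
  have h1 : ∑ l ∈ Y, f1 (supLen l) ≤ 156 * 10 ^ 8 * (11 * kF ^ 4) := by
    refine (sum_supLen_le h0 hR hf10).trans ?_
    have h2 : ∀ m ∈ Finset.Icc 1 R, 26 * (m : ℝ) ^ 2 * f1 m ≤ if m ∈ Finset.Icc 1 n then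
        156 * 10 ^ 8 * (kF ^ 3 + kF ^ 3 * √kF * (√(m : ℝ))⁻¹) else 0 := by
      intro m hm
      have hm1 := (Finset.mem_Icc.1 hm).1
      have hm0 : (0 : ℝ) < m := by positivity
      by_cases hmk : m ≤ n
      · rw [if_pos (Finset.mem_Icc.2 ⟨hm1, hmk⟩)]
        simp only [hf1, if_pos hmk]
        rw [Real.sqrt_mul (by linarith)]
        refine le_of_eq ?_
        have h3 := Real.sq_sqrt hm0.le
        have h4 : 0 < √(m : ℝ) := Real.sqrt_pos.2 hm0
        rw [show (m : ℝ) = √(m : ℝ) ^ 2 from h3.symm]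
        rw [Real.sqrt_sq h4.le]
        field_simp
        ring
      · rw [if_neg (fun h => hmk (Finset.mem_Icc.1 h).2)]
        simp [hf1, hmk]
    refine (Finset.sum_le_sum h2).trans ?_
    rw [← Finset.sum_filter]
    refine (Finset.sum_le_sum_of_subset_of_nonneg (t := Finset.Icc 1 n)
      (fun m hm => (Finset.mem_filter.1 hm).2) fun _ _ _ => by positivity).trans ?_
    rw [← Finset.mul_sum, Finset.sum_add_distrib, ← Finset.mul_sum, Finset.sum_const,
      Nat.card_Icc, nsmul_eq_mul, Nat.add_sub_cancel]
    have h3 := sum_inv_sqrt_le n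
    have h4 : √(n : ℝ) ≤ 2.5 * √kF := by
      refine Real.sqrt_le_iff.2 ⟨by positivity, ?_⟩
      rw [mul_pow, Real.sq_sqrt (by linarith)]
      linarith
    have h5 := Real.mul_self_sqrt (show 0 ≤ kF by linarith)
    have h6 : kF ^ 3 * √kF * ∑ m ∈ Finset.Icc 1 n, (√(m : ℝ))⁻¹ ≤
        kF ^ 3 * √kF * (2 * (2.5 * √kF)) := by gcongr; linarith
    have h7 : kF ^ 3 * √kF * (2 * (2.5 * √kF)) = 5 * kF ^ 4 := by
      calc _ = 5 * kF ^ 3 * (√kF * √kF) := by ring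
        _ = _ := by rw [h5]; ring
    have h8 : (n : ℝ) * kF ^ 3 ≤ 6 * kF ^ 4 := by
      have : (n : ℝ) * kF ^ 3 ≤ 6 * kF * kF ^ 3 := by gcongr
      linarith [show 6 * kF * kF ^ 3 = 6 * kF ^ 4 by ring]
    gcongr
    linarith
  have h2 : ∑ l ∈ Y, f2 (supLen l) ≤ 26 * 6561 * kF ^ 4 := by
    refine (sum_supLen_le h0 hR hf20).trans ?_
    have h3 : ∀ m ∈ Finset.Icc 1 R, 26 * (m : ℝ) ^ 2 * f2 m ≤
        if m ∈ Finset.Ioo n (max R n + 1) then 26 * 6561 * kF ^ 5 * ((m : ℝ) ^ 2)⁻¹ else 0 := by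
      intro m hm
      obtain ⟨hm1, hm2⟩ := Finset.mem_Icc.1 hm
      have hm0 : (m : ℝ) ≠ 0 := by positivity
      by_cases hmk : m ≤ n
      · rw [if_neg (by simp; omega)]
        simp [hf2, hmk]
      · rw [if_pos (by rw [Finset.mem_Ioo]; omega)]
        simp only [hf2, if_neg hmk]
        have : kF ≠ 0 := by linarith
        refine le_of_eq ?_
        field_simp
        ring
    refine (Finset.sum_le_sum h3).trans ?_
    rw [← Finset.sum_filter]
    refine (Finset.sum_le_sum_of_subset_of_nonneg (t := Finset.Ioo n (max R n + 1))
      (fun m hm => (Finset.mem_filter.1 hm).2) fun _ _ _ => by positivity).trans ?_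
    rw [← Finset.mul_sum]
    have h4 := sum_Ioo_inv_sq_le (α := ℝ) n (max R n + 1)
    -- The tail of Σ m^{-2} beyond 6 k_F gains the last factor 1/k_F.
    have h5 : (2 : ℝ) / (n + 1) ≤ kF⁻¹ := by
      rw [div_le_iff₀ (by positivity), inv_mul_eq_div, le_div_iff₀ (by linarith)]
      linarith
    calc 26 * 6561 * kF ^ 5 * ∑ i ∈ Finset.Ioo n (max R n + 1), ((i : ℝ) ^ 2)⁻¹
        ≤ 26 * 6561 * kF ^ 5 * kF⁻¹ := by gcongr; exact h4.trans h5
      _ = _ := by field_simp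
  have : 0 ≤ kF ^ 4 := by positivity
  linarith

theorem sum_V_luneSum_le {V : Mom → ℝ} (hk : 1 ≤ kF) (hV : Summable fun k : MomStar => V k ^ 2)
    (F : Finset MomStar) :
    ∑ l ∈ F, V l * luneSum kF l ≤ errScale kF V * (10 ^ 6 * kF ^ 2) := by
  refine sum_mul_le_errScale hk hV F (by positivity) ?_
  have h2 := sum_luneSum_sq_le hk (Y := F.map (Function.Embedding.subtype _)) (by simp)
  rw [Finset.sum_map] at h2
  refine h2.trans (le_of_eq ?_)
  ring

end LuneSum

end FermiGas

namespace FermiGas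

/-! ### The Hilbert–Schmidt norm of the transformation kernel -/

section Kernel

open Matrix

variable {ι : Type*} [Fintype ι] [DecidableEq ι]

theorem trace_cfc {A : Matrix ι ι ℝ} (hA : A.IsHermitian) (f : ℝ → ℝ) :
    (cfc f A).trace = ∑ i, f (hA.eigenvalues i) := by
  rw [hA.cfc_eq, IsHermitian.cfc, Unitary.conjStarAlgAut_apply, Matrix.trace_mul_cycle,
    Unitary.coe_star_mul_self, one_mul, Matrix.trace_diagonal]
  rfl

/-- Every function is continuous on a finite spectrum, so the logarithm and square root need no
separate treatment at zero. -/
theorem cfc_mul_of_isHermitian {A : Matrix ι ι ℝ} (f g : ℝ → ℝ) :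
    cfc f A * cfc g A = cfc (fun x => f x * g x) A :=
  (cfc_mul f g A (A.finite_real_spectrum.continuousOn _)
    (A.finite_real_spectrum.continuousOn _)).symm

theorem isHermitian_cfc (A : Matrix ι ι ℝ) (f : ℝ → ℝ) : (cfc f A).IsHermitian :=
  cfc_predicate f A

/-- The Hilbert–Schmidt norm squared of a symmetric matrix is the trace of its square. -/
theorem sum_sq_cfc {A : Matrix ι ι ℝ} (hA : A.IsHermitian) (f : ℝ → ℝ) :
    ∑ p, ∑ q, cfc f A p q ^ 2 = ∑ i, f (hA.eigenvalues i) ^ 2 := by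
  have h := trace_cfc hA fun x => f x * f x
  rw [← cfc_mul_of_isHermitian, Matrix.trace] at h
  simp only [← sq] at h
  rw [← h]
  refine Finset.sum_congr rfl fun p _ => ?_
  rw [Matrix.diag_apply, pow_two (cfc f A), Matrix.mul_apply]
  refine Finset.sum_congr rfl fun q _ => ?_
  have := (isHermitian_cfc A f).apply q p
  rw [star_trivial] at this
  rw [this, sq]

theorem posSemidef_cfc_sqrt (A : Matrix ι ι ℝ) : (cfc Real.sqrt A).PosSemidef := by
  have h1 : cfc Real.sqrt A = (cfc (fun x => √√x) A)ᴴ * cfc (fun x => √√x) A := by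
    rw [(isHermitian_cfc A _).eq, cfc_mul_of_isHermitian]
    congr 1
    funext x
    rw [Real.mul_self_sqrt (Real.sqrt_nonneg _)]
  rw [h1]
  exact Matrix.posSemidef_conjTranspose_mul_self _

theorem cfc_sqrt_mul_self {A : Matrix ι ι ℝ} (hA : A.PosSemidef) :
    cfc Real.sqrt A * cfc Real.sqrt A = A := by
  rw [cfc_mul_of_isHermitian]
  have h1 : (spectrum ℝ A).EqOn (fun x => √x * √x) fun x => x := by
    intro x hx
    rw [hA.isHermitian.spectrum_real_eq_range_eigenvalues] at hx
    obtain ⟨i, rfl⟩ := hx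
    exact Real.mul_self_sqrt (hA.eigenvalues_nonneg i)
  rw [cfc_congr h1]
  exact cfc_id' ℝ A hA.isHermitian

/-- With r = √d, the matrix inside the logarithm is E = r^{-1} A^{1/2} r^{-1}, where A ≥ d². Its
eigenvalues e are at least 1, so 0 ≤ log e ≤ e - 1, and the ℓ² norm of the logarithms is at most the
ℓ¹ norm Σ(e - 1) = tr(E - 1). The trace is bounded through the diagonal of A alone. -/
theorem sum_sq_log_kernel_le {d v : ι → ℝ} (hd : ∀ p, 0 < d p) :
    ∑ p, ∑ q, ((-(1 / 2) : ℝ) • cfc Real.log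
      (diagonal (fun p => d p ^ (-(1 / 2) : ℝ)) *
        cfc Real.sqrt (diagonal (fun p => d p ^ (1 / 2 : ℝ)) *
          (diagonal (fun p => d p ^ (1 : ℝ)) + (2 : ℝ) • vecMulVec v v) *
          diagonal (fun p => d p ^ (1 / 2 : ℝ))) *
        diagonal (fun p => d p ^ (-(1 / 2) : ℝ)))) p q ^ 2 ≤
      (1 / 2 * ∑ p, v p ^ 2 * (d p)⁻¹) ^ 2 := by
  set r : ι → ℝ := fun p => √(d p) with hr
  have hr0 : ∀ p, 0 < r p := fun p => Real.sqrt_pos.2 (hd p)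
  have hr2 : ∀ p, r p * r p = d p := fun p => Real.mul_self_sqrt (hd p).le
  have e1 : (fun p => d p ^ (-(1 / 2) : ℝ)) = fun p => (r p)⁻¹ := by
    funext p; rw [Real.rpow_neg (hd p).le, ← Real.sqrt_eq_rpow]
  have e2 : (fun p => d p ^ (1 / 2 : ℝ)) = r := by
    funext p; rw [← Real.sqrt_eq_rpow]
  have e3 : (fun p => d p ^ (1 : ℝ)) = d := by funext p; rw [Real.rpow_one]
  rw [e1, e2, e3]
  set A : Matrix ι ι ℝ := diagonal r * (diagonal d + (2 : ℝ) • vecMulVec v v) * diagonal r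
    with hAdef
  have hAapp : ∀ p q, A p q = (if p = q then d p * d p else 0) + 2 * (r p * v p) * (r q * v q) := by
    intro p q
    rw [hAdef, mul_diagonal, diagonal_mul, Matrix.add_apply, Matrix.smul_apply, vecMulVec_apply, smul_eq_mul,
      diagonal_apply]
    split_ifs with h
    · subst h; rw [← hr2]; ring
    · ring
  have hAsplit : A = diagonal (fun p => d p * d p) +
      (2 : ℝ) • vecMulVec (fun p => r p * v p) (fun p => r p * v p) := by
    ext p q
    rw [hAapp, Matrix.add_apply, Matrix.smul_apply, vecMulVec_apply, smul_eq_mul, diagonal_apply, mul_assoc]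
  have hApsd : A.PosSemidef := by
    rw [hAsplit]
    refine (Matrix.PosSemidef.diagonal fun p => mul_self_nonneg _).add (Matrix.PosSemidef.smul ?_ (by norm_num))
    have := Matrix.posSemidef_vecMulVec_self_star (fun p => r p * v p)
    rwa [star_trivial] at this
  set B := cfc Real.sqrt A with hB
  have hBpsd : B.PosSemidef := posSemidef_cfc_sqrt A
  have hBB : B * B = A := cfc_sqrt_mul_self hApsd
  have hBsymm : ∀ p q, B p q = B q p := fun p q => by
    have := hBpsd.isHermitian.apply q p
    rwa [star_trivial] at this
  set E : Matrix ι ι ℝ := diagonal (fun p => (r p)⁻¹) * B * diagonal (fun p => (r p)⁻¹) with hE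
  have hEapp : ∀ p q, E p q = (r p)⁻¹ * B p q * (r q)⁻¹ := fun p q => by
    rw [hE, mul_diagonal, diagonal_mul]
  have hEh : E.IsHermitian := by
    ext p q
    rw [conjTranspose_apply, star_trivial, hEapp, hEapp, hBsymm]; ring
  -- If E y = e y and x = r^{-1} y, then B x = e d x. Hence e²‖d x‖² = ‖B x‖² = ⟨x, A x⟩ ≥ ‖d x‖²,
  -- and e ≥ 0 because B ≥ 0.
  have heig : ∀ i, 1 ≤ hEh.eigenvalues i := by
    intro i
    set e := hEh.eigenvalues i
    set y : ι → ℝ := ⇑(hEh.eigenvectorBasis i) with hy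
    have h1 : E *ᵥ y = e • y := hEh.mulVec_eigenvectorBasis i
    have hy0 : y ≠ 0 := by
      intro h0
      have h2 := hEh.eigenvectorBasis.orthonormal.1 i
      have h3 : hEh.eigenvectorBasis i = 0 := by
        ext p; exact congrFun h0 p
      rw [h3, norm_zero] at h2
      exact zero_ne_one h2
    set x : ι → ℝ := fun p => (r p)⁻¹ * y p with hx
    have hBx : ∀ p, (B *ᵥ x) p = e * (d p * x p) := by
      intro p
      have h2 := congrFun h1 p
      simp only [mulVec, dotProduct, hEapp, Pi.smul_apply, smul_eq_mul] at h2
      have h3 : (B *ᵥ x) p = r p * ∑ q, (r p)⁻¹ * B p q * (r q)⁻¹ * y q := by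
        rw [Finset.mul_sum]
        simp only [mulVec, dotProduct, hx]
        refine Finset.sum_congr rfl fun q _ => ?_
        have := (hr0 p).ne'
        field_simp
      rw [h3, h2, ← hr2, hx]
      have := (hr0 p).ne'
      field_simp
    have hxp : ∃ p, x p ≠ 0 := by
      obtain ⟨p, hp⟩ := Function.ne_iff.1 hy0
      exact ⟨p, mul_ne_zero (inv_ne_zero (hr0 p).ne') hp⟩
    obtain ⟨p0, hp0⟩ := hxp
    have he0 : 0 ≤ e := by
      have h2 := hBpsd.dotProduct_mulVec_nonneg x
      rw [star_trivial] at h2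
      have h3 : x ⬝ᵥ (B *ᵥ x) = e * ∑ p, d p * x p ^ 2 := by
        simp only [dotProduct, hBx, Finset.mul_sum]
        exact Finset.sum_congr rfl fun q _ => by ring
      rw [h3] at h2
      have h4 : 0 < ∑ p, d p * x p ^ 2 :=
        Finset.sum_pos' (fun q _ => mul_nonneg (hd q).le (sq_nonneg _))
          ⟨p0, Finset.mem_univ _, mul_pos (hd p0) (by positivity)⟩
      exact nonneg_of_mul_nonneg_left h2 h4
    have h5 : (B *ᵥ x) ⬝ᵥ (B *ᵥ x) = x ⬝ᵥ (A *ᵥ x) := by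
      rw [← hBB, ← mulVec_mulVec, dotProduct_mulVec x B, ← mulVec_transpose]
      congr 2
      ext p q
      rw [transpose_apply, hBsymm]
    have h6 : (B *ᵥ x) ⬝ᵥ (B *ᵥ x) = e ^ 2 * ∑ p, (d p * x p) ^ 2 := by
      simp only [dotProduct, hBx, Finset.mul_sum]
      exact Finset.sum_congr rfl fun q _ => by ring
    have h7 : ∑ p, (d p * x p) ^ 2 ≤ x ⬝ᵥ (A *ᵥ x) := by
      rw [hAsplit, add_mulVec, dotProduct_add, smul_mulVec, dotProduct_smul]
      have h8 : x ⬝ᵥ (diagonal (fun p => d p * d p) *ᵥ x) = ∑ p, (d p * x p) ^ 2 := by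
        simp only [dotProduct, mulVec_diagonal]
        exact Finset.sum_congr rfl fun q _ => by ring
      have h9 := (Matrix.posSemidef_vecMulVec_self_star (fun p => r p * v p)).dotProduct_mulVec_nonneg x
      rw [star_trivial, star_trivial] at h9
      rw [h8]
      have : 0 ≤ (2 : ℝ) • (x ⬝ᵥ (vecMulVec (fun p => r p * v p) (fun p => r p * v p) *ᵥ x)) :=
        smul_nonneg (by norm_num) h9
      linarith
    have h8 : 0 < ∑ p, (d p * x p) ^ 2 :=
      Finset.sum_pos' (fun q _ => sq_nonneg _)
        ⟨p0, Finset.mem_univ _, by have := hd p0; positivity⟩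
    rw [← h5, h6] at h7
    by_contra hcon
    nlinarith [not_le.1 hcon, mul_nonneg he0 h8.le]
  have htr : ∑ i, (hEh.eigenvalues i - 1) ≤ ∑ p, v p ^ 2 * (d p)⁻¹ := by
    have h1 : ∑ i, hEh.eigenvalues i = ∑ p, E p p := by
      have := hEh.trace_eq_sum_eigenvalues
      rw [Matrix.trace] at this
      simpa using this.symm
    rw [Finset.sum_sub_distrib, h1, ← Finset.sum_sub_distrib]
    refine Finset.sum_le_sum fun p _ => ?_
    -- B_pp² ≤ (B²)_pp = A_pp = d² + 2 d v² ≤ (d + v²)².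
    have h2 : B p p ≤ d p + v p ^ 2 := by
      refine abs_le_of_sq_le_sq' ?_ (add_nonneg (hd p).le (sq_nonneg _)) |>.2
      have h3 : B p p ^ 2 ≤ A p p := by
        rw [← hBB, mul_apply, sq]
        refine le_trans (le_of_eq ?_) (Finset.single_le_sum (f := fun q => B p q * B q p)
          (fun q _ => ?_) (Finset.mem_univ p))
        · rfl
        · change 0 ≤ B p q * B q p
          rw [hBsymm q p]; exact mul_self_nonneg _
      rw [hAapp, if_pos rfl] at h3
      have h4 : 2 * (r p * v p) * (r p * v p) = 2 * d p * v p ^ 2 := by rw [← hr2]; ring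
      rw [h4] at h3
      nlinarith [sq_nonneg (v p ^ 2)]
    rw [hEapp]
    have h5 : (r p)⁻¹ * B p p * (r p)⁻¹ = B p p * (d p)⁻¹ := by
      rw [← hr2, mul_inv]; ring
    rw [h5]
    have h6 : B p p * (d p)⁻¹ ≤ (d p + v p ^ 2) * (d p)⁻¹ :=
      mul_le_mul_of_nonneg_right h2 (inv_pos.2 (hd p)).le
    rw [add_mul, mul_inv_cancel₀ (hd p).ne'] at h6
    linarith
  have hlog : ∑ i, Real.log (hEh.eigenvalues i) ^ 2 ≤ (∑ i, (hEh.eigenvalues i - 1)) ^ 2 := by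
    have h1 : ∑ i, Real.log (hEh.eigenvalues i) ^ 2 ≤ ∑ i, (hEh.eigenvalues i - 1) ^ 2 := by
      refine Finset.sum_le_sum fun i _ => ?_
      have := Real.log_le_sub_one_of_pos (lt_of_lt_of_le one_pos (heig i))
      have := Real.log_nonneg (heig i)
      gcongr
    exact h1.trans (Finset.sum_sq_le_sq_sum_of_nonneg fun i _ => sub_nonneg.2 (heig i))
  have hnn : 0 ≤ ∑ i, (hEh.eigenvalues i - 1) := Finset.sum_nonneg fun i _ => sub_nonneg.2 (heig i)
  have hfin : ∑ p, ∑ q, ((-(1 / 2) : ℝ) • cfc Real.log E) p q ^ 2 =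
      1 / 4 * ∑ i, Real.log (hEh.eigenvalues i) ^ 2 := by
    rw [← sum_sq_cfc hEh, Finset.mul_sum]
    refine Finset.sum_congr rfl fun p _ => ?_
    rw [Finset.mul_sum]
    refine Finset.sum_congr rfl fun q _ => ?_
    rw [Matrix.smul_apply, smul_eq_mul]; ring
  rw [hfin, mul_pow]
  have : (∑ i, (hEh.eigenvalues i - 1)) ^ 2 ≤ (∑ p, v p ^ 2 * (d p)⁻¹) ^ 2 := by gcongr
  linarith

/-- The Hilbert–Schmidt norm of `K_l`. -/
noncomputable def kNorm (s : ℕ) (kF : ℝ) (V : Mom → ℝ) (l : Mom) : ℝ :=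
  √(∑ p, ∑ q, KMat s kF V l p q ^ 2)

theorem kNorm_nonneg (s : ℕ) (kF : ℝ) (V : Mom → ℝ) (l : Mom) : 0 ≤ kNorm s kF V l :=
  Real.sqrt_nonneg _

theorem kNorm_le {s : ℕ} {kF : ℝ} {V : Mom → ℝ} (hk : 0 < kF) {l : Mom} (hV : 0 ≤ V l) :
    kNorm s kF V l ≤ s * kF⁻¹ / (4 * (2 * Real.pi) ^ 3) * (V l * luneSum kF l) := by
  have hc : 0 ≤ s * V l * kF⁻¹ / (2 * (2 * Real.pi) ^ 3) := by
    have := Real.pi_pos; positivity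
  have h1 := sum_sq_log_kernel_le (ι := lune kF l) (d := fun p => lam l p)
    (v := vVec s kF V l) (fun p => lam_pos p.2)
  have h2 : 1 / 2 * ∑ p : lune kF l, vVec s kF V l p ^ 2 * (lam l p)⁻¹ =
      s * kF⁻¹ / (4 * (2 * Real.pi) ^ 3) * (V l * luneSum kF l) := by
    simp only [vVec, Real.sq_sqrt hc]
    rw [← Finset.mul_sum, luneSum, ← Finset.sum_coe_sort (lune kF l) (fun p => (lam l p)⁻¹)]
    have := Real.pi_pos.ne'
    field_simp
    ring
  rw [h2] at h1
  refine Real.sqrt_le_iff.2 ⟨?_, h1⟩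
  have := luneSum_nonneg (kF := kF) l
  have := Real.pi_pos
  positivity

end Kernel

end FermiGas

namespace FermiGas

open Filter Topology

/-! ### The operators `D_{1,k}` and `D_{2,k}` and the quadratic forms -/

section Forms

variable {s : ℕ} {kF : ℝ}

/-- The mode annihilated by a term of `D_{2,k}`. -/
def srcMode (k : Mom) (x : OutOut kF (-k) × Fin s) : Mode s := (x.1.1 + k, x.2)

/-- The mode created by a term of `D_{2,k}`. -/
def tgtMode (k : Mom) (x : OutOut kF (-k) × Fin s) : Mode s := (x.1.1, x.2)

theorem srcMode_injective (k : Mom) :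
    Function.Injective (srcMode k : OutOut kF (-k) × Fin s → Mode s) := by
  rintro ⟨⟨a, ha⟩, σ⟩ ⟨⟨b, hb⟩, τ⟩ h
  simpa [srcMode] using h

theorem tgtMode_injective (k : Mom) :
    Function.Injective (tgtMode k : OutOut kF (-k) × Fin s → Mode s) := by
  rintro ⟨⟨a, ha⟩, σ⟩ ⟨⟨b, hb⟩, τ⟩ h
  simpa [tgtMode] using h

theorem srcMode_out (k : Mom) (x : OutOut kF (-k) × Fin s) :
    (srcMode k x).1 ∉ fermiBall kF := by
  have := x.1.2.2
  rwa [sub_neg_eq_add] at this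

theorem tgtMode_out (k : Mom) (x : OutOut kF (-k) × Fin s) :
    (tgtMode k x).1 ∉ fermiBall kF := x.1.2.1

/-- The shift `q ↦ q - k`. -/
def outOutEquiv (kF : ℝ) (k : Mom) : OutOut kF k ≃ OutOut kF (-k) where
  toFun q := ⟨q.1 - k, q.2.2, by simpa using q.2.1⟩
  invFun p := ⟨p.1 + k, by simpa using p.2.2, by simpa using p.2.1⟩
  left_inv q := by simp
  right_inv p := by simp

theorem summable_D2 {Ψ : Fock s} (h : Ψ ∈ HN s kF) (k : Mom) :
    Summable fun x : OutOut kF (-k) × Fin s =>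
      tcre kF (tgtMode k x) (tann kF (srcMode k x) Ψ) :=
  summable_tcre_tann (cardLE_of_mem h) (tgtMode_injective k) (srcMode_injective k)
    (tgtMode_out k) (srcMode_out k)

theorem D2Term_eq (k : Mom) (Ψ : Fock s) (q : OutOut kF k) :
    D2Term kF k Ψ q = ∑ σ : Fin s, tcre kF (tgtMode k (outOutEquiv kF k q, σ))
      (tann kF (srcMode k (outOutEquiv kF k q, σ)) Ψ) := by
  refine Finset.sum_congr rfl fun σ _ => ?_
  rw [tcre_of_notMem (tgtMode_out k _), tann_of_notMem (srcMode_out k _)]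
  simp [tgtMode, srcMode, outOutEquiv]

theorem hasSum_D2Term {Ψ : Fock s} (h : Ψ ∈ HN s kF) (k : Mom) :
    HasSum (D2Term kF k Ψ) (∑' x : OutOut kF (-k) × Fin s,
      tcre kF (tgtMode k x) (tann kF (srcMode k x) Ψ)) := by
  have h1 := (summable_D2 h k).hasSum.prod_fiberwise fun p => hasSum_fintype _
  rw [← (outOutEquiv kF k).hasSum_iff] at h1
  refine h1.congr_fun fun q => ?_
  rw [D2Term_eq]
  rfl

theorem hasSum_D2 {Ψ : Fock s} (h : Ψ ∈ HN s kF) (k : Mom) :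
    HasSum (fun x : OutOut kF (-k) × Fin s =>
      tcre kF (tgtMode k x) (tann kF (srcMode k x) Ψ)) (D2 kF k Ψ) := by
  rw [D2, (hasSum_D2Term h k).tsum_eq]
  exact (summable_D2 h k).hasSum

theorem norm_D2_le {Ψ : Fock s} (h : Ψ ∈ HN s kF) (k : Mom) :
    ‖D2 kF k Ψ‖ ≤ ‖excNum kF Ψ‖ := by
  rw [← (hasSum_D2 h k).tsum_eq]
  exact norm_tsum_tcre_tann_le (tgtMode_injective k) (srcMode_injective k) (tgtMode_out k)
    (srcMode_out k) h

/-- The index set of `D_{1,k}`. -/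
noncomputable def innerModes (s : ℕ) (kF : ℝ) (k : Mom) : Finset (Mode s) :=
  (fermiBall kF).filter (fun q => q - k ∈ fermiBall kF) ×ˢ Finset.univ

/-- Both modes lie in the ball, so c_{q-k}^* c_q equals c̃_{q-k} c̃_q^*. Normal ordering costs only
a sign, since k ≠ 0 makes the modes distinct. -/
theorem D1_eq {k : Mom} (hk : k ≠ 0) (Ψ : Fock s) :
    D1 kF k Ψ = -∑ i ∈ innerModes s kF k, tcre kF i (tann kF (i.1 - k, i.2) Ψ) := by
  rw [D1, innerModes, Finset.sum_product, ← Finset.sum_neg_distrib]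
  refine Finset.sum_congr rfl fun q hq => ?_
  rw [← Finset.sum_neg_distrib]
  refine Finset.sum_congr rfl fun σ _ => ?_
  obtain ⟨h1, h2⟩ := Finset.mem_filter.1 hq
  have e1 : cre (q - k, σ) = tann kF (q - k, σ) := (tann_of_mem h2).symm
  have e2 : ann (q, σ) = tcre kF (q, σ) := (tcre_of_mem h1).symm
  rw [e1, e2, tann_tcre, if_neg, zero_sub]
  intro h
  simp [hk] at h

theorem sub_injOn (k : Mom) (I : Finset (Mode s)) :
    Set.InjOn (fun i : Mode s => ((i.1 - k, i.2) : Mode s)) I := by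
  rintro ⟨a, σ⟩ - ⟨b, τ⟩ - h
  simpa using h

theorem norm_D1_le {Ψ : Fock s} (h : Ψ ∈ HN s kF) {k : Mom} (hk : k ≠ 0) :
    ‖D1 kF k Ψ‖ ≤ ‖excNum kF Ψ‖ := by
  rw [D1_eq hk, norm_neg, ← num_ballModes h]
  refine norm_sum_tcre_tann_le _ (Set.injOn_id _) (sub_injOn k _) ?_ ?_ Ψ
  · intro i hi
    exact mem_ballModes.2 (Finset.mem_filter.1 (Finset.mem_product.1 hi).1).1
  · intro i hi
    exact mem_ballModes.2 (Finset.mem_filter.1 (Finset.mem_product.1 hi).1).2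

theorem inner_D1_D1 {k : Mom} (hk : k ≠ 0) (Ψ : Fock s) :
    ⟪D1 kF k Ψ, D1 kF k Ψ⟫_ℂ =
      ∑ p ∈ (fermiBall kF).filter (fun p => p - k ∈ fermiBall kF),
        ∑ q ∈ (fermiBall kF).filter (fun q => q - k ∈ fermiBall kF),
          ∑ σ : Fin s, ∑ τ : Fin s,
            ⟪Ψ, creT kF (p - k) σ (creT kF q τ (annT kF (q - k) τ (annT kF p σ Ψ)))⟫_ℂ
      + ((∑ i ∈ innerModes s kF k, ‖tann kF (i.1 - k, i.2) Ψ‖ ^ 2 : ℝ) : ℂ) := by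
  rw [D1_eq hk, inner_neg_neg, inner_sum_tcre_tann (innerModes s kF k) (f := fun i => i)
    (fun i => (i.1 - k, i.2)) (Set.injOn_id _)]
  rw [add_comm, Complex.ofReal_sum, sub_eq_add_neg, ← Finset.sum_neg_distrib]
  congr 1
  · refine Finset.sum_congr rfl fun i _ => ?_
    rw [inner_self_eq_norm_sq_to_K]; norm_cast
  · rw [innerModes, Finset.sum_product]
    refine Finset.sum_congr rfl fun p _ => ?_
    refine Eq.trans ?_ Finset.sum_comm
    refine Finset.sum_congr rfl fun σ _ => ?_
    rw [Finset.sum_product, ← Finset.sum_neg_distrib]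
    refine Finset.sum_congr rfl fun q _ => ?_
    rw [← Finset.sum_neg_distrib]
    refine Finset.sum_congr rfl fun τ _ => ?_
    change -⟪tann kF (q, τ) (tann kF (p - k, σ) Ψ), tann kF (p, σ) (tann kF (q - k, τ) Ψ)⟫_ℂ =
      ⟪Ψ, tcre kF (p - k, σ) (tcre kF (q, τ) (tann kF (q - k, τ) (tann kF (p, σ) Ψ)))⟫_ℂ
    rw [inner_tcre_right, inner_tcre_right, tann_tann (p, σ), inner_neg_right, neg_neg]

/-- Each of the two annihilations outside the ball contributes at most a factor m. -/
theorem summable_norm_sq_tann_tann {ι κ : Type*} {m : ℕ} {Ψ : Fock s} (h : CardLE m Ψ)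
    {f : ι → Mode s} {g : κ → Mode s} (hf : Function.Injective f) (hg : Function.Injective g)
    (hfY : ∀ i, (f i).1 ∉ fermiBall kF) (hgY : ∀ i, (g i).1 ∉ fermiBall kF) :
    Summable fun x : κ × ι => ‖tann kF (f x.2) (tann kF (g x.1) Ψ)‖ ^ 2 := by
  classical
  refine summable_of_sum_le (c := m * (m * ‖Ψ‖ ^ 2)) (fun _ => by positivity) fun Z => ?_
  refine (Finset.sum_le_sum_of_subset_of_nonneg (Finset.subset_product (s := Z))
    fun _ _ _ => by positivity).trans ?_
  rw [Finset.sum_product]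
  have hstep : ∀ i ∈ Z.image Prod.fst, ∑ j ∈ Z.image Prod.snd,
      ‖tann kF (f j) (tann kF (g i) Ψ)‖ ^ 2 ≤ m * ‖tann kF (g i) Ψ‖ ^ 2 := by
    intro i _
    refine sum_norm_sq_tann_le ?_ _ hf.injOn fun j _ => hfY j
    rw [tann_of_notMem (hgY i)]
    exact h.ann _
  refine (Finset.sum_le_sum hstep).trans ?_
  rw [← Finset.mul_sum]
  exact mul_le_mul_of_nonneg_left
    (sum_norm_sq_tann_le h _ hg.injOn fun j _ => hgY j) (Nat.cast_nonneg m)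

/-- The modes annihilated by D_{2,k} are all those outside the ball except the lune, whose momenta
return to the ball under translation by -k. -/
theorem hasSum_tann_srcMode {Ψ : Fock s} (h : Ψ ∈ HN s kF) (k : Mom) :
    HasSum (fun x : OutOut kF (-k) × Fin s => ‖tann kF (srcMode k x) Ψ‖ ^ 2)
      ((⟪Ψ, excNum kF Ψ⟫_ℂ).re -
        ∑ p ∈ lune kF k, ∑ σ : Fin s, ‖tann kF (p, σ) Ψ‖ ^ 2) := by
  classical
  set F : Mode s → ℝ := Set.indicator {i | i.1 ∉ fermiBall kF} fun i => ‖tann kF i Ψ‖ ^ 2 with hF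
  have h1 : HasSum F (⟪Ψ, excNum kF Ψ⟫_ℂ).re :=
    (hasSum_subtype_iff_indicator (f := fun i : Mode s => ‖tann kF i Ψ‖ ^ 2)
      (s := {i : Mode s | i.1 ∉ fermiBall kF})).1 (hasSum_excNum h)
  set P : Finset (Mode s) := lune kF k ×ˢ Finset.univ with hP
  have hPmem : ∀ i, i ∈ P ↔ i.1 - k ∈ fermiBall kF ∧ i.1 ∉ fermiBall kF := by
    intro i
    simp [hP, mem_lune, mem_fermiBall]
  have h2 : HasSum (Set.indicator (↑P) F) (∑ i ∈ P, F i) := by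
    have := hasSum_sum_of_ne_finset_zero (L := SummationFilter.unconditional _)
      (f := Set.indicator (↑P) F) (s := P) (fun i hi => Set.indicator_of_notMem (by simpa using hi) _)
    rwa [Finset.sum_congr rfl (g := F)
      (fun i hi => Set.indicator_of_mem (by simpa using hi) _)] at this
  have h3 := h1.sub h2
  have h4 : ∑ i ∈ P, F i = ∑ p ∈ lune kF k, ∑ σ : Fin s, ‖tann kF (p, σ) Ψ‖ ^ 2 := by
    rw [hP, Finset.sum_product]
    refine Finset.sum_congr rfl fun p hp => Finset.sum_congr rfl fun σ _ => ?_
    rw [hF, Set.indicator_of_mem]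
    have := ((hPmem (p, σ)).1 (by simp [hP, hp])).2
    exact this
  rw [h4] at h3
  rw [← (srcMode_injective (kF := kF) k).hasSum_iff] at h3
  · refine h3.congr_fun fun x => ?_
    have hx := srcMode_out k x
    have hx' := tgtMode_out k x
    rw [Function.comp_apply, Set.indicator_of_notMem, sub_zero, hF, Set.indicator_of_mem]
    · exact hx
    · rw [Finset.mem_coe, hPmem]
      rintro ⟨h5, -⟩
      apply hx'
      simpa [srcMode, tgtMode] using h5
  · intro i hi
    by_cases h5 : i ∈ P
    · rw [Set.indicator_of_mem (by simpa using h5), sub_self]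
    · rw [Set.indicator_of_notMem (by simpa using h5), sub_zero, hF, Set.indicator_of_notMem]
      intro h6
      refine hi ⟨(⟨i.1 - k, ?_, ?_⟩, i.2), ?_⟩
      · exact fun h7 => h5 ((hPmem i).2 ⟨h7, h6⟩)
      · simpa using h6
      · simp [srcMode]

/-- The two-body matrix elements of `D_{2,k}^* D_{2,k}`. -/
noncomputable def srPair (kF : ℝ) (k : Mom) (Ψ : Fock s)
    (x : (OutOut kF (-k) × Fin s) × (OutOut kF (-k) × Fin s)) : ℂ :=
  ⟪tann kF (tgtMode k x.2) (tann kF (srcMode k x.1) Ψ),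
    tann kF (tgtMode k x.1) (tann kF (srcMode k x.2) Ψ)⟫_ℂ

theorem hasSum_srPair {Ψ : Fock s} (h : Ψ ∈ HN s kF) (k : Mom) :
    HasSum (srPair kF k Ψ)
      (((∑' x : OutOut kF (-k) × Fin s, ‖tann kF (srcMode k x) Ψ‖ ^ 2 : ℝ) : ℂ) -
        ⟪D2 kF k Ψ, D2 kF k Ψ⟫_ℂ) := by
  have hs := summable_norm_sq_tann_tann (kF := kF) (cardLE_of_mem h) (tgtMode_injective k)
    (srcMode_injective k) (tgtMode_out k) (srcMode_out k)
  have hs' := (Equiv.prodComm _ _).summable_iff.2 hs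
  have hsum : Summable (srPair kF k Ψ) := by
    refine Summable.of_norm_bounded (hs.add hs') fun x => ?_
    refine (norm_inner_le_norm _ _).trans ?_
    simp only [Function.comp_apply, Equiv.prodComm_apply, Prod.fst_swap, Prod.snd_swap]
    nlinarith [sq_nonneg (‖tann kF (tgtMode k x.2) (tann kF (srcMode k x.1) Ψ)‖ -
      ‖tann kF (tgtMode k x.1) (tann kF (srcMode k x.2) Ψ)‖),
      norm_nonneg (tann kF (tgtMode k x.2) (tann kF (srcMode k x.1) Ψ)),
      norm_nonneg (tann kF (tgtMode k x.1) (tann kF (srcMode k x.2) Ψ))]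
  -- Absolute convergence permits evaluating the double sum along the squares Y ×ˢ Y, where the
  -- finite normal-ordering identity is available.
  have hlim1 : Tendsto (fun Y : Finset (OutOut kF (-k) × Fin s) => ∑ x ∈ Y ×ˢ Y, srPair kF k Ψ x) atTop (𝓝 (∑' x, srPair kF k Ψ x)) :=
    hsum.hasSum.comp (tendsto_finsetProd_atTop.comp tendsto_atTop_diagonal)
  have hlim2 : Tendsto (fun Y : Finset (OutOut kF (-k) × Fin s) => ∑ x ∈ Y ×ˢ Y, srPair kF k Ψ x) atTop
      (𝓝 (((∑' x : OutOut kF (-k) × Fin s, ‖tann kF (srcMode k x) Ψ‖ ^ 2 : ℝ) : ℂ) -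
        ⟪D2 kF k Ψ, D2 kF k Ψ⟫_ℂ)) := by
    have h1 := (hasSum_D2 h k)
    have h2 : Tendsto (fun Y : Finset (OutOut kF (-k) × Fin s) => ((∑ i ∈ Y, ‖tann kF (srcMode k i) Ψ‖ ^ 2 : ℝ) : ℂ))
        atTop (𝓝 ((∑' x : OutOut kF (-k) × Fin s, ‖tann kF (srcMode k x) Ψ‖ ^ 2 : ℝ) : ℂ)) :=
      (Complex.continuous_ofReal.tendsto _).comp
        (summable_norm_sq_tann (cardLE_of_mem h) (srcMode_injective k) (srcMode_out k)).hasSum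
    refine (h2.sub (Tendsto.inner h1 h1)).congr fun Y => ?_
    rw [inner_sum_tcre_tann Y (srcMode k) (tgtMode_injective k).injOn, Finset.sum_product,
      Complex.ofReal_sum]
    have e : ∀ i ∈ Y, ((‖tann kF (srcMode k i) Ψ‖ ^ 2 : ℝ) : ℂ) =
        ⟪tann kF (srcMode k i) Ψ, tann kF (srcMode k i) Ψ⟫_ℂ := fun i _ => by
      rw [inner_self_eq_norm_sq_to_K]; norm_cast
    rw [Finset.sum_congr rfl e]
    simp [srPair]
  rw [← tendsto_nhds_unique hlim1 hlim2]
  exact hsum.hasSum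

/-- The short-range sum for a fixed momentum transfer. -/
theorem hasSum_SRInner {Ψ : Fock s} (h : Ψ ∈ HN s kF) (k : Mom) :
    HasSum (SRInner kF Ψ k) (⟪D2 kF k Ψ, D2 kF k Ψ⟫_ℂ -
      ((∑' x : OutOut kF (-k) × Fin s, ‖tann kF (srcMode k x) Ψ‖ ^ 2 : ℝ) : ℂ)) := by
  have h3 := (hasSum_srPair h k).neg
  rw [neg_sub] at h3
  rw [← (Equiv.prodProdProdComm _ _ _ _).hasSum_iff] at h3
  have h4 := h3.prod_fiberwise fun p => hasSum_fintype _
  refine h4.congr_fun fun x => ?_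
  rw [SRInner, ← Finset.univ_product_univ, Finset.sum_product]
  refine Finset.sum_congr rfl fun σ _ => Finset.sum_congr rfl fun τ _ => ?_
  change ⟪Ψ, tcre kF (x.1.1 + k, σ) (tcre kF (x.2.1, τ) (tann kF (x.2.1 + k, τ)
    (tann kF (x.1.1, σ) Ψ)))⟫_ℂ = -⟪tann kF (x.2.1, τ) (tann kF (x.1.1 + k, σ) Ψ),
      tann kF (x.1.1, σ) (tann kF (x.2.1 + k, τ) Ψ)⟫_ℂ
  rw [inner_tcre_right, inner_tcre_right, tann_tann (x.1.1, σ), inner_neg_right, neg_neg]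

end Forms

end FermiGas

namespace FermiGas

open Filter Topology

/-! ### Matching Q with G, Q_LR and Q_SR for each momentum transfer -/

section Decomposition

variable {s : ℕ} {kF : ℝ} {V : Mom → ℝ}

/-- `∑_{p ∈ L_k, σ} ‖c̃_{p,σ} Ψ‖²`. -/
noncomputable def luneDens (kF : ℝ) (Ψ : Fock s) (k : Mom) : ℝ :=
  ∑ p ∈ lune kF k, ∑ σ : Fin s, ‖tann kF (p, σ) Ψ‖ ^ 2

/-- `∑_{q ∈ B_F, q + k ∈ B_F, σ} ‖c̃_{q,σ} Ψ‖²`. -/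
noncomputable def ballDens (kF : ℝ) (Ψ : Fock s) (k : Mom) : ℝ :=
  ∑ q ∈ (fermiBall kF).filter (fun q => q + k ∈ fermiBall kF), ∑ σ : Fin s,
    ‖tann kF (q, σ) Ψ‖ ^ 2

theorem luneDens_nonneg (Ψ : Fock s) (k : Mom) : 0 ≤ luneDens kF Ψ k :=
  Finset.sum_nonneg fun _ _ => Finset.sum_nonneg fun _ _ => by positivity

theorem ballDens_nonneg (Ψ : Fock s) (k : Mom) : 0 ≤ ballDens kF Ψ k :=
  Finset.sum_nonneg fun _ _ => Finset.sum_nonneg fun _ _ => by positivity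

theorem inner_tcre_tann (i : Mode s) (Ψ : Fock s) :
    ⟪Ψ, tcre kF i (tann kF i Ψ)⟫_ℂ = ((‖tann kF i Ψ‖ ^ 2 : ℝ) : ℂ) := by
  rw [inner_tcre_right, inner_self_eq_norm_sq_to_K]; norm_cast

theorem GTerm_eq (Ψ : Fock s) (k : MomStar) :
    GTerm kF V Ψ k = ((V k * (ballDens kF Ψ k - luneDens kF Ψ k) : ℝ) : ℂ) := by
  rw [GTerm, ballDens, luneDens]
  push_cast
  congr 2
  · refine Finset.sum_congr rfl fun q _ => Finset.sum_congr rfl fun σ _ => ?_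
    exact_mod_cast inner_tcre_tann (q, σ) Ψ
  · refine Finset.sum_congr rfl fun q _ => Finset.sum_congr rfl fun σ _ => ?_
    exact_mod_cast inner_tcre_tann (q, σ) Ψ

theorem SRTerm_eq {Ψ : Fock s} (h : Ψ ∈ HN s kF) (k : MomStar) :
    SRTerm kF V Ψ k = V k * (⟪D2 kF k Ψ, D2 kF k Ψ⟫_ℂ -
      (((⟪Ψ, excNum kF Ψ⟫_ℂ).re - luneDens kF Ψ k : ℝ) : ℂ)) := by
  rw [SRTerm, (hasSum_SRInner h k.1).tsum_eq, (hasSum_tann_srcMode h k.1).tsum_eq, luneDens]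

theorem sum_innerModes (Ψ : Fock s) (k : Mom) :
    ∑ i ∈ innerModes s kF k, ‖tann kF (i.1 - k, i.2) Ψ‖ ^ 2 = ballDens kF Ψ k := by
  rw [innerModes, Finset.sum_product, ballDens]
  refine Finset.sum_nbij' (fun q => q - k) (fun q => q + k) ?_ ?_ ?_ ?_ ?_ <;>
    simp +contextual

theorem LRTerm_eq {k : Mom} (hk : k ≠ 0) (Ψ : Fock s) :
    LRTerm kF Ψ k = ⟪D1 kF k Ψ, D1 kF k Ψ⟫_ℂ - (ballDens kF Ψ k : ℂ) +
      ⟪D1 kF k Ψ, D2 kF k Ψ⟫_ℂ + ⟪D2 kF k Ψ, D1 kF k Ψ⟫_ℂ := by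
  rw [LRTerm, inner_D1_D1 hk, sum_innerModes, add_sub_cancel_right]

/-- L_k - k consists of the points of the ball that leave it under translation by k; its complement
in the ball carries `ballDens`, and all holes together number N_E. -/
theorem sum_lune_shift {Ψ : Fock s} (h : Ψ ∈ HN s kF) (k : Mom) :
    ∑ p ∈ lune kF k, ∑ σ : Fin s, ‖tann kF (p - k, σ) Ψ‖ ^ 2 =
      (⟪Ψ, excNum kF Ψ⟫_ℂ).re - ballDens kF Ψ k := by
  rw [← sum_norm_tann_ball h, ballModes, Finset.sum_product, ballDens,
    ← Finset.sum_filter_add_sum_filter_not (fermiBall kF) (fun q => q + k ∈ fermiBall kF),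
    add_sub_cancel_left]
  refine Finset.sum_nbij' (fun q => q - k) (fun q => q + k) ?_ ?_ ?_ ?_ ?_ <;>
    simp +contextual [mem_lune, mem_fermiBall]

/-- The decomposition of the quartic term, momentum by momentum. -/
theorem QTerm_eq {Ψ : Fock s} (h : Ψ ∈ HN s kF) (k : MomStar) :
    QTerm kF V Ψ k = SRTerm kF V Ψ k + V k * LRTerm kF Ψ k + 2 * GTerm kF V Ψ k := by
  have h1 : ∑ p ∈ lune kF k.1, ∑ σ : Fin s,
        (⟪Ψ, cre (p, σ) (ann (p, σ) Ψ)⟫_ℂ + ⟪Ψ, ann (p - k.1, σ) (cre (p - k.1, σ) Ψ)⟫_ℂ) =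
      ((luneDens kF Ψ k + ((⟪Ψ, excNum kF Ψ⟫_ℂ).re - ballDens kF Ψ k) : ℝ) : ℂ) := by
    rw [← sum_lune_shift h, luneDens, ← Finset.sum_add_distrib]
    push_cast
    refine Finset.sum_congr rfl fun p hp => ?_
    rw [← Finset.sum_add_distrib]
    refine Finset.sum_congr rfl fun σ _ => ?_
    obtain ⟨h2, h3⟩ := mem_lune.1 hp
    have e1 := inner_tcre_tann (kF := kF) (p, σ) Ψ
    have e2 := inner_tcre_tann (kF := kF) (p - k.1, σ) Ψ
    have h3' : p ∉ fermiBall kF := fun h => (mem_fermiBall.1 h).not_gt h3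
    have h2' : p - k.1 ∈ fermiBall kF := mem_fermiBall.2 h2
    rw [tcre_of_notMem h3', tann_of_notMem h3'] at e1
    rw [tcre_of_mem h2', tann_of_mem h2'] at e2
    rw [tann_of_notMem h3', tann_of_mem h2', e1, e2]
    push_cast
    rfl
  -- The N_E from D_{2,k}^* D_{2,k} cancels against the one from the holes. `ballDens` and
  -- `luneDens` each occur twice with the same sign, which is the factor 2 in front of G.
  rw [QTerm, h1, Dk, inner_add_left, inner_add_right, inner_add_right, SRTerm_eq h,
    LRTerm_eq k.2, GTerm_eq]
  push_cast
  ring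

/-! ### Bounds on `G` and on the long-range part -/

theorem card_filter_add_mem_le (F : Finset MomStar) (hk : 1 ≤ kF) (q : Mom) :
    ((F.filter fun k => q + k.1 ∈ fermiBall kF).card : ℝ) ≤ 125 * kF ^ 3 := by
  classical
  have h1 : (F.filter fun k => q + k.1 ∈ fermiBall kF).card ≤ (fermiBall kF).card := by
    refine Finset.card_le_card_of_injOn (fun k => q + k.1) ?_ ?_
    · intro k hk'
      exact (Finset.mem_filter.1 hk').2
    · rintro a - b - hab
      exact Subtype.ext (by simpa using hab)
  refine (Nat.cast_le.2 h1).trans ((card_fermiBall_le (by linarith)).trans ?_)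
  calc (2 * kF + 1) ^ 3 ≤ (5 * kF) ^ 3 := by gcongr; linarith
    _ = _ := by ring

theorem card_filter_sub_mem_le (F : Finset MomStar) (hk : 1 ≤ kF) (q : Mom) :
    ((F.filter fun k => q - k.1 ∈ fermiBall kF).card : ℝ) ≤ 125 * kF ^ 3 := by
  classical
  have h1 : (F.filter fun k => q - k.1 ∈ fermiBall kF).card ≤ (fermiBall kF).card := by
    refine Finset.card_le_card_of_injOn (fun k => q - k.1) ?_ ?_
    · intro k hk'
      exact (Finset.mem_filter.1 hk').2
    · rintro a - b - hab
      exact Subtype.ext (by simpa using hab)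
  refine (Nat.cast_le.2 h1).trans ((card_fermiBall_le (by linarith)).trans ?_)
  calc (2 * kF + 1) ^ 3 ≤ (5 * kF) ^ 3 := by gcongr; linarith
    _ = _ := by ring

/-- Exchange the sums: a fixed mode q meets only the k with q + k ∈ B_F, of which there are at most
|B_F|, so `sum_V_le` bounds its coefficient. -/
theorem sum_V_ballDens_le (hk : 1 ≤ kF) (hV : Summable fun k : MomStar => V k ^ 2)
    {Ψ : Fock s} (h : Ψ ∈ HN s kF) (F : Finset MomStar) :
    ∑ k ∈ F, V k * ballDens kF Ψ k ≤ errScale kF V * (13 * kF) * (⟪Ψ, excNum kF Ψ⟫_ℂ).re := by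
  classical
  have h1 : ∑ k ∈ F, V k * ballDens kF Ψ k = ∑ i ∈ ballModes s kF,
      (∑ k ∈ F.filter (fun k => i.1 + k.1 ∈ fermiBall kF), V k) * ‖tann kF i Ψ‖ ^ 2 := by
    have h2 : ∀ k ∈ F, V k * ballDens kF Ψ k = ∑ i ∈ ballModes s kF,
        if i.1 + k.1 ∈ fermiBall kF then V k * ‖tann kF i Ψ‖ ^ 2 else 0 := by
      intro k _
      rw [ballModes, Finset.sum_product, ballDens, Finset.sum_filter, Finset.mul_sum]
      refine Finset.sum_congr rfl fun q _ => ?_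
      split_ifs with hq
      · rw [Finset.mul_sum]
      · simp
    rw [Finset.sum_congr rfl h2, Finset.sum_comm]
    refine Finset.sum_congr rfl fun i _ => ?_
    rw [← Finset.sum_filter, Finset.sum_mul]
  rw [h1, ← sum_norm_tann_ball h, Finset.mul_sum]
  refine Finset.sum_le_sum fun i _ => mul_le_mul_of_nonneg_right ?_ (by positivity)
  exact sum_V_le hk hV _ (card_filter_add_mem_le F hk i.1)

theorem sum_V_luneDens_le (hk : 1 ≤ kF) (hV : Summable fun k : MomStar => V k ^ 2)
    {Ψ : Fock s} (h : Ψ ∈ HN s kF) (F : Finset MomStar) :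
    ∑ k ∈ F, V k * luneDens kF Ψ k ≤ errScale kF V * (13 * kF) * (⟪Ψ, excNum kF Ψ⟫_ℂ).re := by
  classical
  -- A finite set of modes containing all lunes of F, so that the order of summation can be
  -- exchanged as for the holes.
  set P : Finset (Mode s) := (F.biUnion fun k => lune kF k.1) ×ˢ Finset.univ with hP
  have h1 : ∑ k ∈ F, V k * luneDens kF Ψ k = ∑ i ∈ P,
      (∑ k ∈ F.filter (fun k => i.1 - k.1 ∈ fermiBall kF), V k) * ‖tann kF i Ψ‖ ^ 2 := by
    have h2 : ∀ k ∈ F, V k * luneDens kF Ψ k = ∑ i ∈ P,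
        if i.1 - k.1 ∈ fermiBall kF then V k * ‖tann kF i Ψ‖ ^ 2 else 0 := by
      intro k hkF
      have e : lune kF k.1 = (F.biUnion fun k => lune kF k.1).filter
          (fun p => p - k.1 ∈ fermiBall kF) := by
        ext p
        simp only [Finset.mem_filter, Finset.mem_biUnion, mem_lune, mem_fermiBall]
        exact ⟨fun h => ⟨⟨k, hkF, h⟩, h.1⟩, fun ⟨⟨_, _, h⟩, h'⟩ => ⟨h', h.2⟩⟩
      rw [hP, Finset.sum_product, luneDens, Finset.mul_sum]
      conv_lhs => rw [e]
      rw [Finset.sum_filter]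
      refine Finset.sum_congr rfl fun q _ => ?_
      split_ifs with hq
      · rw [Finset.mul_sum]
      · simp
    rw [Finset.sum_congr rfl h2, Finset.sum_comm]
    refine Finset.sum_congr rfl fun i _ => ?_
    rw [← Finset.sum_filter, Finset.sum_mul]
  have h3 : ∑ i ∈ P, ‖tann kF i Ψ‖ ^ 2 ≤ (⟪Ψ, excNum kF Ψ⟫_ℂ).re := by
    refine sum_norm_tann_le_excNum h P (g := fun i => i) (Set.injOn_id _) fun i hi => ?_
    obtain ⟨k, _, hk'⟩ := Finset.mem_biUnion.1 (Finset.mem_product.1 hi).1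
    exact fun h => (mem_fermiBall.1 h).not_gt (mem_lune.1 hk').2
  rw [h1]
  have h4 : 0 ≤ errScale kF V * (13 * kF) := mul_nonneg errScale_nonneg (by linarith)
  refine le_trans ?_ (mul_le_mul_of_nonneg_left h3 h4)
  rw [Finset.mul_sum]
  refine Finset.sum_le_sum fun i _ => mul_le_mul_of_nonneg_right ?_ (by positivity)
  exact sum_V_le hk hV _ (card_filter_sub_mem_le F hk i.1)

theorem hasSum_GTerm (hk : 1 ≤ kF) (hV : Summable fun k : MomStar => V k ^ 2)
    (hV0 : ∀ k : MomStar, 0 ≤ V k) {Ψ : Fock s} (h : Ψ ∈ HN s kF) :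
    Summable (GTerm kF V Ψ) ∧ ‖∑' k, GTerm kF V Ψ k‖ ≤
      26 * kF * errScale kF V * (⟪Ψ, excNum kF Ψ⟫_ℂ).re := by
  have h1 := fun k : MomStar => mul_nonneg (hV0 k) (ballDens_nonneg (kF := kF) Ψ k)
  have h2 := fun k : MomStar => mul_nonneg (hV0 k) (luneDens_nonneg (kF := kF) Ψ k)
  have s1 := summable_of_sum_le h1 (sum_V_ballDens_le hk hV h)
  have s2 := summable_of_sum_le h2 (sum_V_luneDens_le hk hV h)
  have b1 := Real.tsum_le_of_sum_le h1 (sum_V_ballDens_le hk hV h)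
  have b2 := Real.tsum_le_of_sum_le h2 (sum_V_luneDens_le hk hV h)
  have e : ∀ k, GTerm kF V Ψ k = ((V k * ballDens kF Ψ k - V k * luneDens kF Ψ k : ℝ) : ℂ) :=
    fun k => by rw [GTerm_eq, mul_sub]
  refine ⟨?_, ?_⟩
  · rw [funext e]
    exact Complex.ofRealCLM.summable (s1.sub s2)
  · rw [funext e, ← Complex.ofReal_tsum, Complex.norm_real, s1.tsum_sub s2, Real.norm_eq_abs]
    have n1 := tsum_nonneg (L := SummationFilter.unconditional _) h1
    have n2 := tsum_nonneg (L := SummationFilter.unconditional _) h2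
    rw [abs_le]
    constructor <;> linarith

theorem norm_LRTerm_le {Ψ : Fock s} (h : Ψ ∈ HN s kF) {k : Mom} (hk : k ≠ 0) :
    ‖LRTerm kF Ψ k‖ ≤ 4 * ‖excNum kF Ψ‖ ^ 2 := by
  have h1 := norm_D1_le h hk
  have h2 := norm_D2_le h k
  have h3 : ballDens kF Ψ k ≤ ‖excNum kF Ψ‖ ^ 2 := by
    refine le_trans ?_ (inner_excNum_le h)
    rw [← sum_norm_tann_ball h, ballModes, Finset.sum_product, ballDens]
    exact Finset.sum_le_sum_of_subset_of_nonneg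
      (f := fun q => ∑ σ : Fin s, ‖tann kF (q, σ) Ψ‖ ^ 2) (Finset.filter_subset _ _)
      fun _ _ _ => Finset.sum_nonneg fun _ _ => sq_nonneg _
  have key : ∀ {a b : Fock s}, ‖a‖ ≤ ‖excNum kF Ψ‖ → ‖b‖ ≤ ‖excNum kF Ψ‖ →
      ‖⟪a, b⟫_ℂ‖ ≤ ‖excNum kF Ψ‖ ^ 2 := fun ha hb =>
    (norm_inner_le_norm _ _).trans (by rw [sq]; gcongr)
  rw [LRTerm_eq hk]
  refine (norm_add_le _ _).trans ?_
  have e1 := norm_add_le (⟪D1 kF k Ψ, D1 kF k Ψ⟫_ℂ - (ballDens kF Ψ k : ℂ)) ⟪D1 kF k Ψ, D2 kF k Ψ⟫_ℂ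
  have e2 := norm_sub_le ⟪D1 kF k Ψ, D1 kF k Ψ⟫_ℂ (ballDens kF Ψ k : ℂ)
  have e3 : ‖(ballDens kF Ψ k : ℂ)‖ = ballDens kF Ψ k := by
    rw [Complex.norm_real, Real.norm_of_nonneg (ballDens_nonneg Ψ k)]
  linarith [key h1 h1, key h1 h2, key h2 h1]

/-- Two points of the ball are at most 2 k_F apart, so the restriction on k in Q_LR discards only
zero terms and Q_LR can be summed with the other series over all k. -/
theorem LRTerm_eq_zero {Ψ : Fock s} {k : Mom} (hk : 2 * kF < len k) : LRTerm kF Ψ k = 0 := by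
  have h1 : (fermiBall kF).filter (fun q => q - k ∈ fermiBall kF) = ∅ := by
    refine Finset.filter_eq_empty_iff.2 fun q hq hq' => ?_
    have := len_add_le q (-(q - k))
    rw [len_neg, show q + -(q - k) = k by abel] at this
    linarith [mem_fermiBall.1 hq, mem_fermiBall.1 hq']
  have h2 : D1 kF k Ψ = 0 := by rw [D1, h1, Finset.sum_empty]
  rw [LRTerm, h1, h2]
  simp

theorem hasSum_LRTerm (V : Mom → ℝ) (Ψ : Fock s) :
    HasSum (fun k : MomStar => (V k : ℂ) * LRTerm kF Ψ k)
      (∑ k ∈ (fermiBall (2 * kF)).erase 0, (V k : ℂ) * LRTerm kF Ψ k) := by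
  classical
  have h1 := hasSum_sum_of_ne_finset_zero (L := SummationFilter.unconditional _)
    (f := fun k : MomStar => (V k : ℂ) * LRTerm kF Ψ k)
    (s := ((fermiBall (2 * kF)).erase 0).subtype fun k => k ≠ 0) (fun k hk => by
      have : 2 * kF < len k := by
        by_contra h
        refine hk ?_
        rw [Finset.mem_subtype, Finset.mem_erase, mem_fermiBall]
        exact ⟨k.2, not_lt.1 h⟩
      rw [LRTerm_eq_zero this, mul_zero])
  rwa [Finset.sum_subtype_of_mem (f := fun k : Mom => (V k : ℂ) * LRTerm kF Ψ k)] at h1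
  intro k hk
  exact (Finset.mem_erase.1 hk).1

theorem norm_LRForm_le (hk : 1 ≤ kF) (hV : Summable fun k : MomStar => V k ^ 2)
    (hV0 : ∀ k : MomStar, 0 ≤ V k) {Ψ : Fock s} (h : Ψ ∈ HN s kF) :
    ‖LRForm kF V Ψ‖ ≤ 26 * errScale kF V * ‖excNum kF Ψ‖ ^ 2 := by
  classical
  have h1 : ‖∑ k ∈ (fermiBall (2 * kF)).erase 0, (V k : ℂ) * LRTerm kF Ψ k‖ ≤
      (∑ k ∈ (fermiBall (2 * kF)).erase 0, V k) * (4 * ‖excNum kF Ψ‖ ^ 2) := by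
    rw [Finset.sum_mul]
    refine norm_sum_le_of_le _ fun k hk' => ?_
    have hk0 := (Finset.mem_erase.1 hk').1
    rw [norm_mul, Complex.norm_real, Real.norm_of_nonneg (hV0 ⟨k, hk0⟩)]
    exact mul_le_mul_of_nonneg_left (norm_LRTerm_le h hk0) (hV0 ⟨k, hk0⟩)
  have h2 : ∑ k ∈ (fermiBall (2 * kF)).erase 0, V k ≤ errScale kF V * (13 * kF) := by
    have h3 := sum_V_le hk hV (((fermiBall (2 * kF)).erase 0).subtype fun k => k ≠ 0) (by
      rw [Finset.card_subtype]
      have h4 : (((fermiBall (2 * kF)).erase 0).filter fun k => k ≠ 0).card ≤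
          (fermiBall (2 * kF)).card :=
        Finset.card_le_card ((Finset.filter_subset _ _).trans (Finset.erase_subset _ _))
      refine (Nat.cast_le.2 h4).trans ((card_fermiBall_le (by linarith)).trans ?_)
      calc (2 * (2 * kF) + 1) ^ 3 ≤ (5 * kF) ^ 3 := by gcongr; linarith
        _ = _ := by ring)
    rwa [Finset.sum_subtype_of_mem (f := V)] at h3
    intro k hk
    exact (Finset.mem_erase.1 hk).1
  have hpi : 1 ≤ (2 * Real.pi) ^ 3 := one_le_pow₀ (by linarith [Real.pi_gt_three])
  have hc : 0 ≤ kF⁻¹ / (2 * (2 * Real.pi) ^ 3) := by positivity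
  rw [LRForm, norm_mul, Complex.norm_real, Real.norm_of_nonneg hc]
  have h5 : kF⁻¹ / (2 * (2 * Real.pi) ^ 3) ≤ kF⁻¹ / 2 := by
    gcongr; linarith
  have he := errScale_nonneg (kF := kF) (V := V)
  -- The constant is 26 = 13 · 4 / 2.
  calc _ ≤ kF⁻¹ / 2 * (errScale kF V * (13 * kF) * (4 * ‖excNum kF Ψ‖ ^ 2)) := by
        refine mul_le_mul h5 (h1.trans ?_) (norm_nonneg _) (by positivity)
        gcongr
    _ = _ := by field_simp; ring

theorem norm_GForm_le (hk : 1 ≤ kF) (hV : Summable fun k : MomStar => V k ^ 2)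
    (hV0 : ∀ k : MomStar, 0 ≤ V k) {Ψ : Fock s} (h : Ψ ∈ HN s kF) :
    ‖GForm kF V Ψ‖ ≤ 26 * errScale kF V * (⟪Ψ, excNum kF Ψ⟫_ℂ).re := by
  have h1 := (hasSum_GTerm hk hV hV0 h).2
  have hpi : 1 ≤ (2 * Real.pi) ^ 3 := one_le_pow₀ (by linarith [Real.pi_gt_three])
  have hc : 0 ≤ kF⁻¹ / (2 * Real.pi) ^ 3 := by positivity
  have h5 : kF⁻¹ / (2 * Real.pi) ^ 3 ≤ kF⁻¹ := div_le_self (by positivity) hpi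
  rw [GForm, norm_mul, Complex.norm_real, Real.norm_of_nonneg hc]
  calc _ ≤ kF⁻¹ * (26 * kF * errScale kF V * (⟪Ψ, excNum kF Ψ⟫_ℂ).re) :=
        mul_le_mul h5 h1 (norm_nonneg _) (by positivity)
    _ = _ := by field_simp

end Decomposition

end FermiGas

namespace FermiGas

open Filter Topology

/-! ### Convergence of the short-range form on the kinetic domain -/

section Kinetic

variable {s : ℕ} {kF : ℝ} {V : Mom → ℝ}

theorem hasSum_norm_sq_tann {i : Mode s} (hi : i.1 ∉ fermiBall kF) (Ψ : Fock s) :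
    HasSum (fun S => if i ∈ S then ‖Ψ S‖ ^ 2 else 0) (‖tann kF i Ψ‖ ^ 2) := by
  have h1 := Complex.reCLM.hasSum (lp.hasSum_inner (𝕜 := ℂ) Ψ (tcre kF i (tann kF i Ψ)))
  have e : Complex.reCLM ⟪Ψ, tcre kF i (tann kF i Ψ)⟫_ℂ = ‖tann kF i Ψ‖ ^ 2 := by
    rw [inner_tcre_tann]; rfl
  rw [e] at h1
  refine h1.congr_fun fun S => ?_
  rw [tcre_tann_apply]
  by_cases h : i ∈ S
  · simp only [h, hi, not_false_eq_true, if_true, Complex.reCLM_apply]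
    exact norm_sq_eq_re_inner (𝕜 := ℂ) _
  · simp [h, hi]

/-- The weight `1 + |p|²`. -/
noncomputable def kinWeight (p : Mom) : ℝ := 1 + len p ^ 2

theorem kinWeight_pos (p : Mom) : 0 < kinWeight p := by unfold kinWeight; positivity

/-- On a fixed sector the kinetic domain controls (Σ_{i ∈ S} (1 + |p_i|²))² on each determinant, and
the sum of the squared weights is at most the square of their sum. -/
theorem exists_sum_kinWeight_le {Ψ : Fock s} (h : Ψ ∈ kinDomain s kF) :
    ∃ W : ℝ, ∀ Y : Finset (Mode s), (∀ i ∈ Y, i.1 ∉ fermiBall kF) →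
      ∑ i ∈ Y, kinWeight i.1 ^ 2 * ‖tann kF i Ψ‖ ^ 2 ≤ W := by
  classical
  obtain ⟨h1, h2⟩ := h
  set N : ℝ := ((s * (fermiBall kF).card : ℕ) : ℝ) with hN
  have hsum : Summable fun S : Finset (Mode s) => (∑ i ∈ S, kinWeight i.1) ^ 2 * ‖Ψ S‖ ^ 2 := by
    have h3 : Summable fun S : Finset (Mode s) => ‖Ψ S‖ ^ 2 := by
      simpa using (lp.hasSum_norm (p := 2) (by simp) Ψ).summable
    refine Summable.of_nonneg_of_le (fun S => by positivity) (fun S => ?_)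
      ((h3.mul_left (2 * N ^ 2)).add (h2.mul_left 2))
    have e : ∑ i ∈ S, kinWeight i.1 = S.card + ∑ i ∈ S, len i.1 ^ 2 := by
      simp [kinWeight, Finset.sum_add_distrib]
    rw [e, Real.norm_eq_abs, sq_abs]
    by_cases hS : S.card = s * (fermiBall kF).card
    · rw [hS, ← hN]
      have : (N + ∑ i ∈ S, len i.1 ^ 2) ^ 2 ≤ 2 * N ^ 2 + 2 * (∑ i ∈ S, len i.1 ^ 2) ^ 2 := by
        nlinarith [sq_nonneg (N - ∑ i ∈ S, len i.1 ^ 2)]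
      calc _ ≤ (2 * N ^ 2 + 2 * (∑ i ∈ S, len i.1 ^ 2) ^ 2) * ‖Ψ S‖ ^ 2 := by gcongr
        _ = _ := by ring
    · rw [h1 S hS]; simp
  refine ⟨∑' S, (∑ i ∈ S, kinWeight i.1) ^ 2 * ‖Ψ S‖ ^ 2, fun Y hY => ?_⟩
  have h4 := hasSum_sum fun i (hi : i ∈ Y) =>
    (hasSum_norm_sq_tann (hY i hi) Ψ).mul_left (kinWeight i.1 ^ 2)
  refine hasSum_le (fun S => ?_) h4 hsum.hasSum
  have h5 : ∑ i ∈ Y, kinWeight i.1 ^ 2 * (if i ∈ S then ‖Ψ S‖ ^ 2 else 0) =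
      (∑ i ∈ Y.filter (fun i => i ∈ S), kinWeight i.1 ^ 2) * ‖Ψ S‖ ^ 2 := by
    rw [Finset.sum_mul, Finset.sum_filter]
    exact Finset.sum_congr rfl fun i _ => by split_ifs <;> simp
  rw [h5]
  refine mul_le_mul_of_nonneg_right ?_ (by positivity)
  refine (Finset.sum_le_sum_of_subset_of_nonneg (t := S) (fun i hi => (Finset.mem_filter.1 hi).2)
    fun _ _ _ => by positivity).trans ?_
  exact Finset.sum_sq_le_sq_sum_of_nonneg fun i _ => (kinWeight_pos i.1).le

/-- The index is recovered from the two modes, and once the weighted mode has been annihilated,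
summing over the other costs a factor m. -/
theorem sum_pair_le {α : Type*} {m : ℕ} {Ψ : Fock s} (h : CardLE m Ψ) (Z : Finset α)
    {f g : α → Mode s} (hf : ∀ z, (f z).1 ∉ fermiBall kF) (hg : ∀ z, (g z).1 ∉ fermiBall kF)
    (hinj : Set.InjOn (fun z => (f z, g z)) Z) {w : Mode s → ℝ} (hw : ∀ i, 0 ≤ w i) {W : ℝ}
    (hW : ∀ Y : Finset (Mode s), (∀ i ∈ Y, i.1 ∉ fermiBall kF) →
      ∑ i ∈ Y, w i * ‖tann kF i Ψ‖ ^ 2 ≤ W) :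
    ∑ z ∈ Z, w (f z) * ‖tann kF (f z) (tann kF (g z) Ψ)‖ ^ 2 ≤ m * W := by
  classical
  have h1 : ∑ z ∈ Z, w (f z) * ‖tann kF (f z) (tann kF (g z) Ψ)‖ ^ 2 =
      ∑ y ∈ Z.image (fun z => (f z, g z)), w y.1 * ‖tann kF y.2 (tann kF y.1 Ψ)‖ ^ 2 := by
    rw [Finset.sum_image hinj]
    refine Finset.sum_congr rfl fun z _ => ?_
    rw [tann_tann, norm_neg]
  have hsub : Z.image (fun z => (f z, g z)) ⊆ Z.image f ×ˢ Z.image g := by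
    intro y hy
    obtain ⟨z, hz, rfl⟩ := Finset.mem_image.1 hy
    exact Finset.mem_product.2 ⟨Finset.mem_image_of_mem _ hz, Finset.mem_image_of_mem _ hz⟩
  rw [h1]
  refine (Finset.sum_le_sum_of_subset_of_nonneg hsub
    fun y _ _ => mul_nonneg (hw y.1) (sq_nonneg _)).trans ?_
  rw [Finset.sum_product]
  have h2 : ∀ i ∈ Z.image f, ∑ j ∈ Z.image g, w i * ‖tann kF j (tann kF i Ψ)‖ ^ 2 ≤
      m * (w i * ‖tann kF i Ψ‖ ^ 2) := by
    intro i hi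
    obtain ⟨z, -, rfl⟩ := Finset.mem_image.1 hi
    rw [← Finset.mul_sum]
    have := sum_norm_sq_tann_le (kF := kF) (m := m) (Ψ := tann kF (f z) Ψ)
      (by rw [tann_of_notMem (hf z)]; exact h.ann _) (Z.image g) (g := fun j => j)
      (Set.injOn_id _) (by
        intro j hj
        obtain ⟨z', -, rfl⟩ := Finset.mem_image.1 hj
        exact hg z')
    calc _ ≤ w (f z) * (m * ‖tann kF (f z) Ψ‖ ^ 2) := mul_le_mul_of_nonneg_left this (hw _)
      _ = _ := by ring
  refine (Finset.sum_le_sum h2).trans ?_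
  rw [← Finset.mul_sum]
  refine mul_le_mul_of_nonneg_left (hW _ ?_) (Nat.cast_nonneg m)
  intro i hi
  obtain ⟨z, -, rfl⟩ := Finset.mem_image.1 hi
  exact hf z

/-- Momentum transfers together with two terms of `D_{2,k}`. -/
abbrev Transfer (s : ℕ) (kF : ℝ) : Type :=
  Σ k : MomStar, (OutOut kF (-k.1) × Fin s) × (OutOut kF (-k.1) × Fin s)

/-- For fixed p the modes q and p + k determine q and k, so the sum over both is bounded uniformly
in p; the remaining Σ_p (1 + |p|²)^{-2} is finite. -/
theorem summable_transfer_left {Ψ : Fock s} (h : Ψ ∈ HN s kF) :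
    Summable fun z : Transfer s kF => (kinWeight z.2.1.1.1 ^ 2)⁻¹ *
      ‖tann kF (tgtMode z.1.1 z.2.2) (tann kF (srcMode z.1.1 z.2.1) Ψ)‖ ^ 2 := by
  classical
  have hm := cardLE_of_mem h
  set m := s * (fermiBall kF).card
  refine summable_of_sum_le
    (c := ∑' p : Mom, ((1 + len p ^ 2) ^ 2)⁻¹ * (m * (m * ‖Ψ‖ ^ 2))) (fun z => by positivity)
    fun Z => ?_
  rw [← Finset.sum_fiberwise_of_maps_to (g := fun z : Transfer s kF => z.2.1.1.1)
    (t := Z.image fun z : Transfer s kF => z.2.1.1.1) fun z hz => Finset.mem_image_of_mem _ hz]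
  refine le_trans (Finset.sum_le_sum fun p _ => ?_)
    ((summable_inv_one_add_len_sq.mul_right (m * (m * ‖Ψ‖ ^ 2))).sum_le_tsum
      (Z.image fun z : Transfer s kF => z.2.1.1.1) fun p _ => by positivity)
  have h1 := sum_pair_le (kF := kF) hm (Z.filter fun z : Transfer s kF => z.2.1.1.1 = p)
    (f := fun z => tgtMode z.1.1 z.2.2) (g := fun z => srcMode z.1.1 z.2.1)
    (fun z => tgtMode_out _ _) (fun z => srcMode_out _ _) (by
      rintro ⟨⟨k, hk⟩, ⟨⟨⟨p, hp⟩, σ⟩, ⟨⟨q, hq⟩, τ⟩⟩⟩ hz ⟨⟨k', hk'⟩, ⟨⟨⟨p', hp'⟩, σ'⟩, ⟨⟨q', hq'⟩, τ'⟩⟩⟩ hz' he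
      have e1 : p = _ := (Finset.mem_filter.1 hz).2
      have e2 : p' = _ := (Finset.mem_filter.1 hz').2
      subst e1
      subst e2
      simp only [tgtMode, srcMode, Prod.mk.injEq, add_right_inj] at he
      obtain ⟨⟨rfl, rfl⟩, rfl, rfl⟩ := he
      rfl) (w := fun _ => 1) (fun _ => zero_le_one) (W := m * ‖Ψ‖ ^ 2)
      (fun Y hY => by
        simpa using sum_norm_sq_tann_le (kF := kF) hm Y (g := fun i => i) (Set.injOn_id _) hY)
  simp only [one_mul] at h1
  refine le_trans (le_of_eq ?_) (mul_le_mul_of_nonneg_left h1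
    (show 0 ≤ ((1 + len p ^ 2) ^ 2)⁻¹ by positivity))
  rw [Finset.mul_sum]
  refine Finset.sum_congr rfl fun z hz => ?_
  rw [(Finset.mem_filter.1 hz).2, kinWeight]

/-- For fixed k the modes p and q + k determine p and q. The kinetic domain pays for the weight on
p, and V_k² sums over k. -/
theorem summable_transfer_right {Ψ : Fock s} (h : Ψ ∈ kinDomain s kF)
    (hV : Summable fun k : MomStar => V k ^ 2) :
    Summable fun z : Transfer s kF => V z.1.1 ^ 2 * (kinWeight z.2.1.1.1 ^ 2 *
      ‖tann kF (tgtMode z.1.1 z.2.1) (tann kF (srcMode z.1.1 z.2.2) Ψ)‖ ^ 2) := by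
  classical
  have hm := cardLE_of_mem h.1
  set m := s * (fermiBall kF).card
  obtain ⟨W, hW⟩ := exists_sum_kinWeight_le h
  have hW0 : 0 ≤ W := by simpa using hW ∅ (by simp)
  refine summable_of_sum_le
    (c := ∑' k : MomStar, V k ^ 2 * (m * W)) (fun z => by positivity)
    fun Z => ?_
  rw [← Finset.sum_fiberwise_of_maps_to (g := fun z : Transfer s kF => z.1)
    (t := Z.image fun z : Transfer s kF => z.1) fun z hz => Finset.mem_image_of_mem _ hz]
  refine le_trans (Finset.sum_le_sum fun k _ => ?_)
    ((hV.mul_right (m * W)).sum_le_tsum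
      (Z.image fun z : Transfer s kF => z.1) fun p _ => by positivity)
  have h1 := sum_pair_le (kF := kF) hm (Z.filter fun z : Transfer s kF => z.1 = k)
    (f := fun z => tgtMode z.1.1 z.2.1) (g := fun z => srcMode z.1.1 z.2.2)
    (fun z => tgtMode_out _ _) (fun z => srcMode_out _ _) (by
      rintro ⟨k1, ⟨⟨⟨p, hp⟩, σ⟩, ⟨⟨q, hq⟩, τ⟩⟩⟩ hz ⟨k2, ⟨⟨⟨p', hp'⟩, σ'⟩, ⟨⟨q', hq'⟩, τ'⟩⟩⟩ hz' he
      have e1 : k1 = k := (Finset.mem_filter.1 hz).2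
      have e2 : k2 = k := (Finset.mem_filter.1 hz').2
      subst e1
      subst e2
      simp only [tgtMode, srcMode, Prod.mk.injEq, add_left_inj] at he
      obtain ⟨⟨rfl, rfl⟩, rfl, rfl⟩ := he
      rfl) (w := fun i => kinWeight i.1 ^ 2) (fun _ => sq_nonneg _) (W := W) hW
  refine le_trans (le_of_eq ?_) (mul_le_mul_of_nonneg_left h1 (sq_nonneg (V k)))
  rw [Finset.mul_sum]
  refine Finset.sum_congr rfl fun z hz => ?_
  rw [← (Finset.mem_filter.1 hz).2]
  rfl

theorem SRTerm_eq_tsum_srPair {Ψ : Fock s} (h : Ψ ∈ HN s kF) (k : MomStar) :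
    SRTerm kF V Ψ k = ∑' x, -((V k : ℂ) * srPair kF k.1 Ψ x) := by
  rw [SRTerm, (hasSum_SRInner h k.1).tsum_eq, tsum_neg, tsum_mul_left,
    (hasSum_srPair h k.1).tsum_eq]
  ring

theorem norm_srPair_le (k : Mom) (Ψ : Fock s)
    (x : (OutOut kF (-k) × Fin s) × (OutOut kF (-k) × Fin s)) :
    ‖srPair kF k Ψ x‖ ≤ ‖tann kF (tgtMode k x.2) (tann kF (srcMode k x.1) Ψ)‖ *
      ‖tann kF (tgtMode k x.1) (tann kF (srcMode k x.2) Ψ)‖ := by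
  rw [srPair]
  exact norm_inner_le_norm _ _

theorem abs_mul_mul_le (v : ℝ) {a b w : ℝ} (ha : 0 ≤ a) (hb : 0 ≤ b) (hw : 0 < w) :
    |v| * (a * b) ≤ (w ^ 2)⁻¹ * a ^ 2 + v ^ 2 * (w ^ 2 * b ^ 2) := by
  have e : |v| * (a * b) = (w⁻¹ * a) * (|v| * (w * b)) := by field_simp
  have e2 : (w ^ 2)⁻¹ * a ^ 2 = (w⁻¹ * a) ^ 2 := by rw [mul_pow, inv_pow]
  have e3 : v ^ 2 * (w ^ 2 * b ^ 2) = (|v| * (w * b)) ^ 2 := by rw [← sq_abs v]; ring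
  rw [e, e2, e3]
  have n1 : 0 ≤ (w⁻¹ * a) * (|v| * (w * b)) := by positivity
  nlinarith [sq_nonneg (w⁻¹ * a - |v| * (w * b))]

theorem summable_SRTerm (hV : Summable fun k : MomStar => V k ^ 2) {Ψ : Fock s}
    (h : Ψ ∈ kinDomain s kF) : Summable (SRTerm kF V Ψ) := by
  have h1 := (summable_transfer_left h.1).add (summable_transfer_right h hV)
  have h2 : Summable fun z : Transfer s kF => -((V z.1.1 : ℂ) * srPair kF z.1.1 Ψ z.2) := by
    -- Weighted Young inequality: V and the kinetic weight go to one factor, the inverse weight to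
    -- the other.
    refine Summable.of_norm_bounded h1 fun z => ?_
    rw [norm_neg, norm_mul, Complex.norm_real, Real.norm_eq_abs]
    exact (mul_le_mul_of_nonneg_left (norm_srPair_le _ _ _) (abs_nonneg _)).trans
      (abs_mul_mul_le _ (norm_nonneg _) (norm_nonneg _) (kinWeight_pos _))
  refine h2.sigma.congr fun k => ?_
  rw [SRTerm_eq_tsum_srPair h.1]

end Kinetic

end FermiGas

namespace FermiGas

open Filter Topology

/-! ### The decomposition of the quartic term -/

section Decomposition

variable {s : ℕ} {kF : ℝ} {V : Mom → ℝ}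

theorem hasSum_QTerm (hk : 1 ≤ kF) (hV : Summable fun k : MomStar => V k ^ 2)
    (hV0 : ∀ k : MomStar, 0 ≤ V k) {Ψ : Fock s} (h : Ψ ∈ kinDomain s kF) :
    HasSum (QTerm kF V Ψ) (∑' k : MomStar, SRTerm kF V Ψ k +
      ∑ k ∈ (fermiBall (2 * kF)).erase 0, (V k : ℂ) * LRTerm kF Ψ k +
      2 * ∑' k : MomStar, GTerm kF V Ψ k) := by
  have h1 := ((summable_SRTerm hV h).hasSum.add (hasSum_LRTerm (kF := kF) V Ψ)).add
    ((hasSum_GTerm hk hV hV0 h.1).1.hasSum.mul_left 2)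
  exact h1.congr_fun fun k => QTerm_eq h.1 k

theorem QForm_eq (hk : 1 ≤ kF) (hV : Summable fun k : MomStar => V k ^ 2)
    (hV0 : ∀ k : MomStar, 0 ≤ V k) {Ψ : Fock s} (h : Ψ ∈ kinDomain s kF) :
    QForm kF V Ψ = GForm kF V Ψ + LRForm kF V Ψ + SRForm kF V Ψ := by
  have e : ((kF⁻¹ / (2 * Real.pi) ^ 3 : ℝ) : ℂ) =
      2 * ((kF⁻¹ / (2 * (2 * Real.pi) ^ 3) : ℝ) : ℂ) := by
    rw [div_mul_eq_div_div_swap]; push_cast; ring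
  rw [QForm, (hasSum_QTerm hk hV hV0 h).tsum_eq, GForm, LRForm, SRForm, e]
  ring

end Decomposition

end FermiGas

namespace FermiGas

open Filter Topology

/-! ### Commutators with the truncated short-range operators -/

section Commutator

variable {s : ℕ} {kF : ℝ}

/-- Translation of the momentum of a mode. -/
def shift (k : Mom) (i : Mode s) : Mode s := (i.1 + k, i.2)

theorem shift_neg_shift (k : Mom) (i : Mode s) : shift (-k) (shift k i) = i := by
  simp [shift]

theorem shift_shift_neg (k : Mom) (i : Mode s) : shift k (shift (-k) i) = i := by
  simp [shift]

theorem shift_injective (k : Mom) : Function.Injective (shift k : Mode s → Mode s) :=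
  Function.LeftInverse.injective (shift_neg_shift k)

theorem shift_left_injective (i : Mode s) : Function.Injective fun k : Mom => shift k i := by
  intro a b h
  simpa [shift] using h

theorem eq_shift_iff {k : Mom} {i j : Mode s} : j = shift k i ↔ i = shift (-k) j :=
  ⟨fun h => by rw [h, shift_neg_shift], fun h => by rw [h, shift_shift_neg]⟩

/-- The modes of `X` whose translate by `k` is in `X`. -/
noncomputable def shiftDom (X : Finset (Mode s)) (k : Mom) : Finset (Mode s) :=
  X.filter fun i => shift k i ∈ X

theorem mem_shiftDom {X : Finset (Mode s)} {k : Mom} {i : Mode s} :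
    i ∈ shiftDom X k ↔ i ∈ X ∧ shift k i ∈ X := Finset.mem_filter

theorem shift_neg_mem_shiftDom {X : Finset (Mode s)} {k : Mom} {i : Mode s} :
    shift (-k) i ∈ shiftDom X k ↔ i ∈ shiftDom X (-k) := by
  rw [mem_shiftDom, mem_shiftDom, shift_shift_neg, and_comm]

/-- `∑ c̃_q^* c̃_{q+k}` over the `q ∈ X` with `q + k ∈ X`. -/
noncomputable def trunc (kF : ℝ) (X : Finset (Mode s)) (k : Mom) : Fock s →L[ℂ] Fock s :=
  ∑ i ∈ shiftDom X k, tcre kF i ∘L tann kF (shift k i)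

/-- `∑ c̃_{q+k}^* c̃_{q+k}` over the `q ∈ X` with `q + k ∈ X`. -/
noncomputable def truncNum (kF : ℝ) (X : Finset (Mode s)) (k : Mom) : Fock s →L[ℂ] Fock s :=
  ∑ i ∈ shiftDom X k, tcre kF (shift k i) ∘L tann kF (shift k i)

/-- The truncation of the two-body operator with momentum transfer `k`. -/
noncomputable def truncQ (kF : ℝ) (X : Finset (Mode s)) (k : Mom) : Fock s →L[ℂ] Fock s :=
  trunc kF X (-k) ∘L trunc kF X k - truncNum kF X k

/-- `c̃_{j+k}`, if `j` and `j + k` are in `X`, and zero otherwise. -/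
noncomputable def move (kF : ℝ) (X : Finset (Mode s)) (k : Mom) (j : Mode s) :
    Fock s →L[ℂ] Fock s :=
  if j ∈ shiftDom X k then tann kF (shift k j) else 0

variable (X : Finset (Mode s)) (k : Mom) (i j : Mode s) (Φ Ψ : Fock s)

theorem trunc_apply :
    trunc kF X k Ψ = ∑ i ∈ shiftDom X k, tcre kF i (tann kF (shift k i) Ψ) := by
  simp [trunc]

theorem truncNum_apply :
    truncNum kF X k Ψ =
      ∑ i ∈ shiftDom X k, tcre kF (shift k i) (tann kF (shift k i) Ψ) := by
  simp [truncNum]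

theorem truncQ_apply :
    truncQ kF X k Ψ = trunc kF X (-k) (trunc kF X k Ψ) - truncNum kF X k Ψ := rfl

theorem inner_trunc_right : ⟪Φ, trunc kF X k Ψ⟫_ℂ = ⟪trunc kF X (-k) Φ, Ψ⟫_ℂ := by
  rw [trunc_apply, trunc_apply, inner_sum, sum_inner]
  refine Finset.sum_nbij' (shift k) (shift (-k)) ?_ ?_ ?_ ?_ ?_
  · intro i hi
    rw [← shift_neg_mem_shiftDom, shift_neg_shift]; exact hi
  · intro i hi
    exact shift_neg_mem_shiftDom.2 hi
  · intro i _; exact shift_neg_shift k i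
  · intro i _; exact shift_shift_neg k i
  · intro i _
    rw [inner_tcre_right, inner_tcre_left, shift_neg_shift]

theorem tann_trunc :
    tann kF j (trunc kF X k Ψ) = trunc kF X k (tann kF j Ψ) + move kF X k j Ψ := by
  rw [trunc_apply, trunc_apply, map_sum, move]
  have h : ∀ i ∈ shiftDom X k, tann kF j (tcre kF i (tann kF (shift k i) Ψ)) =
      tcre kF i (tann kF (shift k i) (tann kF j Ψ)) +
        if j = i then tann kF (shift k i) Ψ else 0 := by
    intro i _
    rw [tann_tcre, tann_tann (shift k i) j, map_neg]
    abel
  rw [Finset.sum_congr rfl h, Finset.sum_add_distrib, Finset.sum_ite_eq]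
  split_ifs <;> simp

theorem tann_truncNum : tann kF j (truncNum kF X k Ψ) =
    truncNum kF X k (tann kF j Ψ) + if j ∈ shiftDom X (-k) then tann kF j Ψ else 0 := by
  rw [truncNum_apply, truncNum_apply, map_sum]
  have h : ∀ i ∈ shiftDom X k, tann kF j (tcre kF (shift k i) (tann kF (shift k i) Ψ)) =
      tcre kF (shift k i) (tann kF (shift k i) (tann kF j Ψ)) +
        if shift (-k) j = i then tann kF j Ψ else 0 := by
    intro i _
    rw [tann_tcre, tann_tann (shift k i) j, map_neg]
    by_cases h : j = shift k i
    · have h' := eq_shift_iff.1 h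
      rw [if_pos h, if_pos h'.symm, ← h]; abel
    · rw [if_neg h, if_neg fun h' => h (eq_shift_iff.2 h'.symm)]; abel
  rw [Finset.sum_congr rfl h, Finset.sum_add_distrib, Finset.sum_ite_eq]
  simp only [shift_neg_mem_shiftDom]

theorem move_trunc : move kF X (-k) j (trunc kF X k Ψ) =
    trunc kF X k (move kF X (-k) j Ψ) + if j ∈ shiftDom X (-k) then tann kF j Ψ else 0 := by
  by_cases h : j ∈ shiftDom X (-k)
  · simp only [move, if_pos h]
    rw [tann_trunc, move, if_pos (shift_neg_mem_shiftDom.2 h), shift_shift_neg]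
  · simp [move, h]

/-- Moving the shifted annihilator past `trunc` leaves a one-body term, which the commutator with
`truncNum` cancels exactly; what remains has `trunc` on the left. -/
theorem tann_truncQ : tann kF j (truncQ kF X k Ψ) = truncQ kF X k (tann kF j Ψ) +
    (trunc kF X k (move kF X (-k) j Ψ) + trunc kF X (-k) (move kF X k j Ψ)) := by
  rw [truncQ_apply, truncQ_apply, map_sub, tann_trunc, tann_trunc, tann_truncNum, move_trunc,
    map_add]
  abel

theorem tann_truncQ_of_notMem {j : Mode s} (hj : j ∉ X) :
    tann kF j (truncQ kF X k Ψ) = truncQ kF X k (tann kF j Ψ) := by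
  have h : ∀ k, j ∉ shiftDom X k := fun k h => hj (mem_shiftDom.1 h).1
  rw [tann_truncQ, move, move, if_neg (h _), if_neg (h _)]
  simp

theorem tann_trunc_of_notMem {j : Mode s} (hj : j ∉ X) :
    tann kF j (trunc kF X k Ψ) = trunc kF X k (tann kF j Ψ) := by
  rw [tann_trunc, move, if_neg fun h => hj (mem_shiftDom.1 h).1]
  simp

/-- Four terms keep a `trunc` on the left and shift one mode; in the last two both modes are
shifted, by opposite momenta. -/
theorem tann_tann_truncQ : tann kF i (tann kF j (truncQ kF X k Ψ)) =
    truncQ kF X k (tann kF i (tann kF j Ψ)) +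
      (trunc kF X k (tann kF i (move kF X (-k) j Ψ)) +
        trunc kF X k (move kF X (-k) i (tann kF j Ψ)) +
        trunc kF X (-k) (tann kF i (move kF X k j Ψ)) +
        trunc kF X (-k) (move kF X k i (tann kF j Ψ)) +
        move kF X k i (move kF X (-k) j Ψ) + move kF X (-k) i (move kF X k j Ψ)) := by
  rw [tann_truncQ, map_add, tann_truncQ, map_add, tann_trunc, tann_trunc]
  abel

/-- The commutator of a product of two hole and two particle operators with the truncated
two-body operator, as a form. -/
theorem norm_inner_commutator_le {x y : Mode s} (hx : x ∉ X) (hy : y ∉ X) {a b : ℝ}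
    (ha : ‖trunc kF X k Φ‖ ≤ a) (ha' : ‖trunc kF X (-k) Φ‖ ≤ a) (hb : ‖Φ‖ ≤ b) :
    ‖⟪Φ, tann kF x (tann kF y (tann kF i (tann kF j (truncQ kF X k Ψ)))) -
        truncQ kF X k (tann kF x (tann kF y (tann kF i (tann kF j Ψ))))⟫_ℂ‖ ≤
      a * ‖tann kF x (tann kF y (tann kF i (move kF X (-k) j Ψ)))‖ +
      a * ‖tann kF x (tann kF y (move kF X (-k) i (tann kF j Ψ)))‖ +
      a * ‖tann kF x (tann kF y (tann kF i (move kF X k j Ψ)))‖ +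
      a * ‖tann kF x (tann kF y (move kF X k i (tann kF j Ψ)))‖ +
      b * ‖tann kF x (tann kF y (move kF X k i (move kF X (-k) j Ψ)))‖ +
      b * ‖tann kF x (tann kF y (move kF X (-k) i (move kF X k j Ψ)))‖ := by
  rw [tann_tann_truncQ]
  simp only [map_add, tann_truncQ_of_notMem _ _ _ hx, tann_truncQ_of_notMem _ _ _ hy,
    tann_trunc_of_notMem _ _ _ hx, tann_trunc_of_notMem _ _ _ hy, add_sub_cancel_left,
    inner_add_right, inner_trunc_right, neg_neg]
  have h0 : ∀ Ω Ξ : Fock s, ∀ c : ℝ, ‖Ω‖ ≤ c → ‖⟪Ω, Ξ⟫_ℂ‖ ≤ c * ‖Ξ‖ := fun Ω Ξ c h =>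
    (norm_inner_le_norm _ _).trans (mul_le_mul_of_nonneg_right h (norm_nonneg _))
  refine (norm_add_le _ _).trans (add_le_add ((norm_add_le _ _).trans (add_le_add
    ((norm_add_le _ _).trans (add_le_add ((norm_add_le _ _).trans (add_le_add
      ((norm_add_le _ _).trans (add_le_add ?_ ?_)) ?_)) ?_)) ?_)) ?_)
  · exact h0 _ _ _ ha'
  · exact h0 _ _ _ ha'
  · exact h0 _ _ _ ha
  · exact h0 _ _ _ ha
  · exact h0 _ _ _ hb
  · exact h0 _ _ _ hb

/-- `(∑_{u,w ∈ X} ‖c̃_x c̃_y c̃_u c̃_w Ψ‖²)^{1/2}`. -/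
noncomputable def pairNorm (kF : ℝ) (X : Finset (Mode s)) (Ψ : Fock s) (x y : Mode s) : ℝ :=
  √(∑ u ∈ X, ∑ w ∈ X, ‖tann kF x (tann kF y (tann kF u (tann kF w Ψ)))‖ ^ 2)

/-- Since the pair of modes determines k, the sum of squares over k is part of a sum over all pairs
in X, and Cauchy–Schwarz costs only the ℓ² norm of the coefficients. -/
theorem sum_mul_norm_le_pairNorm {ι : Type*} (F : Finset ι) (v : ι → ℝ) (x y : Mode s)
    (f : ι → Mode s × Mode s) (hf : Function.Injective f) (G : ι → ℝ)
    (hG : ∀ k, G k ^ 2 ≤ if f k ∈ X ×ˢ X then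
      ‖tann kF x (tann kF y (tann kF (f k).1 (tann kF (f k).2 Ψ)))‖ ^ 2 else 0) :
    ∑ k ∈ F, v k * G k ≤ √(∑ k ∈ F, v k ^ 2) * pairNorm kF X Ψ x y := by
  classical
  refine (Real.sum_mul_le_sqrt_mul_sqrt F v G).trans ?_
  refine mul_le_mul_of_nonneg_left (Real.sqrt_le_sqrt ?_) (Real.sqrt_nonneg _)
  refine (Finset.sum_le_sum fun k _ => hG k).trans ?_
  rw [← Finset.sum_filter, ← Finset.sum_product']
  rw [← Finset.sum_image (s := F.filter fun k => f k ∈ X ×ˢ X) (g := f)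
    (f := fun p => ‖tann kF x (tann kF y (tann kF p.1 (tann kF p.2 Ψ)))‖ ^ 2) hf.injOn]
  refine Finset.sum_le_sum_of_subset_of_nonneg ?_ fun _ _ _ => by positivity
  intro p hp
  obtain ⟨k, hk, rfl⟩ := Finset.mem_image.1 hp
  exact (Finset.mem_filter.1 hk).2

theorem sum_norm_inner_commutator_le (F : Finset MomStar) {V : Mom → ℝ}
    (hV0 : ∀ k : MomStar, 0 ≤ V k) {x y : Mode s} (hx : x ∉ X) (hy : y ∉ X)
    {i j : Mode s} (hi : i ∈ X) (hj : j ∈ X) {a b : ℝ}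
    (ha : ∀ k, ‖trunc kF X k Φ‖ ≤ a) (hb : ‖Φ‖ ≤ b) :
    ∑ k ∈ F, V k *
      ‖⟪Φ, tann kF x (tann kF y (tann kF i (tann kF j (truncQ kF X k Ψ)))) -
        truncQ kF X k (tann kF x (tann kF y (tann kF i (tann kF j Ψ))))⟫_ℂ‖ ≤
      (4 * a + 2 * b) * (√(∑ k ∈ F, V k ^ 2) * pairNorm kF X Ψ x y) := by
  have ha0 : 0 ≤ a := (norm_nonneg _).trans (ha 0)
  have hb0 : 0 ≤ b := (norm_nonneg _).trans hb
  have key := fun (f : MomStar → Mode s × Mode s) (hf : Function.Injective f) (G : MomStar → ℝ) =>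
    sum_mul_norm_le_pairNorm (kF := kF) X Ψ F (fun k => V k) x y f hf G
  have hm : ∀ (k : Mom) (j : Mode s), move kF X k j ≠ 0 → shift k j ∈ X := by
    intro k j h
    by_contra h'
    exact h (by rw [move, if_neg fun hh => h' (mem_shiftDom.1 hh).2])
  have inj1 : ∀ j : Mode s, Function.Injective fun k : MomStar => shift (k : Mom) j := fun j a b h =>
    Subtype.ext (shift_left_injective j h)
  have inj2 : ∀ j : Mode s, Function.Injective fun k : MomStar => shift (-(k : Mom)) j :=
    fun j a b h => Subtype.ext (neg_injective (shift_left_injective j h))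
  -- One choice of pair for each of the six commutator terms; `move` vanishes unless the shifted
  -- mode stays in X.
  have k1 := key (fun k => (i, shift (-k) j)) (fun a b h => inj2 j (Prod.ext_iff.1 h).2)
    (fun k => ‖tann kF x (tann kF y (tann kF i (move kF X (-k) j Ψ)))‖) (fun k => by
      simp only [Finset.mem_product, hi, true_and, move, mem_shiftDom, hj]
      split_ifs <;> simp)
  have k2 := key (fun k => (shift (-k) i, j)) (fun a b h => inj2 i (Prod.ext_iff.1 h).1)
    (fun k => ‖tann kF x (tann kF y (move kF X (-k) i (tann kF j Ψ)))‖) (fun k => by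
      simp only [Finset.mem_product, hi, true_and, and_true, move, mem_shiftDom, hj]
      split_ifs <;> simp)
  have k3 := key (fun k => (i, shift k j)) (fun a b h => inj1 j (Prod.ext_iff.1 h).2)
    (fun k => ‖tann kF x (tann kF y (tann kF i (move kF X k j Ψ)))‖) (fun k => by
      simp only [Finset.mem_product, hi, true_and, move, mem_shiftDom, hj]
      split_ifs <;> simp)
  have k4 := key (fun k => (shift k i, j)) (fun a b h => inj1 i (Prod.ext_iff.1 h).1)
    (fun k => ‖tann kF x (tann kF y (move kF X k i (tann kF j Ψ)))‖) (fun k => by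
      simp only [Finset.mem_product, hi, true_and, and_true, move, mem_shiftDom, hj]
      split_ifs <;> simp)
  have k5 := key (fun k => (shift k i, shift (-k) j)) (fun a b h => inj1 i (Prod.ext_iff.1 h).1)
    (fun k => ‖tann kF x (tann kF y (move kF X k i (move kF X (-k) j Ψ)))‖) (fun k => by
      simp only [Finset.mem_product, hi, true_and, move, mem_shiftDom, hj]
      by_cases h1 : shift (k : Mom) i ∈ X <;> by_cases h2 : shift (-(k : Mom)) j ∈ X <;>
        simp [h1, h2])
  have k6 := key (fun k => (shift (-k) i, shift k j)) (fun a b h => inj2 i (Prod.ext_iff.1 h).1)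
    (fun k => ‖tann kF x (tann kF y (move kF X (-k) i (move kF X k j Ψ)))‖) (fun k => by
      simp only [Finset.mem_product, hi, true_and, move, mem_shiftDom, hj]
      by_cases h1 : shift (k : Mom) j ∈ X <;> by_cases h2 : shift (-(k : Mom)) i ∈ X <;>
        simp [h1, h2])
  have hstep := Finset.sum_le_sum fun k (_ : k ∈ F) => mul_le_mul_of_nonneg_left
    (norm_inner_commutator_le X k i j Φ Ψ hx hy (ha k) (ha (-k)) hb) (hV0 k)
  refine hstep.trans ?_
  have e : ∀ (c : ℝ) (G : MomStar → ℝ), ∑ k ∈ F, V k * (c * G k) = c * ∑ k ∈ F, V k * G k :=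
    fun c G => by rw [Finset.mul_sum]; exact Finset.sum_congr rfl fun k _ => by ring
  simp only [mul_add, Finset.sum_add_distrib, e]
  have := mul_le_mul_of_nonneg_left k1 ha0
  have := mul_le_mul_of_nonneg_left k2 ha0
  have := mul_le_mul_of_nonneg_left k3 ha0
  have := mul_le_mul_of_nonneg_left k4 ha0
  have := mul_le_mul_of_nonneg_left k5 hb0
  have := mul_le_mul_of_nonneg_left k6 hb0
  linarith

end Commutator

end FermiGas

namespace FermiGas

open Filter Topology

/-! ### The lowering part of the kernel and its commutators -/

section Lowering

variable {s : ℕ} {kF : ℝ}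

theorem norm_trunc_le {X : Finset (Mode s)} (hX : ∀ i ∈ X, i.1 ∉ fermiBall kF) (k : Mom)
    {Φ : Fock s} (h : Φ ∈ HN s kF) : ‖trunc kF X k Φ‖ ≤ ‖excNum kF Φ‖ := by
  rw [trunc_apply]
  exact (norm_sum_tcre_tann_le (shiftDom X k) (f := fun i => i) (fun _ _ _ _ h => h)
    (shift_injective k).injOn (fun i hi => (mem_shiftDom.1 hi).1)
    (fun i hi => (mem_shiftDom.1 hi).2) Φ).trans (norm_num_le_excNum h hX)

/-- Two holes and two particles are annihilated; each kind contributes at most a factor N_E to the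
vector. -/
theorem sum_pairNorm_sq_le {X : Finset (Mode s)} (hX : ∀ i ∈ X, i.1 ∉ fermiBall kF)
    {Ψ : Fock s} (h : Ψ ∈ HN s kF) :
    ∑ x ∈ ballModes s kF, ∑ y ∈ ballModes s kF, pairNorm kF X Ψ x y ^ 2 ≤
      ‖excNum kF (excNum kF Ψ)‖ ^ 2 := by
  have hd : Disjoint (ballModes s kF) X :=
    Finset.disjoint_left.2 fun i hi hi' => hX i hi' (mem_ballModes.1 hi)
  have h1 := sum_norm_four_le (kF := kF) hd Ψ
  rw [num_ballModes h] at h1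
  have h2 : ‖num kF X (excNum kF Ψ)‖ ^ 2 ≤ ‖excNum kF (excNum kF Ψ)‖ ^ 2 :=
    pow_le_pow_left₀ (norm_nonneg _) (norm_num_le_excNum (excNum_mem h) hX) 2
  refine le_trans (le_of_eq ?_) (h1.trans h2)
  have e : ∀ x y, pairNorm kF X Ψ x y ^ 2 =
      ∑ w ∈ X, ∑ u ∈ X, ‖tann kF x (tann kF y (tann kF u (tann kF w Ψ)))‖ ^ 2 := by
    intro x y
    rw [pairNorm, Real.sq_sqrt (Finset.sum_nonneg fun _ _ => Finset.sum_nonneg fun _ _ => by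
      positivity), Finset.sum_comm]
  simp only [e]
  rw [Finset.sum_comm]
  simp only [Finset.sum_comm (s := ballModes s kF) (t := X)]

/-- `½ ∑_{p,q ∈ L_l} ⟨e_p, K_l e_q⟩ b_{l,p} b_{-l,-q}`. -/
noncomputable def lowOp (s : ℕ) (kF : ℝ) (V : Mom → ℝ) (l : Mom) : Fock s →L[ℂ] Fock s :=
  (1 / 2 : ℂ) • ∑ p : lune kF l, ∑ q : lune kF l, (KMat s kF V l p q : ℂ) •
    (bOp s l p ∘L bOp s (-l) (-q.1))

theorem calKTermFock_eq (V : Mom → ℝ) (l : Mom) : calKTermFock s kF V l =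
    lowOp s kF V l - ContinuousLinearMap.adjoint (lowOp s kF V l) := by
  rw [calKTermFock, lowOp, LinearIsometryEquiv.map_smulₛₗ]
  simp only [map_sum, LinearIsometryEquiv.map_smulₛₗ, Complex.conj_ofReal,
    ContinuousLinearMap.adjoint_comp]
  rw [show (starRingEnd ℂ) (1 / 2 : ℂ) = 1 / 2 by
    rw [map_div₀, map_one, Complex.conj_ofNat], ← smul_sub]
  simp only [← Finset.sum_sub_distrib, ← smul_sub]

/-- The index set of the terms of `lowOp`. -/
abbrev LowIdx (s : ℕ) (kF : ℝ) (l : Mom) : Type := (lune kF l × lune kF l) × Fin s × Fin s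

variable {l : Mom}

/-- The first hole mode of a term of `lowOp`. -/
def LowIdx.x (α : LowIdx s kF l) : Mode s := (α.1.1 - l, α.2.1)

/-- The second hole mode of a term of `lowOp`. -/
def LowIdx.y (α : LowIdx s kF l) : Mode s := (-α.1.2.1 - -l, α.2.2)

/-- The first particle mode of a term of `lowOp`. -/
def LowIdx.i (α : LowIdx s kF l) : Mode s := (α.1.1, α.2.1)

/-- The second particle mode of a term of `lowOp`. -/
def LowIdx.j (α : LowIdx s kF l) : Mode s := (-α.1.2.1, α.2.2)

theorem LowIdx.x_mem (α : LowIdx s kF l) : α.x.1 ∈ fermiBall kF :=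
  mem_fermiBall.2 (mem_lune.1 α.1.1.2).1

theorem LowIdx.y_mem (α : LowIdx s kF l) : α.y.1 ∈ fermiBall kF := by
  refine mem_fermiBall.2 ?_
  rw [LowIdx.y, show -α.1.2.1 - -l = -(α.1.2.1 - l) by abel, len_neg]
  exact (mem_lune.1 α.1.2.2).1

theorem LowIdx.i_notMem (α : LowIdx s kF l) : α.i.1 ∉ fermiBall kF := fun h =>
  absurd (mem_fermiBall.1 h) (not_le.2 (mem_lune.1 α.1.1.2).2)

theorem LowIdx.j_notMem (α : LowIdx s kF l) : α.j.1 ∉ fermiBall kF := fun h =>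
  absurd (mem_fermiBall.1 h) (not_le.2 (by
    rw [LowIdx.j, len_neg]; exact (mem_lune.1 α.1.2.2).2))

theorem LowIdx.xy_injective :
    Function.Injective fun α : LowIdx s kF l => (α.x, α.y) := by
  rintro ⟨⟨p, q⟩, σ, τ⟩ ⟨⟨p', q'⟩, σ', τ'⟩ h
  simp only [LowIdx.x, LowIdx.y, Prod.mk.injEq, sub_left_inj, neg_inj] at h
  obtain ⟨⟨h1, h2⟩, h3, h4⟩ := h
  rw [Subtype.ext h1, Subtype.ext h3, h2, h4]

/-- The coefficient of a term of `lowOp`. -/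
noncomputable def LowIdx.coeff (V : Mom → ℝ) (α : LowIdx s kF l) : ℝ :=
  -(KMat s kF V l α.1.1 α.1.2 / (2 * s))

/-- Moving both particle annihilators to the right passes one hole operator, whence the sign. -/
theorem bOp_bOp (p q : lune kF l) (Ψ : Fock s) :
    bOp s l p (bOp s (-l) (-q.1) Ψ) = ∑ σ : Fin s, ∑ τ : Fin s, (-(s : ℂ)⁻¹) •
      tann kF (LowIdx.x ((p, q), σ, τ)) (tann kF (LowIdx.y ((p, q), σ, τ))
        (tann kF (LowIdx.i ((p, q), σ, τ)) (tann kF (LowIdx.j ((p, q), σ, τ)) Ψ))) := by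
  have hs' : (((Real.sqrt s)⁻¹ : ℝ) : ℂ) * (((Real.sqrt s)⁻¹ : ℝ) : ℂ) = (s : ℂ)⁻¹ := by
    rw [← Complex.ofReal_mul, ← mul_inv, Real.mul_self_sqrt (Nat.cast_nonneg _)]
    push_cast; rfl
  simp only [bOp, smul_apply, sum_apply,
    ContinuousLinearMap.comp_apply, map_smul, map_sum, smul_smul, hs', Finset.smul_sum]
  rw [Finset.sum_comm]
  refine Finset.sum_congr rfl fun σ _ => Finset.sum_congr rfl fun τ _ => ?_
  set α : LowIdx s kF l := ((p, q), σ, τ) with hα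
  have h1 : cre (p.1 - l, σ) (ann (p.1, σ) (cre (-q.1 - -l, τ) (ann (-q.1, τ) Ψ))) =
      -cre α.x (cre α.y (ann α.i (ann α.j Ψ))) := by
    have h2 : α.i ≠ α.y := fun h => α.i_notMem (h ▸ α.y_mem)
    change cre α.x (ann α.i (cre α.y (ann α.j Ψ))) = _
    rw [ann_cre, if_neg h2, zero_sub, map_neg]
  rw [h1, tann_of_mem α.x_mem, tann_of_mem α.y_mem, tann_of_notMem α.i_notMem,
    tann_of_notMem α.j_notMem, neg_smul, smul_neg]

theorem lowOp_apply (hs : 1 ≤ s) (V : Mom → ℝ) (l : Mom) (Ψ : Fock s) :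
    lowOp s kF V l Ψ = ∑ α : LowIdx s kF l, (α.coeff V : ℂ) •
      tann kF α.x (tann kF α.y (tann kF α.i (tann kF α.j Ψ))) := by
  simp only [lowOp, smul_apply, sum_apply,
    ContinuousLinearMap.comp_apply, bOp_bOp, Finset.smul_sum, smul_smul]
  rw [Fintype.sum_prod_type, Fintype.sum_prod_type]
  refine Finset.sum_congr rfl fun p _ => Finset.sum_congr rfl fun q _ => ?_
  rw [Fintype.sum_prod_type]
  refine Finset.sum_congr rfl fun σ _ => Finset.sum_congr rfl fun τ _ => ?_
  congr 1
  have : (s : ℂ) ≠ 0 := by exact_mod_cast (by omega : s ≠ 0)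
  rw [LowIdx.coeff]
  push_cast
  field_simp

/-- The s² spin pairs compensate the factor 1/s² from the normalization of the two operators b, so
no power of s is lost. -/
theorem sum_coeff_sq (hs : 1 ≤ s) (V : Mom → ℝ) (l : Mom) :
    ∑ α : LowIdx s kF l, α.coeff V ^ 2 = (kNorm s kF V l / 2) ^ 2 := by
  have hs' : (s : ℝ) ≠ 0 := by exact_mod_cast (by omega : s ≠ 0)
  have e : kNorm s kF V l ^ 2 = ∑ p, ∑ q, KMat s kF V l p q ^ 2 :=
    Real.sq_sqrt (Finset.sum_nonneg fun p _ => Finset.sum_nonneg fun q _ => sq_nonneg _)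
  rw [div_pow, e, Fintype.sum_prod_type, Fintype.sum_prod_type, Finset.sum_div]
  refine Finset.sum_congr rfl fun p _ => ?_
  rw [Finset.sum_div]
  refine Finset.sum_congr rfl fun q _ => ?_
  simp only [LowIdx.coeff, Finset.sum_const, Finset.card_univ, Fintype.card_prod,
    Fintype.card_fin, nsmul_eq_mul]
  push_cast
  field_simp

theorem sum_abs_coeff_mul_pairNorm_le (hs : 1 ≤ s) (V : Mom → ℝ) (l : Mom)
    {X : Finset (Mode s)} (hX : ∀ i ∈ X, i.1 ∉ fermiBall kF) {Ψ : Fock s} (h : Ψ ∈ HN s kF) :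
    ∑ α : LowIdx s kF l, |α.coeff V| * pairNorm kF X Ψ α.x α.y ≤
      kNorm s kF V l / 2 * ‖excNum kF (excNum kF Ψ)‖ := by
  classical
  refine (Real.sum_mul_le_sqrt_mul_sqrt _ _ _).trans ?_
  simp only [sq_abs]
  rw [sum_coeff_sq hs, Real.sqrt_sq (div_nonneg (kNorm_nonneg s kF V l) zero_le_two)]
  refine mul_le_mul_of_nonneg_left ?_ (div_nonneg (kNorm_nonneg s kF V l) zero_le_two)
  rw [← Real.sqrt_sq (norm_nonneg (excNum kF (excNum kF Ψ)))]
  refine Real.sqrt_le_sqrt (le_trans ?_ (sum_pairNorm_sq_le hX h))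
  rw [← Finset.sum_product', ← Finset.sum_image (s := Finset.univ)
    (g := fun α : LowIdx s kF l => (α.x, α.y)) (f := fun p => pairNorm kF X Ψ p.1 p.2 ^ 2)
    LowIdx.xy_injective.injOn]
  refine Finset.sum_le_sum_of_subset_of_nonneg ?_ fun _ _ _ => sq_nonneg _
  intro p hp
  obtain ⟨α, -, rfl⟩ := Finset.mem_image.1 hp
  exact Finset.mem_product.2 ⟨mem_ballModes.2 α.x_mem, mem_ballModes.2 α.y_mem⟩

/-- Cauchy–Schwarz in k for each term of the lowering operator, then in the lune indices against the
Hilbert–Schmidt norm. The bound does not depend on X otherwise, so it survives removal of the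
truncation. -/
theorem sum_norm_inner_lowOp_commutator_le (hs : 1 ≤ s) (F : Finset MomStar) {V : Mom → ℝ}
    (hV0 : ∀ k : MomStar, 0 ≤ V k) (l : Mom) {X : Finset (Mode s)}
    (hX : ∀ i ∈ X, i.1 ∉ fermiBall kF) (hl : ∀ α : LowIdx s kF l, α.i ∈ X ∧ α.j ∈ X)
    {Φ Ψ : Fock s} (hΦ : Φ ∈ HN s kF) (hΨ : Ψ ∈ HN s kF) :
    ∑ k ∈ F, V k * ‖⟪Φ, lowOp s kF V l (truncQ kF X k Ψ) -
        truncQ kF X k (lowOp s kF V l Ψ)⟫_ℂ‖ ≤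
      √(∑ k ∈ F, V k ^ 2) * kNorm s kF V l *
        ((2 * ‖excNum kF Φ‖ + ‖Φ‖) * ‖excNum kF (excNum kF Ψ)‖) := by
  set T : MomStar → LowIdx s kF l → ℝ := fun k α =>
    ‖⟪Φ, tann kF α.x (tann kF α.y (tann kF α.i (tann kF α.j (truncQ kF X k Ψ)))) -
        truncQ kF X k (tann kF α.x (tann kF α.y (tann kF α.i (tann kF α.j Ψ))))⟫_ℂ‖ with hT
  have h1 : ∀ k ∈ F, V k * ‖⟪Φ, lowOp s kF V l (truncQ kF X k Ψ) -
      truncQ kF X k (lowOp s kF V l Ψ)⟫_ℂ‖ ≤ ∑ α, |α.coeff V| * (V k * T k α) := by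
    intro k _
    have e : ⟪Φ, lowOp s kF V l (truncQ kF X k Ψ) - truncQ kF X k (lowOp s kF V l Ψ)⟫_ℂ =
        ∑ α : LowIdx s kF l, (α.coeff V : ℂ) *
          ⟪Φ, tann kF α.x (tann kF α.y (tann kF α.i (tann kF α.j (truncQ kF X k Ψ)))) -
            truncQ kF X k (tann kF α.x (tann kF α.y (tann kF α.i (tann kF α.j Ψ))))⟫_ℂ := by
      rw [lowOp_apply hs, lowOp_apply hs, map_sum, ← Finset.sum_sub_distrib, inner_sum]
      refine Finset.sum_congr rfl fun α _ => ?_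
      rw [map_smul, ← smul_sub, inner_smul_right]
    have h2 := norm_sum_le Finset.univ fun α : LowIdx s kF l => (α.coeff V : ℂ) *
      ⟪Φ, tann kF α.x (tann kF α.y (tann kF α.i (tann kF α.j (truncQ kF X k Ψ)))) -
        truncQ kF X k (tann kF α.x (tann kF α.y (tann kF α.i (tann kF α.j Ψ))))⟫_ℂ
    rw [← e] at h2
    refine (mul_le_mul_of_nonneg_left h2 (hV0 k)).trans (le_of_eq ?_)
    rw [Finset.mul_sum]
    refine Finset.sum_congr rfl fun α _ => ?_
    rw [norm_mul, Complex.norm_real, Real.norm_eq_abs, hT]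
    ring
  refine (Finset.sum_le_sum h1).trans ?_
  rw [Finset.sum_comm]
  have hx : ∀ i : Mode s, i.1 ∈ fermiBall kF → i ∉ X := fun i hi hi' => hX i hi' hi
  have h3 : ∀ α ∈ (Finset.univ : Finset (LowIdx s kF l)),
      ∑ k ∈ F, |α.coeff V| * (V k * T k α) ≤ ((4 * ‖excNum kF Φ‖ + 2 * ‖Φ‖) *
        √(∑ k ∈ F, V k ^ 2)) * (|α.coeff V| * pairNorm kF X Ψ α.x α.y) := by
    intro α _
    rw [← Finset.mul_sum]
    have := sum_norm_inner_commutator_le (kF := kF) X Φ Ψ F hV0 (hx _ α.x_mem) (hx _ α.y_mem)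
      (hl α).1 (hl α).2 (fun k => norm_trunc_le hX k hΦ) le_rfl
    refine (mul_le_mul_of_nonneg_left this (abs_nonneg _)).trans (le_of_eq ?_)
    ring
  refine (Finset.sum_le_sum h3).trans ?_
  rw [← Finset.mul_sum]
  refine (mul_le_mul_of_nonneg_left (sum_abs_coeff_mul_pairNorm_le hs V l hX hΨ)
    (by positivity)).trans (le_of_eq ?_)
  ring

end Lowering

end FermiGas

namespace FermiGas

open Filter Topology

/-! ### Functions of the excitation number -/

section Scaled

variable {s : ℕ} {kF : ℝ}

theorem outCard_insert_of_notMem {i : Mode s} (hi : i.1 ∉ fermiBall kF) {S : Finset (Mode s)}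
    (h : i ∉ S) : outCard kF (insert i S) = outCard kF S + 1 := by
  rw [outCard, Finset.filter_insert, if_pos hi, Finset.card_insert_of_notMem]
  · rfl
  · exact fun h' => h (Finset.mem_filter.1 h').1

theorem outCard_insert_of_mem {i : Mode s} (hi : i.1 ∈ fermiBall kF) (S : Finset (Mode s)) :
    outCard kF (insert i S) = outCard kF S := by
  rw [outCard, Finset.filter_insert, if_neg (not_not.2 hi)]
  rfl

/-- `Φ = f(N_E) Ψ` in terms of coefficients. -/
def Scaled (kF : ℝ) (f : ℕ → ℝ) (Ψ Φ : Fock s) : Prop :=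
  ∀ S : Finset (Mode s), Φ S = (f (outCard kF S) : ℂ) * Ψ S

variable {f g : ℕ → ℝ} {Ψ Φ Ψ' Φ' : Fock s}

theorem Scaled.sum {ι : Type*} {I : Finset ι} {v w : ι → Fock s}
    (h : ∀ i ∈ I, Scaled kF f (v i) (w i)) : Scaled kF f (∑ i ∈ I, v i) (∑ i ∈ I, w i) := by
  intro S
  rw [lp.coeFn_sum, lp.coeFn_sum, Finset.sum_apply, Finset.sum_apply, Finset.mul_sum]
  exact Finset.sum_congr rfl fun i hi => h i hi S

theorem Scaled.sub (h : Scaled kF f Ψ Φ) (h' : Scaled kF f Ψ' Φ') :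
    Scaled kF f (Ψ - Ψ') (Φ - Φ') := by
  intro S
  rw [lp.coeFn_sub, lp.coeFn_sub, Pi.sub_apply, Pi.sub_apply, h S, h' S, mul_sub]

theorem Scaled.smul (a : ℂ) (h : Scaled kF f Ψ Φ) : Scaled kF f (a • Ψ) (a • Φ) := by
  intro S
  rw [lp.coeFn_smul, lp.coeFn_smul, Pi.smul_apply, Pi.smul_apply, h S, smul_eq_mul, smul_eq_mul]
  ring

theorem Scaled.tann_out {i : Mode s} (hi : i.1 ∉ fermiBall kF) (h : Scaled kF f Ψ Φ) :
    Scaled kF (fun n => f (n + 1)) (tann kF i Ψ) (tann kF i Φ) := by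
  intro S
  rw [tann_of_notMem hi, ann_apply, ann_apply]
  split_ifs with hS
  · simp
  · rw [h, outCard_insert_of_notMem hi hS]; ring

theorem Scaled.tann_hole {i : Mode s} (hi : i.1 ∈ fermiBall kF) (h : Scaled kF f Ψ Φ) :
    Scaled kF f (tann kF i Ψ) (tann kF i Φ) := by
  intro S
  rw [tann_of_mem hi, cre_apply, cre_apply]
  split_ifs with hS
  · rw [h, ← outCard_insert_of_mem hi (S.erase i), Finset.insert_erase hS]; ring
  · simp

theorem Scaled.tcre_out {i : Mode s} (hi : i.1 ∉ fermiBall kF)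
    (h : Scaled kF (fun n => f (n + 1)) Ψ Φ) : Scaled kF f (tcre kF i Ψ) (tcre kF i Φ) := by
  intro S
  rw [tcre_of_notMem hi, cre_apply, cre_apply]
  split_ifs with hS
  · have e := outCard_insert_of_notMem hi (Finset.notMem_erase i S)
    rw [Finset.insert_erase hS] at e
    rw [h, e]; ring
  · simp

theorem Scaled.truncQ {X : Finset (Mode s)} (hX : ∀ i ∈ X, i.1 ∉ fermiBall kF) (k : Mom)
    (h : Scaled kF f Ψ Φ) : Scaled kF f (truncQ kF X k Ψ) (truncQ kF X k Φ) := by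
  have ht : ∀ (k : Mom) {Ψ Φ : Fock s}, Scaled kF f Ψ Φ →
      Scaled kF f (trunc kF X k Ψ) (trunc kF X k Φ) := by
    intro k Ψ Φ h
    rw [trunc_apply, trunc_apply]
    exact Scaled.sum fun i hi => (h.tann_out (hX _ (mem_shiftDom.1 hi).2)).tcre_out
      (hX _ (mem_shiftDom.1 hi).1)
  rw [truncQ_apply, truncQ_apply, truncNum_apply, truncNum_apply]
  exact (ht _ (ht _ h)).sub (Scaled.sum fun i hi =>
    (h.tann_out (hX _ (mem_shiftDom.1 hi).2)).tcre_out (hX _ (mem_shiftDom.1 hi).2))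

theorem Scaled.lowOp (hs : 1 ≤ s) (V : Mom → ℝ) (l : Mom) (h : Scaled kF f Ψ Φ) :
    Scaled kF (fun n => f (n + 2)) (lowOp s kF V l Ψ) (lowOp s kF V l Φ) := by
  rw [lowOp_apply hs, lowOp_apply hs]
  exact Scaled.sum fun α _ => Scaled.smul _ ((((h.tann_out α.j_notMem).tann_out
    α.i_notMem).tann_hole α.y_mem).tann_hole α.x_mem)

/-- Reciprocal weights on the two sides of an inner product cancel; they need be reciprocal only for
excitation numbers that occur. -/
theorem Scaled.inner_eq (h : Scaled kF f Ψ Φ) (h' : Scaled kF g Ψ' Φ') {m : ℕ}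
    (hfg : ∀ n ≤ m, f n * g n = 1) (hm : ∀ S, m < outCard kF S → Ψ S = 0) :
    ⟪Φ, Φ'⟫_ℂ = ⟪Ψ, Ψ'⟫_ℂ := by
  rw [lp.inner_eq_tsum, lp.inner_eq_tsum]
  refine tsum_congr fun S => ?_
  rw [h S, h' S]
  by_cases hS : m < outCard kF S
  · rw [hm S hS]; simp
  · have e : (f (outCard kF S) : ℂ) * (g (outCard kF S) : ℂ) = 1 := by
      exact_mod_cast hfg _ (not_lt.1 hS)
    simp only [RCLike.inner_apply, map_mul, Complex.conj_ofReal]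
    linear_combination (Ψ' S * (starRingEnd ℂ) (Ψ S)) * e

theorem outCard_le_card (S : Finset (Mode s)) : outCard kF S ≤ S.card := Finset.card_filter_le _ _

theorem apply_eq_zero_of_lt_outCard (h : Ψ ∈ HN s kF) (S : Finset (Mode s))
    (hS : s * (fermiBall kF).card < outCard kF S) : Ψ S = 0 :=
  h S (hS.trans_le (outCard_le_card S)).ne'

/-- At most N excitations occur in the sector, so every function of N_E acts boundedly there. -/
theorem exists_scaled (h : Ψ ∈ HN s kF) (f : ℕ → ℝ) : ∃ Φ ∈ HN s kF, Scaled kF f Ψ Φ := by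
  set m := s * (fermiBall kF).card with hm
  set c : ℝ := ∑ n ∈ Finset.range (m + 1), |f n| with hc
  have hb : ∀ S : Finset (Mode s), ‖(f (outCard kF S) : ℂ) * Ψ S‖ ≤ ‖((c : ℂ) • Ψ) S‖ := by
    intro S
    rw [lp.coeFn_smul, Pi.smul_apply, smul_eq_mul, norm_mul, norm_mul]
    by_cases hS : m < outCard kF S
    · rw [apply_eq_zero_of_lt_outCard h S hS]; simp
    · gcongr
      rw [Complex.norm_real, Complex.norm_real, Real.norm_eq_abs, Real.norm_eq_abs]
      refine le_trans ?_ (le_abs_self _)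
      exact Finset.single_le_sum (f := fun n => |f n|) (fun _ _ => abs_nonneg _)
        (Finset.mem_range.2 (by omega))
  refine ⟨⟨fun S => (f (outCard kF S) : ℂ) * Ψ S,
    memℓp_gen' (C := ‖(c : ℂ) • Ψ‖ ^ (2 : ENNReal).toReal) fun T => ?_⟩, fun S hS => ?_, fun S => rfl⟩
  · exact (Finset.sum_le_sum fun S _ => Real.rpow_le_rpow (norm_nonneg _) (hb S) (by simp)).trans
      (lp.sum_rpow_le_norm_rpow (by simp) _ T)
  · change (f (outCard kF S) : ℂ) * Ψ S = 0
    rw [h S hS, mul_zero]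

theorem hasSum_norm_sq (Ψ : Fock s) : HasSum (fun S => ‖Ψ S‖ ^ 2) (‖Ψ‖ ^ 2) := by
  have h := (lp.hasSum_inner Ψ Ψ).mapL Complex.reCLM
  rw [norm_sq_eq_re_inner (𝕜 := ℂ) Ψ]
  exact h.congr_fun fun S => norm_sq_eq_re_inner (𝕜 := ℂ) (Ψ S)

theorem hasSum_cube (h : Ψ ∈ HN s kF) :
    HasSum (fun S => ((outCard kF S : ℝ) ^ 3 + 1) * ‖Ψ S‖ ^ 2)
      (⟪Ψ, excNum kF (excNum kF (excNum kF Ψ)) + Ψ⟫_ℂ).re := by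
  have h' := (lp.hasSum_inner Ψ (excNum kF (excNum kF (excNum kF Ψ)) + Ψ)).mapL Complex.reCLM
  refine h'.congr_fun fun S => ?_
  rw [lp.coeFn_add, Pi.add_apply, excNum_apply (excNum_mem (excNum_mem h)),
    excNum_apply (excNum_mem h), excNum_apply h, norm_sq_eq_re_inner (𝕜 := ℂ) (Ψ S)]
  have e : (outCard kF S : ℂ) * ((outCard kF S : ℂ) * ((outCard kF S : ℂ) * Ψ S)) + Ψ S =
      (((outCard kF S : ℝ) ^ 3 + 1 : ℝ) : ℂ) * Ψ S := by push_cast; ring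
  rw [e]
  change _ = (⟪Ψ S, (((outCard kF S : ℝ) ^ 3 + 1 : ℝ) : ℂ) • Ψ S⟫_ℂ).re
  rw [inner_smul_right, Complex.re_ofReal_mul]
  rfl

theorem norm_sq_le_cube (h : Ψ ∈ HN s kF) {c : ℝ}
    (hΦ : ∀ S, ‖Φ S‖ ^ 2 ≤ c * (((outCard kF S : ℝ) ^ 3 + 1) * ‖Ψ S‖ ^ 2)) :
    ‖Φ‖ ^ 2 ≤ c * (⟪Ψ, excNum kF (excNum kF (excNum kF Ψ)) + Ψ⟫_ℂ).re :=
  hasSum_le hΦ (hasSum_norm_sq Φ) ((hasSum_cube h).mul_left c)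

/-- Used directly, the previous bound would give ‖N_E Ψ‖ ‖N_E² Ψ‖, which the expectation of N_E³
does not control. Moving half a power of N_E from the right vector to the left balances the two. -/
theorem sum_norm_inner_self_lowOp_commutator_le (hs : 1 ≤ s) (F : Finset MomStar) {V : Mom → ℝ}
    (hV0 : ∀ k : MomStar, 0 ≤ V k) (l : Mom) {X : Finset (Mode s)}
    (hX : ∀ i ∈ X, i.1 ∉ fermiBall kF) (hl : ∀ α : LowIdx s kF l, α.i ∈ X ∧ α.j ∈ X)
    {Ψ : Fock s} (h : Ψ ∈ HN s kF) :
    ∑ k ∈ F, V k * ‖⟪Ψ, lowOp s kF V l (truncQ kF X k Ψ) -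
        truncQ kF X k (lowOp s kF V l Ψ)⟫_ℂ‖ ≤
      √(∑ k ∈ F, V k ^ 2) * kNorm s kF V l *
        (6 * (⟪Ψ, excNum kF (excNum kF (excNum kF Ψ)) + Ψ⟫_ℂ).re) := by
  set E := (⟪Ψ, excNum kF (excNum kF (excNum kF Ψ)) + Ψ⟫_ℂ).re with hE
  have hE0 : 0 ≤ E := (hasSum_cube h).nonneg fun S => by positivity
  -- The commutator lowers N_E by two, so the weight (n + 1)^{-1/2} on the right becomes (n +
  -- 3)^{-1/2} after it and cancels the weight on the left.
  obtain ⟨Φ, hΦ, hf⟩ := exists_scaled h fun n => √(n + 3)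
  obtain ⟨Ω, hΩ, hg⟩ := exists_scaled h fun n => (√(n + 1))⁻¹
  have e : ∀ k : MomStar, ⟪Φ, lowOp s kF V l (truncQ kF X k Ω) -
        truncQ kF X k (lowOp s kF V l Ω)⟫_ℂ = ⟪Ψ, lowOp s kF V l (truncQ kF X k Ψ) -
        truncQ kF X k (lowOp s kF V l Ψ)⟫_ℂ := by
    intro k
    refine hf.inner_eq (((hg.truncQ hX k).lowOp hs V l).sub ((hg.lowOp hs V l).truncQ hX k))
      (m := s * (fermiBall kF).card) (fun n _ => ?_) (apply_eq_zero_of_lt_outCard h)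
    have : ((n + 2 : ℕ) : ℝ) + 1 = n + 3 := by push_cast; ring
    rw [this]
    exact mul_inv_cancel₀ (Real.sqrt_ne_zero'.2 (by positivity))
  have hmain := sum_norm_inner_lowOp_commutator_le hs F hV0 l hX hl hΦ hΩ
  simp only [e] at hmain
  refine hmain.trans (mul_le_mul_of_nonneg_left ?_
    (mul_nonneg (Real.sqrt_nonneg _) (kNorm_nonneg s kF V l)))
  have hn : ∀ n : ℕ, (n : ℝ) ^ 2 ≤ n ^ 3 ∧ (n : ℝ) ≤ n ^ 3 := fun n =>
    ⟨by exact_mod_cast (by rcases n.eq_zero_or_pos with rfl | h0; · simp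
                           exact Nat.pow_le_pow_right h0 (by norm_num) : n ^ 2 ≤ n ^ 3),
      by exact_mod_cast Nat.le_self_pow (by norm_num) n⟩
  have b1 : ‖excNum kF Φ‖ ^ 2 ≤ 4 * E := by
    refine norm_sq_le_cube h fun S => ?_
    rw [excNum_apply hΦ, hf S, norm_mul, norm_mul, mul_pow, mul_pow, Complex.norm_natCast,
      Complex.norm_real, Real.norm_eq_abs, sq_abs, Real.sq_sqrt (by positivity), ← mul_assoc,
      ← mul_assoc]
    refine mul_le_mul_of_nonneg_right ?_ (by positivity)
    nlinarith [(hn (outCard kF S)).1]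
  have b2 : ‖Φ‖ ^ 2 ≤ 4 * E := by
    refine norm_sq_le_cube h fun S => ?_
    rw [hf S, norm_mul, mul_pow, Complex.norm_real, Real.norm_eq_abs, sq_abs,
      Real.sq_sqrt (by positivity), ← mul_assoc]
    refine mul_le_mul_of_nonneg_right ?_ (by positivity)
    nlinarith [(hn (outCard kF S)).2, sq_nonneg (outCard kF S : ℝ)]
  have b3 : ‖excNum kF (excNum kF Ω)‖ ^ 2 ≤ 1 * E := by
    refine norm_sq_le_cube h fun S => ?_
    rw [excNum_apply (excNum_mem hΩ), excNum_apply hΩ, hg S, norm_mul, norm_mul, norm_mul, mul_pow,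
      mul_pow, mul_pow, Complex.norm_natCast, Complex.norm_real, Real.norm_eq_abs, sq_abs, inv_pow,
      Real.sq_sqrt (by positivity), ← mul_assoc, ← mul_assoc, ← mul_assoc]
    refine mul_le_mul_of_nonneg_right ?_ (by positivity)
    rw [← div_eq_mul_inv, div_le_iff₀ (by positivity)]
    have : (0 : ℝ) ≤ outCard kF S := by positivity
    nlinarith [pow_nonneg this 3]
  have c1 : ‖excNum kF Φ‖ ≤ 2 * √E := by
    refine le_of_sq_le_sq ?_ (by positivity)
    rw [mul_pow, Real.sq_sqrt hE0]; linarith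
  have c2 : ‖Φ‖ ≤ 2 * √E := by
    refine le_of_sq_le_sq ?_ (by positivity)
    rw [mul_pow, Real.sq_sqrt hE0]; linarith
  have c3 : ‖excNum kF (excNum kF Ω)‖ ≤ √E := by
    refine le_of_sq_le_sq ?_ (by positivity)
    rw [Real.sq_sqrt hE0]; linarith
  calc _ ≤ (2 * (2 * √E) + 2 * √E) * √E := by gcongr
    _ = 6 * E := by nlinarith [Real.mul_self_sqrt hE0]

end Scaled

end FermiGas

namespace FermiGas

open Filter Topology

/-! ### The two-body operators on `H_N` -/

section TwoBody

variable {s : ℕ} {kF : ℝ}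

theorem incl_mem (Ψ : HSpace s kF) : incl s kF Ψ ∈ HN s kF := Subtype.mem Ψ

theorem inner_incl (Φ Ψ : HSpace s kF) : ⟪incl s kF Φ, incl s kF Ψ⟫_ℂ = ⟪Φ, Ψ⟫_ℂ := rfl

theorem norm_incl (Ψ : HSpace s kF) : ‖incl s kF Ψ‖ = ‖Ψ‖ := rfl

theorem adjoint_incl_incl (Ψ : HSpace s kF) :
    ContinuousLinearMap.adjoint (incl s kF) (incl s kF Ψ) = Ψ := by
  refine ext_inner_left ℂ fun Φ => ?_
  rw [ContinuousLinearMap.adjoint_inner_right, inner_incl]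

theorem incl_adjoint_incl {Ψ : Fock s} (h : Ψ ∈ HN s kF) :
    incl s kF (ContinuousLinearMap.adjoint (incl s kF) Ψ) = Ψ := by
  obtain ⟨Φ, rfl⟩ : ∃ Φ : HSpace s kF, incl s kF Φ = Ψ := ⟨⟨Ψ, h⟩, rfl⟩
  rw [adjoint_incl_incl]

theorem norm_excNum_le {Ψ : Fock s} (h : Ψ ∈ HN s kF) :
    ‖excNum kF Ψ‖ ≤ (s * (fermiBall kF).card : ℕ) * ‖Ψ‖ := by
  have e : ((s * (fermiBall kF).card : ℕ) : ℝ) * ‖Ψ‖ =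
      ‖((s * (fermiBall kF).card : ℕ) : ℂ) • Ψ‖ := by
    rw [norm_smul, Complex.norm_natCast]
  rw [e]
  refine norm_le_of_apply_le fun S => ?_
  rw [excNum_apply h, lp.coeFn_smul, Pi.smul_apply, smul_eq_mul, norm_mul, norm_mul]
  by_cases hS : s * (fermiBall kF).card < outCard kF S
  · rw [apply_eq_zero_of_lt_outCard h S hS]; simp
  · gcongr
    rw [Complex.norm_natCast, Complex.norm_natCast]
    exact_mod_cast not_lt.1 hS

variable {ι : Type*} {f g : ι → Mode s}

/-- The operator `∑_i c̃_{f i}^* c̃_{g i}` from `H_N` to the Fock space. -/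
noncomputable def transOp (kF : ℝ) (f g : ι → Mode s) (hf : Function.Injective f)
    (hg : Function.Injective g) (hfo : ∀ i, (f i).1 ∉ fermiBall kF)
    (hgo : ∀ i, (g i).1 ∉ fermiBall kF) : HSpace s kF →L[ℂ] Fock s :=
  LinearMap.mkContinuous
    { toFun := fun Ψ => ∑' i, tcre kF (f i) (tann kF (g i) (incl s kF Ψ))
      map_add' := fun Ψ Φ => by
        simp only [map_add]
        exact (summable_tcre_tann (cardLE_of_mem (incl_mem Ψ)) hf hg hfo hgo).tsum_add
          (summable_tcre_tann (cardLE_of_mem (incl_mem Φ)) hf hg hfo hgo)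
      map_smul' := fun a Ψ => by
        simp only [map_smul, RingHom.id_apply]
        exact (summable_tcre_tann (cardLE_of_mem (incl_mem Ψ)) hf hg hfo hgo).tsum_const_smul a }
    (s * (fermiBall kF).card : ℕ)
    fun Ψ => (norm_tsum_tcre_tann_le hf hg hfo hgo (incl_mem Ψ)).trans
      (norm_excNum_le (incl_mem Ψ))

theorem hasSum_transOp (hf : Function.Injective f) (hg : Function.Injective g)
    (hfo : ∀ i, (f i).1 ∉ fermiBall kF) (hgo : ∀ i, (g i).1 ∉ fermiBall kF) (Ψ : HSpace s kF) :
    HasSum (fun i => tcre kF (f i) (tann kF (g i) (incl s kF Ψ)))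
      (transOp kF f g hf hg hfo hgo Ψ) :=
  (summable_tcre_tann (cardLE_of_mem (incl_mem Ψ)) hf hg hfo hgo).hasSum

/-- `D_{2,k}` as a bounded operator from `H_N` to the Fock space. -/
noncomputable def D2op (s : ℕ) (kF : ℝ) (k : Mom) : HSpace s kF →L[ℂ] Fock s :=
  transOp kF (tgtMode k) (srcMode k) (tgtMode_injective k) (srcMode_injective k) (tgtMode_out k)
    (srcMode_out k)

/-- The number operator of the modes annihilated in `D_{2,k}`. -/
noncomputable def srcNum (s : ℕ) (kF : ℝ) (k : Mom) : HSpace s kF →L[ℂ] Fock s :=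
  transOp kF (srcMode k) (srcMode k) (srcMode_injective k) (srcMode_injective k) (srcMode_out k)
    (srcMode_out k)

/-- The two-body operator with momentum transfer `k` on `H_N`. -/
noncomputable def twoBody (s : ℕ) (kF : ℝ) (k : Mom) : HSpace s kF →L[ℂ] HSpace s kF :=
  ContinuousLinearMap.adjoint (D2op s kF k) ∘L D2op s kF k -
    ContinuousLinearMap.adjoint (incl s kF) ∘L srcNum s kF k

theorem D2op_apply (k : Mom) (Ψ : HSpace s kF) : D2op s kF k Ψ = D2 kF k (incl s kF Ψ) :=
  (hasSum_transOp _ _ _ _ Ψ).unique (hasSum_D2 (incl_mem Ψ) k)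

theorem inner_twoBody (k : Mom) (Φ Ψ : HSpace s kF) : ⟪Φ, twoBody s kF k Ψ⟫_ℂ =
    ⟪D2op s kF k Φ, D2op s kF k Ψ⟫_ℂ - ⟪incl s kF Φ, srcNum s kF k Ψ⟫_ℂ := by
  rw [twoBody, sub_apply, inner_sub_right, ContinuousLinearMap.comp_apply,
    ContinuousLinearMap.comp_apply, ContinuousLinearMap.adjoint_inner_right,
    ContinuousLinearMap.adjoint_inner_right]

theorem hasSum_inner_srcNum (k : Mom) (Φ Ψ : HSpace s kF) :
    HasSum (fun x : OutOut kF (-k) × Fin s => ⟪tann kF (srcMode k x) (incl s kF Φ),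
      tann kF (srcMode k x) (incl s kF Ψ)⟫_ℂ) ⟪incl s kF Φ, srcNum s kF k Ψ⟫_ℂ := by
  have h := (hasSum_transOp (srcMode_injective k) (srcMode_injective k) (srcMode_out k)
    (srcMode_out k) Ψ).mapL (innerSL ℂ (incl s kF Φ))
  refine h.congr_fun fun x => ?_
  rw [innerSL_apply_apply, inner_tcre_right]

theorem adjoint_twoBody (k : Mom) :
    ContinuousLinearMap.adjoint (twoBody s kF k) = twoBody s kF k := by
  ext1 Ψ
  refine ext_inner_left ℂ fun Φ => ?_
  rw [ContinuousLinearMap.adjoint_inner_right, ← inner_conj_symm, inner_twoBody, inner_twoBody,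
    map_sub, inner_conj_symm]
  have h := (hasSum_inner_srcNum k Ψ Φ).map (starRingEnd ℂ) Complex.continuous_conj
  have h' : (starRingEnd ℂ) ⟪incl s kF Ψ, srcNum s kF k Φ⟫_ℂ =
      ⟪incl s kF Φ, srcNum s kF k Ψ⟫_ℂ := by
    refine h.unique ((hasSum_inner_srcNum k Φ Ψ).congr_fun fun x => ?_)
    rw [Function.comp_apply, inner_conj_symm]
  rw [h']

theorem inner_twoBody_self (k : Mom) (Ψ : HSpace s kF) : ⟪Ψ, twoBody s kF k Ψ⟫_ℂ =
    ∑' x, SRInner kF (incl s kF Ψ) k x := by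
  rw [(hasSum_SRInner (incl_mem Ψ) k).tsum_eq, inner_twoBody, D2op_apply,
    ← (hasSum_inner_srcNum k Ψ Ψ).tsum_eq, Complex.ofReal_tsum]
  congr 1
  refine tsum_congr fun x => ?_
  rw [inner_self_eq_norm_sq_to_K]
  norm_cast

/-- For each k the form is that of a bounded operator, so it makes sense on e^{-𝒦} Ψ, where no
kinetic regularity is available. -/
theorem SRTerm_incl (V : Mom → ℝ) (Ψ : HSpace s kF) (k : MomStar) :
    SRTerm kF V (incl s kF Ψ) k = V k * ⟪Ψ, twoBody s kF k Ψ⟫_ℂ := by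
  rw [inner_twoBody_self, SRTerm]

/-! ### Approximation by the truncated operators -/

/-- The modes of `Z` outside the Fermi ball. -/
noncomputable def outPart (kF : ℝ) (Z : Finset (Mode s)) : Finset (Mode s) :=
  Z.filter fun i => i.1 ∉ fermiBall kF

theorem mem_outPart {Z : Finset (Mode s)} {i : Mode s} :
    i ∈ outPart kF Z ↔ i ∈ Z ∧ i.1 ∉ fermiBall kF := Finset.mem_filter

/-- The terms of `D_{2,k}` with both modes in `Z`. -/
noncomputable def transIdx (kF : ℝ) (k : Mom) (Z : Finset (Mode s)) :
    Finset (OutOut kF (-k) × Fin s) :=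
  (Z.preimage (tgtMode k) (tgtMode_injective k).injOn).filter fun x => srcMode k x ∈ Z

theorem mem_transIdx {k : Mom} {Z : Finset (Mode s)} {x : OutOut kF (-k) × Fin s} :
    x ∈ transIdx kF k Z ↔ tgtMode k x ∈ Z ∧ srcMode k x ∈ Z := by
  rw [transIdx, Finset.mem_filter, Finset.mem_preimage]

theorem tendsto_transIdx (k : Mom) :
    Tendsto (transIdx kF k : Finset (Mode s) → _) atTop atTop := by
  classical
  refine tendsto_atTop_finset_of_monotone (fun Z Z' h x hx => ?_) fun x =>
    ⟨{tgtMode k x, srcMode k x}, mem_transIdx.2 (by simp)⟩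
  have := mem_transIdx.1 hx
  exact mem_transIdx.2 ⟨h this.1, h this.2⟩

theorem sum_transIdx {E : Type*} [AddCommMonoid E] (k : Mom) (Z : Finset (Mode s))
    (v : Mode s → E) : ∑ x ∈ transIdx kF k Z, v (tgtMode k x) =
      ∑ i ∈ shiftDom (outPart kF Z) k, v i := by
  refine Finset.sum_bij (fun x _ => tgtMode k x) ?_ ?_ ?_ fun _ _ => rfl
  · intro x hx
    have h := mem_transIdx.1 hx
    exact mem_shiftDom.2 ⟨mem_outPart.2 ⟨h.1, tgtMode_out k x⟩,
      mem_outPart.2 ⟨h.2, srcMode_out k x⟩⟩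
  · intro x _ y _ h
    exact tgtMode_injective k h
  · intro i hi
    obtain ⟨h1, h2⟩ := mem_shiftDom.1 hi
    rw [mem_outPart] at h1 h2
    refine ⟨(⟨i.1, h1.2, ?_⟩, i.2), mem_transIdx.2 ⟨h1.1, h2.1⟩, rfl⟩
    rw [sub_neg_eq_add]
    exact h2.2

theorem tendsto_trunc (k : Mom) (Ψ : HSpace s kF) :
    Tendsto (fun Z => trunc kF (outPart kF Z) k (incl s kF Ψ)) atTop (𝓝 (D2op s kF k Ψ)) := by
  have h := (hasSum_transOp (tgtMode_injective k) (srcMode_injective k) (tgtMode_out k)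
    (srcMode_out k) Ψ)
  refine (Tendsto.comp h (tendsto_transIdx k)).congr fun Z => ?_
  rw [trunc_apply]
  exact sum_transIdx k Z fun i => tcre kF i (tann kF (shift k i) (incl s kF Ψ))

theorem tendsto_truncNum (k : Mom) (Ψ : HSpace s kF) :
    Tendsto (fun Z => truncNum kF (outPart kF Z) k (incl s kF Ψ)) atTop
      (𝓝 (srcNum s kF k Ψ)) := by
  have h := (hasSum_transOp (srcMode_injective k) (srcMode_injective k) (srcMode_out k)
    (srcMode_out k) Ψ)
  refine (Tendsto.comp h (tendsto_transIdx k)).congr fun Z => ?_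
  rw [truncNum_apply]
  exact sum_transIdx k Z fun i => tcre kF (shift k i) (tann kF (shift k i) (incl s kF Ψ))

/-- Only weak convergence is needed: one factor D_{2,k} is carried by each side of the inner
product, and there the truncations converge strongly. -/
theorem tendsto_inner_truncQ (k : Mom) (Φ Ψ : HSpace s kF) :
    Tendsto (fun Z => ⟪incl s kF Φ, truncQ kF (outPart kF Z) k (incl s kF Ψ)⟫_ℂ) atTop
      (𝓝 ⟪Φ, twoBody s kF k Ψ⟫_ℂ) := by
  rw [inner_twoBody]
  refine (((tendsto_trunc k Φ).inner (tendsto_trunc k Ψ)).sub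
    (tendsto_const_nhds.inner (tendsto_truncNum k Ψ))).congr fun Z => ?_
  have h := inner_trunc_right (kF := kF) (outPart kF Z) (-k) (incl s kF Φ)
    (trunc kF (outPart kF Z) k (incl s kF Ψ))
  rw [neg_neg] at h
  rw [truncQ_apply, inner_sub_right, h]

/-! ### The lowering operators on `H_N` -/

theorem cre_ann_mem {n : ℕ} {Ψ : Fock s} (h : Ψ ∈ sector s n) (i j : Mode s) :
    cre i (ann j Ψ) ∈ sector s n := by
  intro S hS
  rw [cre_apply]
  split_ifs with hi
  · rw [ann_apply]
    split_ifs with hj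
    · simp
    · rw [h, mul_zero, mul_zero]
      rwa [Finset.card_insert_of_notMem hj, Finset.card_erase_add_one hi]
  · rfl

theorem bOp_mem {n : ℕ} {Ψ : Fock s} (h : Ψ ∈ sector s n) (k p : Mom) :
    bOp s k p Ψ ∈ sector s n := by
  simp only [bOp, smul_apply, sum_apply, ContinuousLinearMap.comp_apply]
  exact Submodule.smul_mem _ _ (Submodule.sum_mem _ fun σ _ => cre_ann_mem h _ _)

theorem adjoint_bOp_mem {n : ℕ} {Ψ : Fock s} (h : Ψ ∈ sector s n) (k p : Mom) :
    ContinuousLinearMap.adjoint (bOp s k p) Ψ ∈ sector s n := by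
  simp only [bOp, LinearIsometryEquiv.map_smulₛₗ, map_sum, ContinuousLinearMap.adjoint_comp,
    adjoint_cre, smul_apply, sum_apply, ContinuousLinearMap.comp_apply]
  exact Submodule.smul_mem _ _ (Submodule.sum_mem _ fun σ _ => cre_ann_mem h _ _)

theorem lowOp_mem {Ψ : Fock s} (h : Ψ ∈ HN s kF) (V : Mom → ℝ) (l : Mom) :
    lowOp s kF V l Ψ ∈ HN s kF := by
  simp only [lowOp, smul_apply, sum_apply, ContinuousLinearMap.comp_apply]
  exact Submodule.smul_mem _ _ (Submodule.sum_mem _ fun p _ => Submodule.sum_mem _ fun q _ =>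
    Submodule.smul_mem _ _ (bOp_mem (bOp_mem h _ _) _ _))

theorem adjoint_lowOp_mem {Ψ : Fock s} (h : Ψ ∈ HN s kF) (V : Mom → ℝ) (l : Mom) :
    ContinuousLinearMap.adjoint (lowOp s kF V l) Ψ ∈ HN s kF := by
  simp only [lowOp, LinearIsometryEquiv.map_smulₛₗ, map_sum, ContinuousLinearMap.adjoint_comp,
    smul_apply, sum_apply, ContinuousLinearMap.comp_apply]
  exact Submodule.smul_mem _ _ (Submodule.sum_mem _ fun p _ => Submodule.sum_mem _ fun q _ =>
    Submodule.smul_mem _ _ (adjoint_bOp_mem (adjoint_bOp_mem h _ _) _ _))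

/-- `½ ∑_{p,q ∈ L_l} ⟨e_p, K_l e_q⟩ b_{l,p} b_{-l,-q}` on `H_N`. -/
noncomputable def low (s : ℕ) (kF : ℝ) (V : Mom → ℝ) (l : Mom) :
    HSpace s kF →L[ℂ] HSpace s kF :=
  ContinuousLinearMap.adjoint (incl s kF) ∘L lowOp s kF V l ∘L incl s kF

theorem adjoint_low (V : Mom → ℝ) (l : Mom) : ContinuousLinearMap.adjoint (low s kF V l) =
    ContinuousLinearMap.adjoint (incl s kF) ∘L
      ContinuousLinearMap.adjoint (lowOp s kF V l) ∘L incl s kF := by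
  rw [low, ContinuousLinearMap.adjoint_comp, ContinuousLinearMap.adjoint_comp,
    ContinuousLinearMap.adjoint_adjoint, ContinuousLinearMap.comp_assoc]

theorem calKTerm_eq (V : Mom → ℝ) (l : MomStar) : calKTerm s kF V l =
    low s kF V l - ContinuousLinearMap.adjoint (low s kF V l) := by
  rw [adjoint_low, low, calKTerm, calKTermFock_eq, ContinuousLinearMap.sub_comp,
    ContinuousLinearMap.comp_sub]

theorem incl_low (V : Mom → ℝ) (l : Mom) (Ψ : HSpace s kF) :
    incl s kF (low s kF V l Ψ) = lowOp s kF V l (incl s kF Ψ) :=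
  incl_adjoint_incl (lowOp_mem (incl_mem Ψ) V l)

theorem incl_adjoint_low (V : Mom → ℝ) (l : Mom) (Ψ : HSpace s kF) :
    incl s kF (ContinuousLinearMap.adjoint (low s kF V l) Ψ) =
      ContinuousLinearMap.adjoint (lowOp s kF V l) (incl s kF Ψ) := by
  rw [adjoint_low]
  exact incl_adjoint_incl (adjoint_lowOp_mem (incl_mem Ψ) V l)

/-- The commutator of a bounded operator with the two-body operator. -/
noncomputable def comm (k : Mom) (A : HSpace s kF →L[ℂ] HSpace s kF) :
    HSpace s kF →L[ℂ] HSpace s kF :=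
  A ∘L twoBody s kF k - twoBody s kF k ∘L A

theorem tendsto_inner_comm (V : Mom → ℝ) (k l : Mom) (Φ Ψ : HSpace s kF) :
    Tendsto (fun Z => ⟪incl s kF Φ,
      lowOp s kF V l (truncQ kF (outPart kF Z) k (incl s kF Ψ)) -
        truncQ kF (outPart kF Z) k (lowOp s kF V l (incl s kF Ψ))⟫_ℂ) atTop
      (𝓝 ⟪Φ, comm k (low s kF V l) Ψ⟫_ℂ) := by
  have h1 := tendsto_inner_truncQ k (ContinuousLinearMap.adjoint (low s kF V l) Φ) Ψ
  have h2 := tendsto_inner_truncQ k Φ (low s kF V l Ψ)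
  have e : ⟪Φ, comm k (low s kF V l) Ψ⟫_ℂ =
      ⟪ContinuousLinearMap.adjoint (low s kF V l) Φ, twoBody s kF k Ψ⟫_ℂ -
        ⟪Φ, twoBody s kF k (low s kF V l Ψ)⟫_ℂ := by
    rw [comm, sub_apply, inner_sub_right, ContinuousLinearMap.adjoint_inner_left]
    rfl
  rw [e]
  refine (h1.sub h2).congr fun Z => ?_
  rw [incl_adjoint_low, incl_low, inner_sub_right, ContinuousLinearMap.adjoint_inner_left]

theorem sum_norm_inner_comm_le_of_forall {F : Finset MomStar} {V : Mom → ℝ} {l : Mom}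
    {Φ Ψ : HSpace s kF} {c : ℝ}
    (h : ∀ X : Finset (Mode s), (∀ i ∈ X, i.1 ∉ fermiBall kF) →
      (∀ α : LowIdx s kF l, α.i ∈ X ∧ α.j ∈ X) →
      ∑ k ∈ F, V k * ‖⟪incl s kF Φ, lowOp s kF V l (truncQ kF X k (incl s kF Ψ)) -
        truncQ kF X k (lowOp s kF V l (incl s kF Ψ))⟫_ℂ‖ ≤ c) :
    ∑ k ∈ F, V k * ‖⟪Φ, comm k (low s kF V l) Ψ⟫_ℂ‖ ≤ c := by
  classical
  refine le_of_tendsto (tendsto_finsetSum _ fun (k : MomStar) _ =>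
    ((tendsto_inner_comm V k l Φ Ψ).norm.const_mul (V k))) ?_
  -- The lune is finite, so eventually the truncation contains every particle mode that the lowering
  -- operator uses.
  filter_upwards [eventually_ge_atTop ((Finset.univ.image fun α : LowIdx s kF l => α.i) ∪
    Finset.univ.image fun α : LowIdx s kF l => α.j)] with Z hZ
  refine h _ (fun i hi => (mem_outPart.1 hi).2) fun α => ⟨mem_outPart.2 ⟨hZ ?_, α.i_notMem⟩,
    mem_outPart.2 ⟨hZ ?_, α.j_notMem⟩⟩
  · exact Finset.mem_union_left _ (Finset.mem_image_of_mem _ (Finset.mem_univ α))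
  · exact Finset.mem_union_right _ (Finset.mem_image_of_mem _ (Finset.mem_univ α))

/-- Crude in the particle number; it is needed only for operator-norm convergence of the commutator
series. -/
theorem sum_norm_inner_comm_le (hs : 1 ≤ s) (F : Finset MomStar) {V : Mom → ℝ}
    (hV0 : ∀ k : MomStar, 0 ≤ V k) (l : Mom) (Φ Ψ : HSpace s kF) :
    ∑ k ∈ F, V k * ‖⟪Φ, comm k (low s kF V l) Ψ⟫_ℂ‖ ≤
      √(∑ k ∈ F, V k ^ 2) * kNorm s kF V l *
        ((2 * (s * (fermiBall kF).card : ℕ) + 1) * (s * (fermiBall kF).card : ℕ) ^ 2 *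
          (‖Φ‖ * ‖Ψ‖)) := by
  refine sum_norm_inner_comm_le_of_forall fun X hX hl =>
    (sum_norm_inner_lowOp_commutator_le hs F hV0 l hX hl (incl_mem Φ) (incl_mem Ψ)).trans
      (mul_le_mul_of_nonneg_left ?_ (mul_nonneg (Real.sqrt_nonneg _) (kNorm_nonneg s kF V l)))
  have h1 := norm_excNum_le (incl_mem Φ)
  have h2 := norm_excNum_le (incl_mem Ψ)
  have h3 := norm_excNum_le (excNum_mem (incl_mem Ψ))
  rw [norm_incl] at h1 h2 ⊢
  set m : ℝ := ((s * (fermiBall kF).card : ℕ) : ℝ) with hm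
  have hm0 : 0 ≤ m := Nat.cast_nonneg _
  calc _ ≤ (2 * (m * ‖Φ‖) + ‖Φ‖) * (m * (m * ‖Ψ‖)) := by
        gcongr
        exact h3.trans (by gcongr)
    _ = _ := by ring

theorem sum_norm_inner_self_comm_le (hs : 1 ≤ s) (F : Finset MomStar) {V : Mom → ℝ}
    (hV0 : ∀ k : MomStar, 0 ≤ V k) (l : Mom) (Ψ : HSpace s kF) :
    ∑ k ∈ F, V k * ‖⟪Ψ, comm k (low s kF V l) Ψ⟫_ℂ‖ ≤
      √(∑ k ∈ F, V k ^ 2) * kNorm s kF V l *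
        (6 * (⟪incl s kF Ψ, excNum kF (excNum kF (excNum kF (incl s kF Ψ)))
          + incl s kF Ψ⟫_ℂ).re) :=
  sum_norm_inner_comm_le_of_forall fun _ hX hl =>
    sum_norm_inner_self_lowOp_commutator_le hs F hV0 l hX hl (incl_mem Ψ)

end TwoBody

end FermiGas

namespace FermiGas

open Filter Topology

/-! ### Conjugation of bounded operators by one-parameter unitary groups -/

section Conjugation

variable {H : Type*} [NormedAddCommGroup H] [InnerProductSpace ℂ H] [CompleteSpace H]

theorem hasDerivAt_exp_ofReal_smul (K : H →L[ℂ] H) (t : ℝ) :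
    HasDerivAt (fun u : ℝ => NormedSpace.exp ((u : ℂ) • K))
      (NormedSpace.exp ((t : ℂ) • K) * K) t := by
  simp only [Complex.coe_smul]
  exact hasDerivAt_exp_smul_const (𝕂 := ℝ) K t

theorem hasDerivAt_exp_neg_ofReal_smul (K : H →L[ℂ] H) (t : ℝ) :
    HasDerivAt (fun u : ℝ => NormedSpace.exp (-((u : ℂ) • K)))
      (-K * NormedSpace.exp (-((t : ℂ) • K))) t := by
  simp only [Complex.coe_smul, ← smul_neg]
  exact hasDerivAt_exp_smul_const' (𝕂 := ℝ) (-K) t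

/-- `⟨Ψ, e^{tK} T e^{-tK} Ψ⟩`. -/
noncomputable def conjForm (K T : H →L[ℂ] H) (Ψ : H) (t : ℝ) : ℂ :=
  ⟪Ψ, NormedSpace.exp ((t : ℂ) • K) (T (NormedSpace.exp (-((t : ℂ) • K)) Ψ))⟫_ℂ

theorem continuous_conjForm (K : H →L[ℂ] H) (Ψ : H) :
    Continuous fun p : (H →L[ℂ] H) × ℝ => conjForm K p.1 Ψ p.2 := by
  have h1 : Continuous fun t : ℝ => NormedSpace.exp ((t : ℂ) • K) :=
    continuous_iff_continuousAt.2 fun t => (hasDerivAt_exp_ofReal_smul K t).continuousAt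
  have h2 : Continuous fun t : ℝ => NormedSpace.exp (-((t : ℂ) • K)) :=
    continuous_iff_continuousAt.2 fun t => (hasDerivAt_exp_neg_ofReal_smul K t).continuousAt
  exact continuous_const.inner ((h1.comp continuous_snd).clm_apply (continuous_fst.clm_apply
    ((h2.comp continuous_snd).clm_apply continuous_const)))

theorem hasDerivAt_conjForm (K T : H →L[ℂ] H) (Ψ : H) (t : ℝ) :
    HasDerivAt (conjForm K T Ψ) (conjForm K (K * T - T * K) Ψ t) t := by
  have h3 := ((hasDerivAt_exp_ofReal_smul K t).mul_const T).mul
    (hasDerivAt_exp_neg_ofReal_smul K t)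
  have h4 := (((innerSL ℂ Ψ).comp (ContinuousLinearMap.apply ℂ H Ψ)).restrictScalars
    ℝ).hasFDerivAt.comp_hasDerivAt t h3
  refine h4.congr_deriv ?_
  simp [conjForm, sub_eq_add_neg, inner_add_right]

theorem integral_conjForm (K T : H →L[ℂ] H) (Ψ : H) :
    ∫ t in (0 : ℝ)..1, conjForm K (K * T - T * K) Ψ t =
      ⟪Ψ, NormedSpace.exp K (T (NormedSpace.exp (-K) Ψ))⟫_ℂ - ⟪Ψ, T Ψ⟫_ℂ := by
  have hc : Continuous fun t : ℝ => conjForm K (K * T - T * K) Ψ t :=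
    (continuous_conjForm K Ψ).comp (continuous_const.prodMk continuous_id)
  rw [intervalIntegral.integral_eq_sub_of_hasDerivAt (fun t _ => hasDerivAt_conjForm K T Ψ t)
    (hc.intervalIntegrable _ _)]
  simp [conjForm, NormedSpace.exp_zero]

theorem continuous_integral_conjForm (K : H →L[ℂ] H) (Ψ : H) :
    Continuous fun T : H →L[ℂ] H => ∫ t in (0 : ℝ)..1, conjForm K T Ψ t :=
  intervalIntegral.continuous_parametric_intervalIntegral_of_continuous'
    (continuous_conjForm K Ψ) 0 1

theorem integral_conjForm_add (K T T' : H →L[ℂ] H) (Ψ : H) :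
    ∫ t in (0 : ℝ)..1, conjForm K (T + T') Ψ t =
      (∫ t in (0 : ℝ)..1, conjForm K T Ψ t) + ∫ t in (0 : ℝ)..1, conjForm K T' Ψ t := by
  have hc : ∀ T : H →L[ℂ] H, Continuous fun t : ℝ => conjForm K T Ψ t := fun T =>
    (continuous_conjForm K Ψ).comp (continuous_const.prodMk continuous_id)
  rw [← intervalIntegral.integral_add ((hc T).intervalIntegrable _ _)
    ((hc T').intervalIntegrable _ _)]
  simp [conjForm]

theorem integral_conjForm_smul (c : ℂ) (K T : H →L[ℂ] H) (Ψ : H) :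
    ∫ t in (0 : ℝ)..1, conjForm K (c • T) Ψ t = c * ∫ t in (0 : ℝ)..1, conjForm K T Ψ t := by
  rw [← intervalIntegral.integral_const_mul]
  simp [conjForm]

/-- The integral is additive and continuous in T for the operator norm, so it may be exchanged with
a norm-convergent series. -/
theorem hasSum_integral_conjForm {ι : Type*} {T : ι → H →L[ℂ] H} {S : H →L[ℂ] H}
    (h : HasSum T S) (K : H →L[ℂ] H) (Ψ : H) :
    HasSum (fun i => ∫ t in (0 : ℝ)..1, conjForm K (T i) Ψ t)
      (∫ t in (0 : ℝ)..1, conjForm K S Ψ t) := by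
  let L : (H →L[ℂ] H) →+ ℂ := AddMonoidHom.mk' (fun T => ∫ t in (0 : ℝ)..1, conjForm K T Ψ t)
    fun T T' => integral_conjForm_add K T T' Ψ
  exact h.map L (continuous_integral_conjForm K Ψ)

theorem adjoint_exp (K : H →L[ℂ] H) : ContinuousLinearMap.adjoint (NormedSpace.exp K) =
    NormedSpace.exp (ContinuousLinearMap.adjoint K) := by
  rw [← ContinuousLinearMap.star_eq_adjoint, ← ContinuousLinearMap.star_eq_adjoint,
    NormedSpace.star_exp]

/-- Duhamel's formula for the conjugation by `e^{A - A†}`. -/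
theorem inner_exp_conj (A Q : H →L[ℂ] H) (hQ : ContinuousLinearMap.adjoint Q = Q) (Ψ : H) :
    ⟪NormedSpace.exp (-(A - ContinuousLinearMap.adjoint A)) Ψ,
      Q (NormedSpace.exp (-(A - ContinuousLinearMap.adjoint A)) Ψ)⟫_ℂ = ⟪Ψ, Q Ψ⟫_ℂ +
      ∫ t in (0 : ℝ)..1, conjForm (A - ContinuousLinearMap.adjoint A)
        ((A ∘L Q - Q ∘L A) + ContinuousLinearMap.adjoint (A ∘L Q - Q ∘L A)) Ψ t := by
  set K := A - ContinuousLinearMap.adjoint A with hK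
  have h1 : (A ∘L Q - Q ∘L A) + ContinuousLinearMap.adjoint (A ∘L Q - Q ∘L A) =
      K * Q - Q * K := by
    rw [map_sub, ContinuousLinearMap.adjoint_comp, ContinuousLinearMap.adjoint_comp, hQ, hK,
      sub_mul, mul_sub]
    simp only [ContinuousLinearMap.mul_def]
    abel
  have h2 : ContinuousLinearMap.adjoint (NormedSpace.exp (-K)) = NormedSpace.exp K := by
    rw [adjoint_exp, hK]
    simp
  rw [h1, integral_conjForm, ← ContinuousLinearMap.adjoint_inner_right, h2]
  ring

end Conjugation

end FermiGas

namespace FermiGas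

open Filter Topology

/-! ### The kernel and the commutator on `H_N` -/

section Kernel

variable {s : ℕ} {kF : ℝ} {V : Mom → ℝ}

theorem norm_ann_le (i : Mode s) : ‖ann i‖ ≤ 1 := LinearMap.mkContinuous_norm_le _ zero_le_one _

theorem norm_tann_le (i : Mode s) (Ψ : Fock s) : ‖tann kF i Ψ‖ ≤ ‖Ψ‖ := by
  have h : ‖tann kF i‖ ≤ 1 := by
    by_cases hi : i.1 ∈ fermiBall kF
    · rw [tann_of_mem hi, cre, LinearIsometryEquiv.norm_map]
      exact norm_ann_le i
    · rw [tann_of_notMem hi]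
      exact norm_ann_le i
  simpa using (tann kF i).le_of_opNorm_le h Ψ

/-- At most (s|B_F|)² terms, each a product of contractions; Cauchy–Schwarz over the coefficients.
It is used only for convergence of 𝒦. -/
theorem norm_lowOp_apply_le (hs : 1 ≤ s) (V : Mom → ℝ) (l : Mom) (Ψ : Fock s) :
    ‖lowOp s kF V l Ψ‖ ≤ (s * (fermiBall kF).card : ℕ) * kNorm s kF V l * ‖Ψ‖ := by
  have h1 : ‖lowOp s kF V l Ψ‖ ≤ ∑ α : LowIdx s kF l, |α.coeff V| * ‖Ψ‖ := by
    rw [lowOp_apply hs]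
    refine norm_sum_le_of_le _ fun α _ => ?_
    rw [norm_smul, Complex.norm_real, Real.norm_eq_abs]
    gcongr
    exact (norm_tann_le _ _).trans ((norm_tann_le _ _).trans ((norm_tann_le _ _).trans
      (norm_tann_le _ _)))
  have hcard : (lune kF l).card ≤ (fermiBall kF).card :=
    (Finset.card_le_card Finset.sdiff_subset).trans Finset.card_image_le
  have h2 : ∑ α : LowIdx s kF l, |α.coeff V| ≤
      (s * (fermiBall kF).card : ℕ) * (kNorm s kF V l / 2) := by
    have h3 := Real.sum_mul_le_sqrt_mul_sqrt Finset.univ (fun _ : LowIdx s kF l => (1 : ℝ))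
      fun α => |α.coeff V|
    simp only [one_mul, one_pow, sq_abs] at h3
    rw [sum_coeff_sq hs, Real.sqrt_sq (div_nonneg (kNorm_nonneg s kF V l) zero_le_two)] at h3
    refine h3.trans (mul_le_mul_of_nonneg_right ?_
      (div_nonneg (kNorm_nonneg s kF V l) zero_le_two))
    refine Real.sqrt_le_iff.2 ⟨Nat.cast_nonneg _, ?_⟩
    simp only [Finset.sum_const, Finset.card_univ, Fintype.card_prod, Fintype.card_fin,
      Fintype.card_coe, nsmul_eq_mul, mul_one]
    norm_cast
    calc (lune kF l).card * (lune kF l).card * (s * s)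
        ≤ (fermiBall kF).card * (fermiBall kF).card * (s * s) := by gcongr
      _ = _ := by ring
  have h4 := kNorm_nonneg s kF V l
  calc _ ≤ (∑ α : LowIdx s kF l, |α.coeff V|) * ‖Ψ‖ := by rw [Finset.sum_mul]; exact h1
    _ ≤ (s * (fermiBall kF).card : ℕ) * (kNorm s kF V l / 2) * ‖Ψ‖ := by gcongr
    _ ≤ _ := by gcongr; linarith

theorem norm_low_le (hs : 1 ≤ s) (V : Mom → ℝ) (l : Mom) :
    ‖low s kF V l‖ ≤ (s * (fermiBall kF).card : ℕ) * kNorm s kF V l := by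
  refine ContinuousLinearMap.opNorm_le_bound _
    (mul_nonneg (Nat.cast_nonneg _) (kNorm_nonneg s kF V l)) fun Ψ => ?_
  rw [← norm_incl, incl_low, ← norm_incl Ψ]
  exact norm_lowOp_apply_le hs V l _

/-- Combines the Hilbert–Schmidt bound with the lattice sum: k_F^{-1} from v_l against k_F² from the
lunes leaves O(k_F) times the error scale. -/
theorem sum_kNorm_le (hk : 1 ≤ kF) (hV : Summable fun k : MomStar => V k ^ 2)
    (hV0 : ∀ k : MomStar, 0 ≤ V k) (F : Finset MomStar) :
    ∑ l ∈ F, kNorm s kF V l ≤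
      s * kF⁻¹ / (4 * (2 * Real.pi) ^ 3) * (errScale kF V * (10 ^ 6 * kF ^ 2)) := by
  have hk0 : 0 < kF := by linarith
  have h1 : ∀ l ∈ F, kNorm s kF V l ≤
      s * kF⁻¹ / (4 * (2 * Real.pi) ^ 3) * (V l * luneSum kF l) := fun l _ =>
    kNorm_le hk0 (hV0 l)
  refine (Finset.sum_le_sum h1).trans ?_
  rw [← Finset.mul_sum]
  exact mul_le_mul_of_nonneg_left (sum_V_luneSum_le hk hV F) (by positivity)

theorem summable_kNorm (hk : 1 ≤ kF) (hV : Summable fun k : MomStar => V k ^ 2)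
    (hV0 : ∀ k : MomStar, 0 ≤ V k) : Summable fun l : MomStar => kNorm s kF V l :=
  summable_of_sum_le (fun l => kNorm_nonneg s kF V l) (sum_kNorm_le hk hV hV0)

theorem summable_low (hs : 1 ≤ s) (hK : Summable fun l : MomStar => kNorm s kF V l) :
    Summable fun l : MomStar => low s kF V l :=
  Summable.of_norm_bounded (hK.mul_left _) fun l => norm_low_le hs V l

/-- The lowering part of the kernel. -/
noncomputable def lowSum (s : ℕ) (kF : ℝ) (V : Mom → ℝ) : HSpace s kF →L[ℂ] HSpace s kF :=
  ∑' l : MomStar, low s kF V l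

theorem hasSum_calKTerm (hs : 1 ≤ s) (hK : Summable fun l : MomStar => kNorm s kF V l) :
    HasSum (calKTerm s kF V) (lowSum s kF V - ContinuousLinearMap.adjoint (lowSum s kF V)) := by
  have h := (summable_low hs hK).hasSum
  have h' := h.map (ContinuousLinearMap.adjoint : (HSpace s kF →L[ℂ] HSpace s kF) ≃ₗᵢ⋆[ℂ] _)
    (LinearIsometryEquiv.continuous _)
  exact (h.sub h').congr_fun fun l => calKTerm_eq V l

theorem calK_eq (hs : 1 ≤ s) (hK : Summable fun l : MomStar => kNorm s kF V l) :
    calK s kF V = lowSum s kF V - ContinuousLinearMap.adjoint (lowSum s kF V) :=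
  (hasSum_calKTerm hs hK).tsum_eq

theorem sum_norm_inner_comm_lowSum_le (hs : 1 ≤ s)
    (hK : Summable fun l : MomStar => kNorm s kF V l) {F : Finset MomStar}
    (hV0 : ∀ k : MomStar, 0 ≤ V k) {Φ Ψ : HSpace s kF} {c : ℝ} (hc : 0 ≤ c)
    (h : ∀ l : MomStar, ∑ k ∈ F, V k * ‖⟪Φ, comm k (low s kF V l) Ψ⟫_ℂ‖ ≤
      √(∑ k ∈ F, V k ^ 2) * kNorm s kF V l * c) :
    ∑ k ∈ F, V k * ‖⟪Φ, comm k (lowSum s kF V) Ψ⟫_ℂ‖ ≤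
      √(∑ k ∈ F, V k ^ 2) * (∑' l : MomStar, kNorm s kF V l) * c := by
  have hsum := (summable_low hs hK).hasSum
  have happ : ∀ Ω : HSpace s kF, HasSum (fun l : MomStar => low s kF V l Ω) (lowSum s kF V Ω) :=
    fun Ω => hsum.mapL (ContinuousLinearMap.apply ℂ (HSpace s kF) Ω)
  have hcomm : ∀ k : Mom, HasSum (fun l : MomStar => ⟪Φ, comm k (low s kF V l) Ψ⟫_ℂ)
      ⟪Φ, comm k (lowSum s kF V) Ψ⟫_ℂ := fun k =>
    ((happ (twoBody s kF k Ψ)).sub ((happ Ψ).mapL (twoBody s kF k))).mapL (innerSL ℂ Φ)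
  refine le_of_tendsto (tendsto_finsetSum _ fun (k : MomStar) _ =>
    (hcomm k).norm.const_mul (V k)) (Eventually.of_forall fun L => ?_)
  have h1 : ∀ k ∈ F, V k * ‖∑ l ∈ L, ⟪Φ, comm k (low s kF V l) Ψ⟫_ℂ‖ ≤
      ∑ l ∈ L, V k * ‖⟪Φ, comm k (low s kF V l) Ψ⟫_ℂ‖ := fun k _ => by
    rw [← Finset.mul_sum]
    exact mul_le_mul_of_nonneg_left (norm_sum_le _ _) (hV0 k)
  refine (Finset.sum_le_sum h1).trans ?_
  rw [Finset.sum_comm]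
  refine (Finset.sum_le_sum fun l _ => h l).trans ?_
  rw [← Finset.sum_mul, ← Finset.mul_sum]
  gcongr
  exact hK.sum_le_tsum _ fun l _ => kNorm_nonneg s kF V l

theorem norm_le_of_norm_inner_le {H : Type*} [NormedAddCommGroup H] [InnerProductSpace ℂ H]
    {T : H →L[ℂ] H} {c : ℝ} (hc : 0 ≤ c) (h : ∀ Φ Ψ : H, ‖⟪Φ, T Ψ⟫_ℂ‖ ≤ c * (‖Φ‖ * ‖Ψ‖)) :
    ‖T‖ ≤ c := by
  refine T.opNorm_le_bound hc fun Ψ => ?_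
  have h1 := h (T Ψ) Ψ
  rw [inner_self_eq_norm_sq_to_K, norm_pow, RCLike.norm_ofReal, abs_norm] at h1
  rcases (norm_nonneg (T Ψ)).eq_or_lt with h0 | h0
  · rw [← h0]; positivity
  · nlinarith

/-- The terms of the commutator of the kernel with the short-range part. -/
noncomputable def commTerm (s : ℕ) (kF : ℝ) (V : Mom → ℝ) (k : MomStar) :
    HSpace s kF →L[ℂ] HSpace s kF :=
  (V k : ℂ) • comm k.1 (lowSum s kF V)

theorem norm_inner_sum_commTerm_le (F : Finset MomStar) (hV0 : ∀ k : MomStar, 0 ≤ V k)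
    (Φ Ψ : HSpace s kF) : ‖⟪Φ, (∑ k ∈ F, commTerm s kF V k) Ψ⟫_ℂ‖ ≤
      ∑ k ∈ F, V k * ‖⟪Φ, comm k (lowSum s kF V) Ψ⟫_ℂ‖ := by
  rw [sum_apply, inner_sum]
  refine norm_sum_le_of_le _ fun k _ => ?_
  rw [commTerm, smul_apply, inner_smul_right, norm_mul, Complex.norm_real, Real.norm_eq_abs,
    abs_of_nonneg (hV0 k)]

/-- A partial sum over F has norm at most a constant times (Σ_{k ∈ F} V_k²)^{1/2}, so the Cauchy
criterion holds although V is merely square summable. -/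
theorem summable_commTerm (hs : 1 ≤ s) (hK : Summable fun l : MomStar => kNorm s kF V l)
    (hV : Summable fun k : MomStar => V k ^ 2) (hV0 : ∀ k : MomStar, 0 ≤ V k) :
    Summable (commTerm s kF V) := by
  set m : ℝ := ((s * (fermiBall kF).card : ℕ) : ℝ) with hm
  have hm0 : 0 ≤ m := Nat.cast_nonneg _
  set S := ∑' l : MomStar, kNorm s kF V l with hS
  have hS0 : 0 ≤ S := tsum_nonneg (L := SummationFilter.unconditional _)
    fun l => kNorm_nonneg s kF V l
  refine summable_of_sq_norm_sum_le (hV.mul_left ((S * ((2 * m + 1) * m ^ 2)) ^ 2)) fun F => ?_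
  have h1 : ‖∑ k ∈ F, commTerm s kF V k‖ ≤
      √(∑ k ∈ F, V k ^ 2) * (S * ((2 * m + 1) * m ^ 2)) := by
    refine norm_le_of_norm_inner_le (by positivity) fun Φ Ψ => ?_
    refine (norm_inner_sum_commTerm_le F hV0 Φ Ψ).trans
      ((sum_norm_inner_comm_lowSum_le hs hK hV0 (by positivity) fun l =>
        sum_norm_inner_comm_le hs F hV0 l Φ Ψ).trans (le_of_eq ?_))
    ring
  refine (pow_le_pow_left₀ (norm_nonneg _) h1 2).trans (le_of_eq ?_)
  rw [mul_pow, Real.sq_sqrt (Finset.sum_nonneg fun _ _ => sq_nonneg _), ← Finset.mul_sum, mul_comm]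

/-- The operator whose real part is the derivative of the conjugated short-range part. -/
noncomputable def commSum (s : ℕ) (kF : ℝ) (V : Mom → ℝ) : HSpace s kF →L[ℂ] HSpace s kF :=
  ((kF⁻¹ / (2 * (2 * Real.pi) ^ 3) : ℝ) : ℂ) • ∑' k : MomStar, commTerm s kF V k

/-- Duhamel's formula for each bounded T_k, summed over k. Both series on the right converge, the
first by the kinetic domain and the second in operator norm, and so the series on the transformed
vector converges too. -/
theorem hasSum_SRTerm_exp (hs : 1 ≤ s) (hK : Summable fun l : MomStar => kNorm s kF V l)
    (hV : Summable fun k : MomStar => V k ^ 2) (hV0 : ∀ k : MomStar, 0 ≤ V k)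
    {Ψ : HSpace s kF} (hΨ : incl s kF Ψ ∈ kinDomain s kF) :
    HasSum (SRTerm kF V (incl s kF (NormedSpace.exp (-calK s kF V) Ψ)))
      (∑' k : MomStar, SRTerm kF V (incl s kF Ψ) k +
        ∫ t in (0 : ℝ)..1, conjForm (calK s kF V) ((∑' k : MomStar, commTerm s kF V k) +
          ContinuousLinearMap.adjoint (∑' k : MomStar, commTerm s kF V k)) Ψ t) := by
  have h1 := (summable_commTerm hs hK hV hV0).hasSum
  have h2 := h1.map (ContinuousLinearMap.adjoint : (HSpace s kF →L[ℂ] HSpace s kF) ≃ₗᵢ⋆[ℂ] _)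
    (LinearIsometryEquiv.continuous _)
  have h3 := hasSum_integral_conjForm (h1.add h2) (calK s kF V) Ψ
  refine ((summable_SRTerm hV hΨ).hasSum.add h3).congr_fun fun k => ?_
  have h4 := inner_exp_conj (lowSum s kF V) (twoBody s kF k.1) (adjoint_twoBody k.1) Ψ
  rw [← calK_eq hs hK] at h4
  rw [SRTerm_incl, SRTerm_incl, h4, mul_add, ← integral_conjForm_smul]
  congr 2
  ext t
  rw [Function.comp_apply, commTerm, LinearIsometryEquiv.map_smulₛₗ, Complex.conj_ofReal,
    ← smul_add]
  rfl

theorem SRForm_exp (hs : 1 ≤ s) (hK : Summable fun l : MomStar => kNorm s kF V l)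
    (hV : Summable fun k : MomStar => V k ^ 2) (hV0 : ∀ k : MomStar, 0 ≤ V k)
    {Ψ : HSpace s kF} (hΨ : incl s kF Ψ ∈ kinDomain s kF) :
    SRForm kF V (incl s kF (NormedSpace.exp (-calK s kF V) Ψ)) =
      SRForm kF V (incl s kF Ψ) + ∫ t in (0 : ℝ)..1, conjForm (calK s kF V)
        (commSum s kF V + ContinuousLinearMap.adjoint (commSum s kF V)) Ψ t := by
  rw [SRForm, (hasSum_SRTerm_exp hs hK hV hV0 hΨ).tsum_eq, mul_add, SRForm, commSum,
    LinearIsometryEquiv.map_smulₛₗ, Complex.conj_ofReal, ← smul_add, integral_conjForm_smul]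

theorem norm_inner_commSum_le (hs : 1 ≤ s) (hk : 1 ≤ kF) {M : ℝ}
    (hM : HasSum (fun k : MomStar => V k ^ 2) M) (hV0 : ∀ k : MomStar, 0 ≤ V k)
    (Ψ : HSpace s kF) : ‖⟪Ψ, commSum s kF V Ψ⟫_ℂ‖ ≤
      10 ^ 6 * (s + 1) * (√M + 1) * errScale kF V *
        (⟪incl s kF Ψ, excNum kF (excNum kF (excNum kF (incl s kF Ψ)))
          + incl s kF Ψ⟫_ℂ).re := by
  have hK := summable_kNorm (s := s) hk hM.summable hV0
  set E := (⟪incl s kF Ψ, excNum kF (excNum kF (excNum kF (incl s kF Ψ)))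
    + incl s kF Ψ⟫_ℂ).re with hE
  have hE0 : 0 ≤ E := (hasSum_cube (incl_mem Ψ)).nonneg fun S => by positivity
  have hpi : 1 ≤ (2 * Real.pi) ^ 3 := one_le_pow₀ (by linarith [Real.pi_gt_three])
  have hk0 : 0 < kF := by linarith
  set S := ∑' l : MomStar, kNorm s kF V l with hS
  have hS0 : 0 ≤ S := tsum_nonneg (L := SummationFilter.unconditional _)
    fun l => kNorm_nonneg s kF V l
  have he0 : 0 ≤ errScale kF V := errScale_nonneg
  have h1 : ‖⟪Ψ, (∑' k : MomStar, commTerm s kF V k) Ψ⟫_ℂ‖ ≤ √M * S * (6 * E) := by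
    have ht := ((summable_commTerm hs hK hM.summable hV0).hasSum.mapL
      (ContinuousLinearMap.apply ℂ (HSpace s kF) Ψ)).mapL (innerSL ℂ Ψ)
    refine le_of_tendsto ht.norm (Eventually.of_forall fun F => ?_)
    have h2 := (norm_inner_sum_commTerm_le F hV0 Ψ Ψ).trans
      (sum_norm_inner_comm_lowSum_le hs hK hV0 (by positivity) fun l =>
        sum_norm_inner_self_comm_le hs F hV0 l Ψ)
    rw [sum_apply, inner_sum] at h2
    refine h2.trans ?_
    gcongr
    exact sum_le_hasSum F (fun k _ => sq_nonneg _) hM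
  have h3 : S ≤ s * kF⁻¹ / (4 * (2 * Real.pi) ^ 3) * (errScale kF V * (10 ^ 6 * kF ^ 2)) :=
    Real.tsum_le_of_sum_le (fun l => kNorm_nonneg s kF V l) (sum_kNorm_le hk hM.summable hV0)
  -- Here all powers of k_F cancel: k_F^{-1} from the prefactor of Q_SR, k_F^{-1} from v_l, k_F²
  -- from the lunes.
  have h4 : kF⁻¹ * S ≤ s * (errScale kF V * 10 ^ 6) / 4 := by
    calc kF⁻¹ * S ≤ kF⁻¹ * (s * kF⁻¹ / (4 * (2 * Real.pi) ^ 3) *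
          (errScale kF V * (10 ^ 6 * kF ^ 2))) := by gcongr
      _ ≤ kF⁻¹ * (s * kF⁻¹ / (4 * 1) * (errScale kF V * (10 ^ 6 * kF ^ 2))) := by gcongr
      _ = _ := by field_simp
  rw [commSum, smul_apply, inner_smul_right, norm_mul, Complex.norm_real, Real.norm_eq_abs,
    abs_of_nonneg (by positivity)]
  calc _ ≤ kF⁻¹ / (2 * 1) * (√M * S * (6 * E)) := by gcongr
    _ = (kF⁻¹ * S) * (3 * √M * E) := by ring
    _ ≤ s * (errScale kF V * 10 ^ 6) / 4 * (3 * √M * E) := by gcongr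
    _ = 10 ^ 6 * s * (√M * (3 / 4)) * errScale kF V * E := by ring
    _ ≤ _ := by
        have : 0 ≤ √M := Real.sqrt_nonneg M
        gcongr <;> linarith

end Kernel

end FermiGas

/-! ### The theorem: choice of constants and assembly -/

theorem mainTheorem9 (M : ℝ) :
    ∃ (C : ℝ) (C' : ℕ → ℝ), 0 < C ∧ (∀ s, 0 < C' s) ∧
      ∀ (s : ℕ) (kF : ℝ) (V : Mom → ℝ), 1 ≤ s → 1 ≤ kF →
        (∀ k : MomStar, V (-k.1) = V k) → (∀ k : MomStar, 0 ≤ V k) →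
        HasSum (fun k : MomStar => V k ^ 2) M →
        -- all the series below converge
        ((∀ Ψ ∈ HN s kF, ∀ k : MomStar, Summable (D2Term kF k.1 Ψ)) ∧
          (∀ Ψ ∈ HN s kF, Summable (GTerm kF V Ψ)) ∧
          (∀ Ψ ∈ HN s kF, ∀ k : MomStar, Summable (SRInner kF Ψ k.1)) ∧
          (∀ Ψ ∈ kinDomain s kF, Summable (QTerm kF V Ψ) ∧ Summable (SRTerm kF V Ψ)) ∧
          Summable (calKTerm s kF V)) ∧
        -- the decomposition of the quartic term, in the sense of quadratic forms
        (∀ Ψ ∈ kinDomain s kF, QForm kF V Ψ = GForm kF V Ψ + LRForm kF V Ψ + SRForm kF V Ψ) ∧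
        -- the bounds on `G` and `Q_LR`
        (∀ Ψ ∈ HN s kF, ‖GForm kF V Ψ‖ ≤ C * errScale kF V * (⟪Ψ, excNum kF Ψ⟫_ℂ).re) ∧
        (∀ Ψ ∈ HN s kF, ‖LRForm kF V Ψ‖ ≤
          C * errScale kF V * (⟪Ψ, excNum kF (excNum kF Ψ)⟫_ℂ).re) ∧
        -- the transformation of `Q_SR`, in the sense of quadratic forms
        ∃ 𝒢 : HSpace s kF →L[ℂ] HSpace s kF,
          (∀ Ψ : HSpace s kF, incl s kF Ψ ∈ kinDomain s kF →
            Summable (SRTerm kF V (incl s kF (NormedSpace.exp (-calK s kF V) Ψ))) ∧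
            SRForm kF V (incl s kF (NormedSpace.exp (-calK s kF V) Ψ)) =
              SRForm kF V (incl s kF Ψ) +
                ∫ t in (0 : ℝ)..1,
                  ⟪Ψ, NormedSpace.exp ((t : ℂ) • calK s kF V)
                    ((𝒢 + ContinuousLinearMap.adjoint 𝒢)
                      (NormedSpace.exp (-((t : ℂ) • calK s kF V)) Ψ))⟫_ℂ) ∧
          ∀ Ψ : HSpace s kF, ‖⟪Ψ, 𝒢 Ψ⟫_ℂ‖ ≤
            C' s * errScale kF V *
              (⟪incl s kF Ψ, excNum kF (excNum kF (excNum kF (incl s kF Ψ)))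
                + incl s kF Ψ⟫_ℂ).re := by
  -- √M is the ℓ² norm of V from Cauchy–Schwarz in k. The added ones only keep the constant positive
  -- for every s and every real M.
  refine ⟨26, fun s => 10 ^ 6 * (s + 1) * (√M + 1), by norm_num, fun s => by positivity, ?_⟩
  intro s kF V hs hk _ hV0 hM
  have hV := hM.summable
  have hK := summable_kNorm (s := s) hk hV hV0
  refine ⟨⟨fun Ψ h k => (hasSum_D2Term h k.1).summable, fun Ψ h => (hasSum_GTerm hk hV hV0 h).1,
    fun Ψ h k => (hasSum_SRInner h k.1).summable,
    fun Ψ h => ⟨(hasSum_QTerm hk hV hV0 h).summable, summable_SRTerm hV h⟩,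
    (hasSum_calKTerm hs hK).summable⟩, fun Ψ h => QForm_eq hk hV hV0 h,
    fun Ψ h => norm_GForm_le hk hV hV0 h, fun Ψ h => ?_, commSum s kF V, fun Ψ h =>
    ⟨(hasSum_SRTerm_exp hs hK hV hV0 h).summable, SRForm_exp hs hK hV hV0 h⟩,
    fun Ψ => norm_inner_commSum_le hs hk hM hV0 Ψ⟩
  rw [inner_excNum_excNum h]
  exact norm_LRForm_le hk hV hV0 h
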